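/- Let $k$ be an algebraically closed field and $n\ge 1$. Let $X$ be an irreducible algebraic variety over $k$ on which $\mathrm{PGL}_n$ acts freely, with quotient variety $X/\mathrm{PGL}_n$ (so that $X\to X/\mathrm{PGL}_n$ is a principal $\mathrm{PGL}_n$-bundle). Let $P$ be a vector bundle of weight $w\in\mathbb{Z}$ over $X$, that is, a vector bundle with an action of $\mathrm{GL}_n$, linear on the fibres, which lifts the action of $\mathrm{PGL}_n$ on $X$ and for which every scalar $t\in k^*\subset \mathrm{GL}_n$ acts on the fibres of $P$ as multiplication by $t^w$. The Brauer class defined by $P$ is the class, in the Brauer group of the function field $k(X/\mathrm{PGL}_n)$, of the generic fibre of the bundle of central simple algebras $(P^\vee\otimes P)/\mathrm{PGL}_n$ over $X/\mathrm{PGL}_n$. Let $j$ be an integer with $1\le j\le \operatorname{rk}(P)$, let $\mathrm{Gr}_j(P)\to X$ be the bundle of Grassmannians of $j$-dimensional subspaces of the fibres of $P$, with the induced free action of $\mathrm{PGL}_n$, and let $\mathrm{Gr}_j(P)/\mathrm{PGL}_n$ be the quotient variety. Assume that the Brauer class defined by $P$ is represented by a central simple algebra over $k(X/\mathrm{PGL}_n)$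 of dimension $j^2$. Then the induced map $\pi\colon \mathrm{Gr}_j(P)/\mathrm{PGL}_n\to X/\mathrm{PGL}_n$ is birationally linear, that is, $\pi$ is dominant and the function field of $\mathrm{Gr}_j(P)/\mathrm{PGL}_n$ is a purely transcendental extension of the function field of $X/\mathrm{PGL}_n$. -/

import Mathlib

open CategoryTheory AlgebraicGeometry Opposite

universe u

namespace TwistedGrassmannian

/-! ### The group schemes `GL_n` and `PGL_n` through their functors of points -/

section MatrixGroups

variable {n : ℕ} {R R' R'' : Type u} [CommRing R] [CommRing R'] [CommRing R'']

/-- Extension of scalars, along a ring homomorphism `f : R →+* R'`, of an endomorphism `φ` of the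
algebra `M_n(R)`: the `R'`-linear map sending `E_ij` to the image of `φ E_ij` in `M_n(R')`. -/
def matrixBaseChange (f : R →+* R') (φ : Matrix (Fin n) (Fin n) R →ₗ[R] Matrix (Fin n) (Fin n) R) :
    Matrix (Fin n) (Fin n) R' →ₗ[R'] Matrix (Fin n) (Fin n) R' where
  toFun N := ∑ i, ∑ j, N i j • (φ (Matrix.single i j 1)).map f
  map_add' N N' := by simp [add_smul, Finset.sum_add_distrib]
  map_smul' c N := by simp [mul_smul, Finset.smul_sum]

theorem single_one_map (f : R →+* R') (i j : Fin n) :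
    Matrix.single i j (1 : R') = (Matrix.single i j (1 : R)).map f := by
  ext c d; simp [Matrix.single_apply, apply_ite f]

theorem matrixBaseChange_single (f : R →+* R')
    (φ : Matrix (Fin n) (Fin n) R →ₗ[R] Matrix (Fin n) (Fin n) R) (i j : Fin n) :
    matrixBaseChange f φ (Matrix.single i j 1) = (φ (Matrix.single i j 1)).map f := by
  classical
  change ∑ i', ∑ j', (Matrix.single i j (1 : R')) i' j' • _ = _
  rw [Finset.sum_eq_single i, Finset.sum_eq_single j]
  · simp
  · intro b _ hb; simp [hb.symm]
  · simp
  · intro b _ hb; simp [hb.symm]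
  · simp

/-- The base change of `φ` is the unique linear map that is compatible with `φ`. -/
theorem matrixBaseChange_map (f : R →+* R')
    (φ : Matrix (Fin n) (Fin n) R →ₗ[R] Matrix (Fin n) (Fin n) R)
    (M : Matrix (Fin n) (Fin n) R) :
    matrixBaseChange f φ (M.map f) = (φ M).map f := by
  conv_rhs => rw [Matrix.matrix_eq_sum_single M]
  change ∑ i, ∑ j, f (M i j) • (φ (Matrix.single i j 1)).map f = _
  ext a b
  simp only [map_sum, Matrix.map_apply, Matrix.sum_apply, Matrix.smul_apply, smul_eq_mul]
  refine Finset.sum_congr rfl fun i _ => Finset.sum_congr rfl fun j _ => ?_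
  have : Matrix.single i j (M i j) = M i j • Matrix.single i j (1 : R) := by simp
  rw [this, map_smul, Matrix.smul_apply, smul_eq_mul, map_mul]

theorem matrix_linearMap_ext
    {φ ψ : Matrix (Fin n) (Fin n) R →ₗ[R] Matrix (Fin n) (Fin n) R}
    (h : ∀ i j, φ (Matrix.single i j 1) = ψ (Matrix.single i j 1)) : φ = ψ := by
  apply Matrix.ext_linearMap
  intro i j
  ext1
  exact h i j

theorem matrixBaseChange_comp (f : R →+* R')
    (φ ψ : Matrix (Fin n) (Fin n) R →ₗ[R] Matrix (Fin n) (Fin n) R) :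
    matrixBaseChange f (φ ∘ₗ ψ) = matrixBaseChange f φ ∘ₗ matrixBaseChange f ψ := by
  apply matrix_linearMap_ext
  intro i j
  rw [LinearMap.comp_apply, matrixBaseChange_single, matrixBaseChange_single,
    matrixBaseChange_map, LinearMap.comp_apply]

theorem matrixBaseChange_id (f : R →+* R') :
    matrixBaseChange (n := n) f LinearMap.id = LinearMap.id := by
  apply matrix_linearMap_ext
  intro i j
  rw [matrixBaseChange_single]
  ext a b
  simp [Matrix.single_apply, apply_ite f]

theorem matrixBaseChange_mul (f : R →+* R')
    (φ : Matrix (Fin n) (Fin n) R →ₐ[R] Matrix (Fin n) (Fin n) R)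
    (N N' : Matrix (Fin n) (Fin n) R') :
    matrixBaseChange f φ.toLinearMap (N * N') =
      matrixBaseChange f φ.toLinearMap N * matrixBaseChange f φ.toLinearMap N' := by
  revert N N'
  rw [LinearMap.map_mul_iff]
  apply Matrix.ext_linearMap
  intro i j
  ext1
  apply Matrix.ext_linearMap
  intro i' j'
  ext1
  change matrixBaseChange f φ.toLinearMap (Matrix.single i j 1 * Matrix.single i' j' 1) =
    matrixBaseChange f φ.toLinearMap (Matrix.single i j 1) *
      matrixBaseChange f φ.toLinearMap (Matrix.single i' j' 1)
  rw [single_one_map f, single_one_map f, ← Matrix.map_mul, matrixBaseChange_map, matrixBaseChange_map, matrixBaseChange_map,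
    ← Matrix.map_mul]
  simp

/-- Base change of automorphisms of the matrix algebra. -/
def autBaseChange (f : R →+* R')
    (φ : Matrix (Fin n) (Fin n) R ≃ₐ[R] Matrix (Fin n) (Fin n) R) :
    Matrix (Fin n) (Fin n) R' ≃ₐ[R'] Matrix (Fin n) (Fin n) R' :=
  AlgEquiv.ofLinearEquiv
    (LinearEquiv.ofLinearMap (matrixBaseChange f φ.toLinearMap)
      (matrixBaseChange f φ.symm.toLinearMap)
      (by
        rw [← matrixBaseChange_comp, ← matrixBaseChange_id f]
        congr 1; ext1 x; exact φ.apply_symm_apply x)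
      (by
        rw [← matrixBaseChange_comp, ← matrixBaseChange_id f]
        congr 1; ext1 x; exact φ.symm_apply_apply x))
    (by
      change matrixBaseChange f φ.toLinearMap 1 = 1
      have : (1 : Matrix (Fin n) (Fin n) R') = (1 : Matrix (Fin n) (Fin n) R).map f := by simp
      rw [this, matrixBaseChange_map]
      simp)
    (fun x y => matrixBaseChange_mul f φ.toAlgHom x y)

theorem autBaseChange_map (f : R →+* R')
    (φ : Matrix (Fin n) (Fin n) R ≃ₐ[R] Matrix (Fin n) (Fin n) R)
    (M : Matrix (Fin n) (Fin n) R) : autBaseChange f φ (M.map f) = (φ M).map f :=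
  matrixBaseChange_map f φ.toLinearMap M

theorem aut_ext {φ ψ : Matrix (Fin n) (Fin n) R ≃ₐ[R] Matrix (Fin n) (Fin n) R}
    (h : ∀ i j, φ (Matrix.single i j 1) = ψ (Matrix.single i j 1)) : φ = ψ := by
  have := matrix_linearMap_ext (φ := φ.toLinearMap) (ψ := ψ.toLinearMap) h
  ext1 x
  exact LinearMap.congr_fun this x

/-- Inner automorphism of the matrix algebra given by an invertible matrix. -/
def conj (g : GL (Fin n) R) : Matrix (Fin n) (Fin n) R ≃ₐ[R] Matrix (Fin n) (Fin n) R :=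
  AlgEquiv.ofLinearEquiv
    (LinearEquiv.ofLinearMap
      (LinearMap.mulLeft R g.1 ∘ₗ LinearMap.mulRight R (g⁻¹).1)
      (LinearMap.mulLeft R (g⁻¹).1 ∘ₗ LinearMap.mulRight R g.1)
      (by ext1 x; simp [mul_assoc]) (by ext1 x; simp [mul_assoc]))
    (by simp) (fun x y => by simp [mul_assoc])

theorem conj_apply (g : GL (Fin n) R) (M : Matrix (Fin n) (Fin n) R) :
    conj g M = g.1 * M * (g⁻¹).1 := by
  change g.1 * (M * (g⁻¹).1) = _
  rw [mul_assoc]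

theorem conj_mul (g h : GL (Fin n) R) : conj (g * h) = conj g * conj h := by
  ext1 M
  rw [AlgEquiv.mul_apply, conj_apply, conj_apply, conj_apply, mul_inv_rev]
  simp only [Units.val_mul, mul_assoc]

theorem conj_map (f : R →+* R') (g : GL (Fin n) R) :
    conj (Matrix.GeneralLinearGroup.map f g) = autBaseChange f (conj g) := by
  apply aut_ext
  intro i j
  rw [single_one_map f, autBaseChange_map, conj_apply, conj_apply, Matrix.map_mul, Matrix.map_mul]
  rfl

end MatrixGroups

/-- The group functor `R ↦ GL_n(R)`. -/
@[simps]
def GLFunctor (n : ℕ) : CommRingCat.{u} ⥤ GrpCat.{u} where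
  obj R := GrpCat.of (GL (Fin n) R)
  map f := GrpCat.ofHom (Matrix.GeneralLinearGroup.map f.hom)
  map_id R := by ext g; rfl
  map_comp f g := by ext x; rfl

/-- The group functor `R ↦ Aut_{R-alg}(M_n(R))`, that is, the functor of points of the group scheme
`PGL_n`; by the Skolem-Noether theorem this is the sheaf quotient of `GL_n` by its centre `𝔾_m`. -/
@[simps]
def PGLFunctor (n : ℕ) : CommRingCat.{u} ⥤ GrpCat.{u} where
  obj R := GrpCat.of (Matrix (Fin n) (Fin n) R ≃ₐ[R] Matrix (Fin n) (Fin n) R)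
  map f := GrpCat.ofHom
    { toFun φ := autBaseChange f.hom φ
      map_one' := by
        apply aut_ext
        intro i j
        rw [single_one_map f.hom, autBaseChange_map]; rfl
      map_mul' φ ψ := by
        apply aut_ext
        intro i j
        rw [single_one_map f.hom, autBaseChange_map, AlgEquiv.mul_apply, AlgEquiv.mul_apply,
          autBaseChange_map, autBaseChange_map] }
  map_id R := by
    ext φ : 2
    apply aut_ext
    intro i j
    exact matrixBaseChange_single _ _ _ _
  map_comp f g := by
    ext φ : 2
    apply aut_ext
    intro i j
    refine (matrixBaseChange_single _ _ _ _).trans ?_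
    change _ = autBaseChange g.hom (autBaseChange f.hom φ) _
    rw [single_one_map g.hom, autBaseChange_map, single_one_map f.hom, autBaseChange_map]
    rfl

/-- The canonical homomorphism `GL_n → PGL_n`, by conjugation. -/
@[simps]
def conjNatTrans (n : ℕ) : GLFunctor.{u} n ⟶ PGLFunctor.{u} n where
  app R := GrpCat.ofHom (MonoidHom.mk' (fun g ↦ conj g) conj_mul)
  naturality R R' f := by
    ext g : 2
    exact conj_map f.hom g

variable (k : Type u) [Field k]

/-- Schemes over `k`. -/
abbrev Sch := Over (Spec (CommRingCat.of k))

/-- Global functions, as a functor on schemes over `k`. -/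
noncomputable abbrev globalFunctions : (Sch k)ᵒᵖ ⥤ CommRingCat.{u} :=
  (Over.forget _).op ⋙ Scheme.Γ

/-- The group scheme `GL_n` over `k`, through its functor of points `T ↦ GL_n(Γ(T, 𝒪_T))`. -/
noncomputable abbrev GLn (n : ℕ) : (Sch k)ᵒᵖ ⥤ GrpCat.{u} := globalFunctions k ⋙ GLFunctor n

/-- The group scheme `PGL_n` over `k`, through its functor of points
`T ↦ Aut_{Γ(T, 𝒪_T)-alg}(M_n(Γ(T, 𝒪_T)))`. -/
noncomputable abbrev PGLn (n : ℕ) : (Sch k)ᵒᵖ ⥤ GrpCat.{u} := globalFunctions k ⋙ PGLFunctor n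

variable {k}

/-- The canonical homomorphism `GL_n → PGL_n` on `T`-points. -/
noncomputable def toPGL {n : ℕ} {T : Sch k} (g : (GLn k n).obj (op T)) : (PGLn k n).obj (op T) :=
  (Functor.whiskerLeft (globalFunctions k) (conjNatTrans n)).app (op T) g

/-- The inclusion of scalar matrices `𝔾_m → GL_n` on `T`-points. -/
noncomputable def scalarGL (n : ℕ) {T : Sch k} (t : Γ(T.left, ⊤)ˣ) : (GLn k n).obj (op T) :=
  Matrix.GeneralLinearGroup.scalar (R := Γ(T.left, ⊤)) (Fin n) t

/-! ### Varieties, group actions and quotients by free actions -/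

/-- Irreducible algebraic varieties over `k`. -/
class IsVariety (X : Sch k) : Prop where
  isIntegral : IsIntegral X.left
  isSeparated : IsSeparated X.hom
  locallyOfFiniteType : LocallyOfFiniteType X.hom
  quasiCompact : QuasiCompact X.hom

attribute [instance] IsVariety.isIntegral IsVariety.isSeparated IsVariety.locallyOfFiniteType
  IsVariety.quasiCompact

/-- An action over `k` of a group scheme `G`, given by its functor of points, on a `k`-scheme `X`:
the groups `G(T)` act on the sets `X(T)`, naturally in `T`. -/
structure GroupAction (G : (Sch k)ᵒᵖ ⥤ GrpCat.{u}) (X : Sch k) where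
  smul {T : Sch k} (g : G.obj (op T)) (x : T ⟶ X) : T ⟶ X
  one_smul {T : Sch k} (x : T ⟶ X) : smul 1 x = x
  mul_smul {T : Sch k} (g h : G.obj (op T)) (x : T ⟶ X) : smul (g * h) x = smul g (smul h x)
  comp_smul {T T' : Sch k} (f : T' ⟶ T) (g : G.obj (op T)) (x : T ⟶ X) :
    f ≫ smul g x = smul (G.map f.op g) (f ≫ x)

/-- The action `a` of `G` on `X` is free with quotient `q : X ⟶ Y`, that is, `q` is a principal
`G`-bundle: it is flat, surjective and locally of finite presentation, it is `G`-invariant, and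
`G × X ⟶ X ×_Y X` is an isomorphism. -/
structure IsFreeQuotient {G : (Sch k)ᵒᵖ ⥤ GrpCat.{u}} {X Y : Sch k} (a : GroupAction G X)
    (q : X ⟶ Y) : Prop where
  flat : Flat q.left
  surjective : Surjective q.left
  locallyOfFinitePresentation : LocallyOfFinitePresentation q.left
  smul_comp {T : Sch k} (g : G.obj (op T)) (x : T ⟶ X) : a.smul g x ≫ q = x ≫ q
  existsUnique_smul_eq {T : Sch k} (x y : T ⟶ X) : x ≫ q = y ≫ q → ∃! g, a.smul g x = y

/-! ### Vector bundles -/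

/-- For a scheme `p : E ⟶ X` over `X` and a `T`-point `x` of `X`, the set of `T`-points of `E`
above `x`, which is the set of sections over `T` of the pullback of `E` along `x`. -/
def Fiber {E X : Sch k} (p : E ⟶ X) {T : Sch k} (x : T ⟶ X) : Type u :=
  { v : T ⟶ E // v ≫ p = x }

/-- Pullback of sections along `f : T' ⟶ T`. -/
noncomputable def Fiber.pullback {E X : Sch k} {p : E ⟶ X} {T T' : Sch k} {x : T ⟶ X} {x' : T' ⟶ X}
    (v : Fiber p x) (f : T' ⟶ T) (h : f ≫ x = x') : Fiber p x' :=
  ⟨f ≫ v.1, by rw [Category.assoc, v.2, h]⟩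

/-- An open subscheme of a `k`-scheme. -/
noncomputable abbrev openSub (X : Sch k) (U : X.left.Opens) : Sch k := Over.mk (U.ι ≫ X.hom)

/-- Its inclusion. -/
noncomputable abbrev openSubι (X : Sch k) (U : X.left.Opens) : openSub X U ⟶ X := Over.homMk U.ι

/-- A (geometric) vector bundle of rank `r` over `X`: a scheme over `X` whose sets of sections are
modules, compatibly with pullback, and which has, locally on `X` for the Zariski topology, a frame
of `r` sections, i.e. is isomorphic to `X × 𝔸^r`. -/
structure VectorBundle (X : Sch k) (r : ℕ) where
  total : Sch k
  proj : total ⟶ X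
  [addCommGroup : ∀ {T : Sch k} (x : T ⟶ X), AddCommGroup (Fiber proj x)]
  [module : ∀ {T : Sch k} (x : T ⟶ X), Module Γ(T.left, ⊤) (Fiber proj x)]
  pullback_add {T T' : Sch k} {x : T ⟶ X} {x' : T' ⟶ X} (v v' : Fiber proj x) (f : T' ⟶ T)
    (h : f ≫ x = x') : (v + v').pullback f h = v.pullback f h + v'.pullback f h
  pullback_smul {T T' : Sch k} {x : T ⟶ X} {x' : T' ⟶ X} (c : Γ(T.left, ⊤)) (v : Fiber proj x)
    (f : T' ⟶ T) (h : f ≫ x = x') : (c • v).pullback f h = f.left.appTop c • v.pullback f h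
  exists_frame (pt : X.left) : ∃ U : X.left.Opens, pt ∈ U ∧
    ∃ e : Fin r → Fiber proj (openSubι X U),
      ∀ {T : Sch k} (t : T ⟶ openSub X U), Function.Bijective
        (fun c : Fin r → Γ(T.left, ⊤) ↦
          (∑ i, c i • (e i).pullback t rfl : Fiber proj (t ≫ openSubι X U)))

attribute [instance] VectorBundle.addCommGroup VectorBundle.module

/-- For an action of `GL_n` on a scheme `E` over `X` which lifts an action of `PGL_n` on `X`:
the map `E_x → E_{g x}` given by `g ∈ GL_n(T)`. -/
noncomputable def Fiber.lift {n : ℕ} {E X : Sch k} {p : E ⟶ X} (a : GroupAction (PGLn k n) X)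
    (b : GroupAction (GLn k n) E)
    (hb : ∀ {T : Sch k} (g : (GLn k n).obj (op T)) (v : T ⟶ E),
      b.smul g v ≫ p = a.smul (toPGL g) (v ≫ p))
    {T : Sch k} (g : (GLn k n).obj (op T)) {x : T ⟶ X} (v : Fiber p x) :
    Fiber p (a.smul (toPGL g) x) :=
  ⟨b.smul g v.1, by rw [hb, v.2]⟩

/-- A vector bundle of rank `r` and weight `w` over a `k`-scheme `X` with an action `a` of `PGL_n`:
a vector bundle `P` with an action of `GL_n` on (the total space of) `P`, linear on the fibres,
which lifts the action of `PGL_n` on `X` and for which the scalars `t` act on the fibres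
as multiplication by `t ^ w`. -/
structure WeightBundle {n : ℕ} {X : Sch k} (a : GroupAction (PGLn k n) X) (r : ℕ) (w : ℤ) extends
    VectorBundle X r where
  action : GroupAction (GLn k n) total
  smul_proj {T : Sch k} (g : (GLn k n).obj (op T)) (v : T ⟶ total) :
    action.smul g v ≫ proj = a.smul (toPGL g) (v ≫ proj)
  smul_add {T : Sch k} (g : (GLn k n).obj (op T)) {x : T ⟶ X} (v v' : Fiber proj x) :
    (v + v').lift a action smul_proj g = v.lift a action smul_proj g + v'.lift a action smul_proj g
  smul_smul {T : Sch k} (g : (GLn k n).obj (op T)) {x : T ⟶ X} (c : Γ(T.left, ⊤))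
    (v : Fiber proj x) : (c • v).lift a action smul_proj g = c • v.lift a action smul_proj g
  scalar_smul {T : Sch k} (t : Γ(T.left, ⊤)ˣ) {x : T ⟶ X} (v : Fiber proj x) :
    action.smul (scalarGL n t) v.1 = (((t ^ w : Γ(T.left, ⊤)ˣ) : Γ(T.left, ⊤)) • v).1

section

variable {n : ℕ} {X : Sch k} {a : GroupAction (PGLn k n) X} {r : ℕ} {w : ℤ}

/-- The linear map `P_x → P_{g x}` given by `g ∈ GL_n(T)`. -/
noncomputable def WeightBundle.smulFiber (P : WeightBundle a r w) {T : Sch k}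
    (g : (GLn k n).obj (op T)) (x : T ⟶ X) :
    Fiber P.proj x →ₗ[Γ(T.left, ⊤)] Fiber P.proj (a.smul (toPGL g) x) where
  toFun v := v.lift a P.action P.smul_proj g
  map_add' v v' := P.smul_add g v v'
  map_smul' c v := P.smul_smul g c v

/-! ### The Brauer class of a vector bundle of weight `w` -/

/-- A `T`-point of the generic fibre `X ×_Y Spec k(Y)` of `q : X ⟶ Y`. -/
structure GenericFiberPoint {Y : Sch k} [IsIntegral Y.left] (q : X ⟶ Y) where
  T : Sch k
  x : T ⟶ X
  t : T.left ⟶ Spec Y.left.functionField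
  comm : t ≫ Y.left.fromSpecStalk (genericPoint Y.left) = (x ≫ q).left

variable {Y : Sch k} [IsIntegral Y.left]

/-- The structure map `k(Y) → Γ(T, 𝒪_T)`. -/
noncomputable def GenericFiberPoint.scalars {q : X ⟶ Y} (s : GenericFiberPoint q) :
    Y.left.functionField →+* Γ(s.T.left, ⊤) :=
  ((Scheme.ΓSpecIso Y.left.functionField).inv ≫ s.t.appTop).hom

noncomputable instance {q : X ⟶ Y} (P : VectorBundle X r) (s : GenericFiberPoint q) :
    Algebra Y.left.functionField (Module.End Γ(s.T.left, ⊤) (Fiber P.proj s.x)) :=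
  Algebra.compHom _ s.scalars

theorem algebraMap_end_apply {q : X ⟶ Y} (P : VectorBundle X r) (s : GenericFiberPoint q)
    (c : Y.left.functionField) (v : Fiber P.proj s.x) :
    algebraMap Y.left.functionField (Module.End Γ(s.T.left, ⊤) (Fiber P.proj s.x)) c v =
      s.scalars c • v := rfl

/-- The generic fibre of the bundle of central simple algebras `(P^∨ ⊗ P) / PGL_n` over the
quotient `q : X ⟶ Y` of `X` by `PGL_n`, as an algebra over the function field `k(Y)`:
the `GL_n`-equivariant endomorphisms of the restriction of the vector bundle `P` to the generic
fibre of `q`. Such an endomorphism is a family of linear endomorphisms of the modules of sections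
of `P` over the `T`-points of the generic fibre, compatible with pullback and equivariant. -/
noncomputable def genericEnd (P : WeightBundle a r w) (q : X ⟶ Y) :
    Subalgebra Y.left.functionField
      (∀ s : GenericFiberPoint q, Module.End Γ(s.T.left, ⊤) (Fiber P.proj s.x)) where
  carrier := { φ |
    (∀ (s s' : GenericFiberPoint q) (f : s'.T ⟶ s.T) (h : f ≫ s.x = s'.x) (v : Fiber P.proj s.x),
      φ s' (v.pullback f h) = (φ s v).pullback f h) ∧
    (∀ (T : Sch k) (g : (GLn k n).obj (op T)) (x : T ⟶ X)
      (t : T.left ⟶ Spec Y.left.functionField)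
      (h : t ≫ Y.left.fromSpecStalk (genericPoint Y.left) = (x ≫ q).left)
      (h' : t ≫ Y.left.fromSpecStalk (genericPoint Y.left) = (a.smul (toPGL g) x ≫ q).left)
      (v : Fiber P.proj x),
      φ ⟨T, a.smul (toPGL g) x, t, h'⟩ (P.smulFiber g x v) =
        P.smulFiber g x (φ ⟨T, x, t, h⟩ v)) }
  mul_mem' := by
    rintro φ ψ ⟨h1, h2⟩ ⟨h1', h2'⟩
    refine ⟨fun s s' f h v => ?_, fun T g x t h h' v => ?_⟩
    · simp only [Pi.mul_apply, Module.End.mul_apply]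
      rw [h1' s s' f h, h1 s s' f h]
    · simp only [Pi.mul_apply, Module.End.mul_apply]
      rw [h2' T g x t h h', h2 T g x t h h']
  add_mem' := by
    rintro φ ψ ⟨h1, h2⟩ ⟨h1', h2'⟩
    refine ⟨fun s s' f h v => ?_, fun T g x t h h' v => ?_⟩
    · simp only [Pi.add_apply, LinearMap.add_apply]
      rw [h1' s s' f h, h1 s s' f h, P.pullback_add]
    · simp only [Pi.add_apply, LinearMap.add_apply]
      rw [h2' T g x t h h', h2 T g x t h h', map_add]
  algebraMap_mem' := by
    intro c
    refine ⟨fun s s' f h v => ?_, fun T g x t h h' v => ?_⟩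
    · simp only [Pi.algebraMap_apply, algebraMap_end_apply]
      rw [P.pullback_smul]
      congr 1
      have : s'.t = f.left ≫ s.t := by
        rw [← cancel_mono (Y.left.fromSpecStalk (genericPoint Y.left)), s'.comm, Category.assoc,
          s.comm, ← h]
        simp
      simp only [GenericFiberPoint.scalars, this, Scheme.Hom.comp_appTop]
      rfl
    · exact (map_smul (P.smulFiber g x) _ _).symm

/-- `β` is the Brauer class defined by `P`: the class of the central simple algebra
`(P^∨ ⊗ P) / PGL_n` at the generic point of `X / PGL_n`. -/
def IsBrauerClassOf (P : WeightBundle a r w) (q : X ⟶ Y)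
    (β : BrauerGroup.{u, u} Y.left.functionField) : Prop :=
  ∃ A : CSA.{u, u} Y.left.functionField,
    Nonempty (A ≃ₐ[Y.left.functionField] genericEnd P q) ∧
      Quotient.mk (Brauer.CSA_Setoid _) A = β

end

/-! ### Grassmannian bundles -/

/-- `N` is a subbundle of rank `j` of the (finitely generated projective) module `M`: the quotient
`M / N` is projective and `N` has rank `j` everywhere. -/
structure IsSubbundle {R M : Type u} [CommRing R] [AddCommGroup M] [Module R M] (j : ℕ)
    (N : Submodule R M) : Prop where
  projective_quotient : Module.Projective R (M ⧸ N)
  rank_eq (p : PrimeSpectrum R) : Module.rankAtStalk N p = j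

/-- The Grassmannian bundle `Gr_j(P) → X` of `j`-dimensional subspaces of the fibres of a vector
bundle `P` over `X`: the scheme over `X` whose points over `x : T ⟶ X`, for affine `T`, are the
subbundles of rank `j` of the pullback of `P` along `x`, functorially in `T`. -/
structure GrassmannianBundle {X : Sch k} {r : ℕ} (P : VectorBundle X r) (j : ℕ) where
  total : Sch k
  proj : total ⟶ X
  subspace {T : Sch k} [IsAffine T.left] {x : T ⟶ X} (z : Fiber proj x) :
    Submodule Γ(T.left, ⊤) (Fiber P.proj x)
  bijOn_subspace {T : Sch k} [IsAffine T.left] (x : T ⟶ X) :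
    Set.BijOn (fun z : Fiber proj x ↦ subspace z) Set.univ {N | IsSubbundle j N}
  subspace_pullback {T T' : Sch k} [IsAffine T.left] [IsAffine T'.left] {x : T ⟶ X} {x' : T' ⟶ X}
    (z : Fiber proj x) (f : T' ⟶ T) (h : f ≫ x = x') :
    subspace (z.pullback f h) =
      Submodule.span Γ(T'.left, ⊤) ((fun v ↦ v.pullback f h) '' (subspace z : Set (Fiber P.proj x)))

/-- The action `b` of `PGL_n` on `Gr_j(P)` is the one induced by the action of `GL_n` on `P`: it
lifts the action of `PGL_n` on `X`, and the class in `PGL_n` of `g ∈ GL_n` sends a subspace `N` of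
`P_x` to the subspace `g N` of `P_{g x}`. -/
structure IsInducedAction {n : ℕ} {X : Sch k} {a : GroupAction (PGLn k n) X} {r j : ℕ} {w : ℤ}
    (P : WeightBundle a r w) (Gr : GrassmannianBundle P.toVectorBundle j)
    (b : GroupAction (PGLn k n) Gr.total) : Prop where
  smul_proj {T : Sch k} (g : (PGLn k n).obj (op T)) (z : T ⟶ Gr.total) :
    b.smul g z ≫ Gr.proj = a.smul g (z ≫ Gr.proj)
  subspace_smul {T : Sch k} [IsAffine T.left] (g : (GLn k n).obj (op T)) {x : T ⟶ X}
    (z : Fiber Gr.proj x) :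
    Gr.subspace (⟨b.smul (toPGL g) z.1, by rw [smul_proj, z.2]⟩ :
        Fiber Gr.proj (a.smul (toPGL g) x)) =
      (Gr.subspace z).map (P.smulFiber g x)

/-! ### Birationally linear maps -/

/-- The field extension given by `θ : K →+* L` is purely transcendental: `L` is generated, as a
field over `K`, by a family of algebraically independent elements. -/
def IsPurelyTranscendental {K L : Type u} [Field K] [Field L] (θ : K →+* L) : Prop :=
  letI := θ.toAlgebra
  ∃ (ι : Type) (x : ι → L), AlgebraicIndependent K x ∧ IntermediateField.adjoin K (Set.range x) = ⊤

/-- A rational map `φ` between integral schemes is birationally linear if it is dominant and the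
extension of function fields that it induces is purely transcendental. -/
def IsBirationallyLinear {X Y : Scheme.{u}} [IsIntegral X] [IsIntegral Y] (φ : X ⤏ Y) : Prop :=
  φ.IsDominant ∧ ∃ θ : Y.functionField ⟶ X.functionField,
    Spec.map θ ≫ Y.fromSpecStalk (genericPoint Y) = φ.fromFunctionField ∧
      IsPurelyTranscendental θ.hom

end TwistedGrassmannian

open TwistedGrassmannian

namespace TwistedGrassmannian

/-! ### Automorphisms of matrix algebras -/

section MatrixAut

variable {n : ℕ} {R : Type u} [CommRing R]

/-! Let `K = k(X/PGL_n)`. The principal bundle `X → X/PGL_n` has a point `x₀` over some finite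
extension `F` of `K`, and in a frame of `P` at `x₀` the endomorphisms of the fibre are `M_r(F)`.
Since scalars of `GL_n` act on `P` through the weight, `P` need not descend to `K`; but scalars
disappear under conjugation, so `End P` does descend. The invariant matrices form a `K`-algebra `A ⊂
M_r(F)` (`descended`) with `A ⊗ F = M_r(F)`: this is `isForm_descended`, proved by hand from the
cocycle condition on `F ⊗ F`. By fpqc gluing, `A` is the generic fibre of the bundle of algebras
that defines the Brauer class (`range_genericEndToMatrix`).

The generic fibre of `π` is thus the variety of rank `j` subspaces twisted by `A`, a generalized
Severi-Brauer variety. If the Brauer class is represented in dimension `j ^ 2`, then the index of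
`A` divides `j`, so `A` contains an idempotent `e` of rank `j` (`exists_idempotent_rank_eq`). The
big cell of the Grassmannian around the image of `e` consists of the images of the idempotents `e +
v` with `v ∈ (1 - e) A e`; it is an affine space with coordinates over `K`. The invariance of `e`
and of the `v` makes the cell compatible with the action: two of its points have the same image in
the quotient exactly when their parameters agree (`chartPoint_comp_eq_iff`). Hence the cell descends
to a morphism `G` from affine `d`-space over `K` to `Z = Gr_j(P)/PGL_n` (`exists_chartQuotient`)
that is injective on points with values in every `K`-algebra.

Conjugating `e` by a unit of `A` in general position, which exists because `K` is infinite, puts the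
generic point of `Z` inside the cell (`IsForm.exists_chart`). Openness of `G` is never needed: a map
that is injective on points and through which the generic point of `Z` factors already forces `k(Z)
= K(x₁, …, x_d)` with independent `x_i` (`isPurelyTranscendental_of_map_comp_eq`). -/

/-- For an automorphism `φ` of `M_n(R)` and a vector `v`, the matrix whose `i`-th column is
`φ(E_{i,0}) φ(E_{0,0}) v`. It intertwines `φ` and the identity. -/
def intertwiner (z : Fin n) (φ : Matrix (Fin n) (Fin n) R ≃ₐ[R] Matrix (Fin n) (Fin n) R)
    (v : Fin n → R) : Matrix (Fin n) (Fin n) R :=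
  Matrix.of fun b i => (φ (Matrix.single i z 1)).mulVec v b

/-- On matrix units: `φ(E_ij)` sends the `l`-th column `φ(E_lz) v` to `φ(E_ij E_lz) v`, which is
`φ(E_iz) v` if `j = l` and zero otherwise. -/
theorem map_mul_intertwiner (z : Fin n)
    (φ : Matrix (Fin n) (Fin n) R ≃ₐ[R] Matrix (Fin n) (Fin n) R) (v : Fin n → R)
    (M : Matrix (Fin n) (Fin n) R) :
    φ M * intertwiner z φ v = intertwiner z φ v * M := by
  have key : (LinearMap.mulRight R (intertwiner z φ v)) ∘ₗ φ.toLinearMap =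
      LinearMap.mulLeft R (intertwiner z φ v) := by
    apply matrix_linearMap_ext
    intro i j
    ext b l
    have h : (φ (Matrix.single i j 1) * intertwiner z φ v) b l =
        (φ (Matrix.single i j 1 * Matrix.single l z 1)).mulVec v b := by
      rw [map_mul, ← Matrix.mulVec_mulVec]; rfl
    change (φ (Matrix.single i j 1) * intertwiner z φ v) b l =
      (intertwiner z φ v * (Matrix.single i j 1 : Matrix (Fin n) (Fin n) R)) b l
    rw [h]
    by_cases hjl : j = l
    · subst hjl
      rw [Matrix.single_mul_single_same, Matrix.mul_single_apply_same]
      simp [intertwiner]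
    · rw [Matrix.single_mul_single_of_ne _ _ _ _ hjl, Matrix.mul_single_apply_of_ne]
      · simp
      · exact fun h => hjl h.symm
  exact LinearMap.congr_fun key M

/-- If the vector `φ(E_{0,0}) v` is nonzero modulo a maximal ideal, then so is the determinant of
`intertwiner φ v`. -/
theorem det_intertwiner_notMem (z : Fin n)
    (φ : Matrix (Fin n) (Fin n) R ≃ₐ[R] Matrix (Fin n) (Fin n) R) (v : Fin n → R)
    (p : Ideal R) [p.IsPrime] (hv : ∃ b, (φ (Matrix.single z z 1)).mulVec v b ∉ p) :
    (intertwiner z φ v).det ∉ p := by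
  intro hdet
  let π := Ideal.Quotient.mk p
  have h0 : ((intertwiner z φ v).map π).det = 0 := by
    rw [← RingHom.mapMatrix_apply, ← RingHom.map_det]
    exact Ideal.Quotient.eq_zero_iff_mem.mpr hdet
  obtain ⟨c, hc, hc0⟩ := Matrix.exists_mulVec_eq_zero_iff.mpr h0
  apply hc
  ext l
  obtain ⟨b, hb⟩ := hv
  -- Write `T` for the intertwiner. Applying `φ(E_zl)` to `T c = 0` gives `T E_zl c = c_l φ(E_zz) v
  -- = 0` modulo `p`, and the quotient by `p` is a domain.
  have h1 : ((φ (Matrix.single z l 1)).map π).mulVec (((intertwiner z φ v).map π).mulVec c) = 0 := by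
    rw [hc0]; simp
  rw [Matrix.mulVec_mulVec, ← Matrix.map_mul, map_mul_intertwiner, Matrix.map_mul,
    ← Matrix.mulVec_mulVec] at h1
  have h2 : ((Matrix.single z l (1 : R)).map π).mulVec c = Pi.single z (c l) := by
    rw [← single_one_map]
    ext i
    simp [Matrix.mulVec, dotProduct, Matrix.single_apply, Pi.single_apply, eq_comm, ite_and]
  rw [h2] at h1
  have h3 := congr_fun h1 b
  rw [Matrix.mulVec_single] at h3
  have h4 : π ((φ (Matrix.single z z 1)).mulVec v b) * c l = 0 := by
    simpa [intertwiner, Matrix.col_apply] using h3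
  rcases mul_eq_zero.mp h4 with h5 | h5
  · exact absurd (Ideal.Quotient.eq_zero_iff_mem.mp h5) hb
  · exact h5

/-- If all entries of `φ(E_zz)` were in `p`, so would be those of `φ(E_ii) = φ(E_iz) φ(E_zz)
φ(E_zi)` for every `i`, and hence those of their sum `φ(1) = 1`. -/
theorem exists_mulVec_single_notMem (z : Fin n)
    (φ : Matrix (Fin n) (Fin n) R ≃ₐ[R] Matrix (Fin n) (Fin n) R)
    (p : Ideal R) (hp : p ≠ ⊤) :
    ∃ c b, (φ (Matrix.single z z 1)).mulVec (Pi.single c 1) b ∉ p := by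
  by_contra! H
  let π := Ideal.Quotient.mk p
  have h0 : (φ (Matrix.single z z 1)).map π = 0 := by
    ext b c
    have := H c b
    rw [Matrix.mulVec_single_one] at this
    exact Ideal.Quotient.eq_zero_iff_mem.mpr this
  have h1 : ∀ i, (φ (Matrix.single i i 1)).map π = 0 := by
    intro i
    have : Matrix.single i i (1 : R) =
        Matrix.single i z 1 * Matrix.single z z 1 * Matrix.single z i 1 := by simp
    rw [this, map_mul, map_mul, Matrix.map_mul, Matrix.map_mul, h0]
    simp
  have h2 : (φ 1).map π = 0 := by
    have : (1 : Matrix (Fin n) (Fin n) R) = ∑ i, Matrix.single i i 1 := by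
      rw [← Matrix.diagonal_one, ← Matrix.sum_single_eq_diagonal]
    rw [this, map_sum]
    change π.mapMatrix (∑ i, φ (Matrix.single i i 1)) = 0
    rw [map_sum]
    exact Finset.sum_eq_zero fun i _ => h1 i
  apply hp
  rw [Ideal.eq_top_iff_one]
  have := congr_fun (congr_fun h2 z) z
  rw [map_one, Matrix.map_apply, Matrix.one_apply_eq] at this
  exact Ideal.Quotient.eq_zero_iff_mem.mp this

theorem conj_eq_of_intertwines (φ : Matrix (Fin n) (Fin n) R ≃ₐ[R] Matrix (Fin n) (Fin n) R)
    (g : GL (Fin n) R) (h : ∀ M, φ M * g.1 = g.1 * M) : conj g = φ := by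
  ext1 M
  rw [conj_apply, ← h, mul_assoc, ← Units.val_mul, mul_inv_cancel, Units.val_one, mul_one]

/-- Automorphisms of `M_n(R)` are inner if `R` is semilocal. -/
theorem exists_conj_eq_of_finite_maximalSpectrum [Finite (MaximalSpectrum R)]
    (φ : Matrix (Fin n) (Fin n) R ≃ₐ[R] Matrix (Fin n) (Fin n) R) : ∃ g, conj g = φ := by
  classical
  rcases Nat.eq_zero_or_pos n with rfl | hn
  · exact ⟨1, by ext M i; exact i.elim0⟩
  let z : Fin n := ⟨0, hn⟩
  choose c hc using fun p : MaximalSpectrum R =>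
    exists_mulVec_single_notMem z φ p.asIdeal p.isMaximal.ne_top
  have hcop : Pairwise fun p p' : MaximalSpectrum R => IsCoprime p.asIdeal p'.asIdeal := by
    intro p p' hpp
    rw [Ideal.isCoprime_iff_sup_eq]
    exact Ideal.IsMaximal.coprime_of_ne p.isMaximal p'.isMaximal
      (fun h => hpp (MaximalSpectrum.ext h))
  -- Chinese remainder theorem, one coordinate at a time: modulo each maximal ideal `v` is the
  -- standard basis vector chosen for it, so a single intertwiner is invertible modulo all of them.
  choose v hv using fun d : Fin n => Ideal.exists_forall_sub_mem_ideal hcop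
    (fun p => (Pi.single (c p) 1 : Fin n → R) d)
  have hdet : IsUnit (intertwiner z φ v).det := by
    by_contra H
    obtain ⟨m, hm, hmem⟩ := exists_max_ideal_of_mem_nonunits H
    let p : MaximalSpectrum R := ⟨m, hm⟩
    obtain ⟨b, hb⟩ := hc p
    refine det_intertwiner_notMem z φ v m ⟨b, fun hvb => hb ?_⟩ hmem
    have : (φ (Matrix.single z z 1)).mulVec v b -
        (φ (Matrix.single z z 1)).mulVec (Pi.single (c p) 1) b ∈ m := by
      rw [← Pi.sub_apply, ← Matrix.mulVec_sub]
      change ∑ d, _ * (v d - (Pi.single (c p) 1 : Fin n → R) d) ∈ m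
      exact Ideal.sum_mem _ fun d _ => Ideal.mul_mem_left _ _ (hv d p)
    simpa using m.sub_mem hvb this
  exact ⟨((Matrix.isUnit_iff_isUnit_det _).mpr hdet).unit,
    conj_eq_of_intertwines _ _ fun M => map_mul_intertwiner z φ v M⟩

/-- Automorphisms of `M_n(R)` are inner locally on `Spec R`. -/
theorem exists_span_eq_top_and_conj_eq
    (φ : Matrix (Fin n) (Fin n) R ≃ₐ[R] Matrix (Fin n) (Fin n) R) :
    ∃ s : Set R, Ideal.span s = ⊤ ∧ ∀ f ∈ s, ∀ {R' : Type u} [CommRing R'] (ι : R →+* R'),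
      IsUnit (ι f) → ∃ g, conj g = autBaseChange ι φ := by
  rcases Nat.eq_zero_or_pos n with rfl | hn
  · exact ⟨{1}, by simp, fun f _ R' _ ι _ => ⟨1, by ext M i; exact i.elim0⟩⟩
  let z : Fin n := ⟨0, hn⟩
  -- The determinants of the intertwiners of the standard basis vectors. No maximal ideal contains
  -- them all, and where one becomes invertible its intertwiner is the required matrix.
  refine ⟨Set.range fun c => (intertwiner z φ (Pi.single c 1)).det, ?_, ?_⟩
  · by_contra H
    obtain ⟨m, hm, hle⟩ := Ideal.exists_le_maximal _ H
    obtain ⟨c, b, hcb⟩ := exists_mulVec_single_notMem z φ m hm.ne_top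
    exact det_intertwiner_notMem z φ _ m ⟨b, hcb⟩ (hle (Ideal.subset_span ⟨c, rfl⟩))
  · rintro _ ⟨c, rfl⟩ R' _ ι hu
    let M := intertwiner z φ (Pi.single c 1)
    have hM : IsUnit (M.map ι) := by
      rw [Matrix.isUnit_iff_isUnit_det]
      rwa [← RingHom.mapMatrix_apply, ← RingHom.map_det]
    refine ⟨hM.unit, conj_eq_of_intertwines _ _ fun N => ?_⟩
    change (LinearMap.mulRight R' (M.map ι) ∘ₗ (autBaseChange ι φ).toLinearMap) N =
      LinearMap.mulLeft R' (M.map ι) N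
    congr 1
    apply matrix_linearMap_ext
    intro i j
    change autBaseChange ι φ _ * M.map ι = M.map ι * _
    rw [single_one_map ι, autBaseChange_map, ← Matrix.map_mul, ← Matrix.map_mul,
      map_mul_intertwiner]

/-- Two invertible matrices that define the same inner automorphism differ by a scalar. -/
theorem exists_eq_mul_scalar_of_conj_eq {g g' : GL (Fin n) R} (h : conj g = conj g') :
    ∃ c : Rˣ, g' = g * Matrix.GeneralLinearGroup.scalar (Fin n) c := by
  have hc : g⁻¹ * g' ∈ Subgroup.center (GL (Fin n) R) := by
    rw [Subgroup.mem_center_iff]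
    intro x
    have hx := AlgEquiv.congr_fun h x.1
    rw [conj_apply, conj_apply] at hx
    have hx' : g * x * g⁻¹ = g' * x * g'⁻¹ := Units.ext (by simpa using hx)
    calc x * (g⁻¹ * g') = g⁻¹ * (g * x * g⁻¹) * g' := by group
      _ = g⁻¹ * g' * x := by rw [hx']; group
  rw [Matrix.GeneralLinearGroup.center_eq_range_scalar] at hc
  obtain ⟨c, hc⟩ := hc
  exact ⟨c, by rw [hc]; group⟩

end MatrixAut

end TwistedGrassmannian

namespace TwistedGrassmannian

variable {k : Type u} [Field k]

/-! ### Functions pulled back from an affine scheme -/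

/-- The ring homomorphism `R → Γ(T, 𝒪_T)` given by a morphism `T ⟶ Spec R`. -/
noncomputable def pullFun {R : CommRingCat.{u}} {T : Scheme.{u}} (y : T ⟶ Spec R) :
    R →+* Γ(T, ⊤) :=
  ((Scheme.ΓSpecIso R).inv ≫ y.appTop).hom

theorem pullFun_comp {R : CommRingCat.{u}} {T T' : Scheme.{u}} (f : T' ⟶ T) (y : T ⟶ Spec R) :
    pullFun (f ≫ y) = f.appTop.hom.comp (pullFun y) := by
  rw [pullFun, Scheme.Hom.comp_appTop]; rfl

theorem pullFun_id (R : CommRingCat.{u}) : pullFun (𝟙 (Spec R)) = (Scheme.ΓSpecIso R).inv.hom := by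
  simp [pullFun]

theorem pullFun_SpecMap {R R' : CommRingCat.{u}} {T : Scheme.{u}} (y : T ⟶ Spec R') (φ : R ⟶ R') :
    pullFun (y ≫ Spec.map φ) = (pullFun y).comp φ.hom := by
  ext1 x
  simp only [pullFun, Scheme.Hom.comp_appTop]
  rw [← Category.assoc, ← Scheme.ΓSpecIso_inv_naturality]
  rfl

theorem pullFun_injective {R : CommRingCat.{u}} {T : Scheme.{u}} {y y' : T ⟶ Spec R}
    (h : pullFun y = pullFun y') : y = y' := by
  apply ext_to_Spec
  exact CommRingCat.hom_ext h

theorem exists_pullFun_eq {R : CommRingCat.{u}} {T : Scheme.{u}} (φ : R →+* Γ(T, ⊤)) :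
    ∃ y : T ⟶ Spec R, pullFun y = φ := by
  refine ⟨T.toSpecΓ ≫ Spec.map (CommRingCat.ofHom φ), ?_⟩
  rw [pullFun_SpecMap]
  have : pullFun T.toSpecΓ = RingHom.id _ := by
    simp [pullFun]
  rw [this]; rfl

/-! ### Fibres and frames -/

section Fiber

variable {E X : Sch k} {p : E ⟶ X}

theorem Fiber.ext {T : Sch k} {x : T ⟶ X} {v v' : Fiber p x} (h : v.1 = v'.1) : v = v' :=
  Subtype.ext h

theorem Fiber.pullback_pullback {T T' T'' : Sch k} {x : T ⟶ X} {x' : T' ⟶ X} {x'' : T'' ⟶ X}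
    (v : Fiber p x) (f : T' ⟶ T) (h : f ≫ x = x') (f' : T'' ⟶ T') (h' : f' ≫ x' = x'') :
    (v.pullback f h).pullback f' h' = v.pullback (f' ≫ f) (by rw [Category.assoc, h, h']) :=
  Fiber.ext (Category.assoc _ _ _).symm

theorem Fiber.pullback_id {T : Sch k} {x : T ⟶ X} (v : Fiber p x) (h : 𝟙 T ≫ x = x) :
    v.pullback (𝟙 T) h = v := Fiber.ext (Category.id_comp _)

end Fiber

section Frame

variable {X : Sch k} {r : ℕ}

/-- Pullback of sections as an additive map. -/
noncomputable def VectorBundle.pullbackHom (P : VectorBundle X r) {T T' : Sch k} {x : T ⟶ X}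
    {x' : T' ⟶ X} (f : T' ⟶ T) (h : f ≫ x = x') : Fiber P.proj x →+ Fiber P.proj x' :=
  AddMonoidHom.mk' (fun v => v.pullback f h) fun v v' => P.pullback_add v v' f h

theorem VectorBundle.pullback_sum (P : VectorBundle X r) {T T' : Sch k} {x : T ⟶ X}
    {x' : T' ⟶ X} (f : T' ⟶ T) (h : f ≫ x = x') {ι : Type*} (s : Finset ι)
    (v : ι → Fiber P.proj x) :
    (∑ i ∈ s, v i).pullback f h = ∑ i ∈ s, (v i).pullback f h :=
  map_sum (P.pullbackHom f h) v s

/-- A family of sections of `P` over `x : T ⟶ X` whose pullbacks are bases. -/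
structure Frame (P : VectorBundle X r) {T : Sch k} (x : T ⟶ X) where
  e : Fin r → Fiber P.proj x
  bijective {T' : Sch k} (f : T' ⟶ T) {x' : T' ⟶ X} (h : f ≫ x = x') : Function.Bijective
    (fun c : Fin r → Γ(T'.left, ⊤) ↦ (∑ i, c i • (e i).pullback f h : Fiber P.proj x'))

namespace Frame

variable {P : VectorBundle X r} {T₀ : Sch k} {x₀ : T₀ ⟶ X} (ε : Frame P x₀)

/-- The pullback of a frame. -/
noncomputable def pullback {T : Sch k} (f : T ⟶ T₀) {x : T ⟶ X} (h : f ≫ x₀ = x) : Frame P x where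
  e i := (ε.e i).pullback f h
  bijective f' x' h' := by
    simp only [Fiber.pullback_pullback]
    exact ε.bijective _ _

theorem bijective_linearCombination :
    Function.Bijective (Fintype.linearCombination Γ(T₀.left, ⊤) ε.e) := by
  have := ε.bijective (𝟙 T₀) (Category.id_comp x₀)
  simp only [Fiber.pullback_id] at this
  exact this

/-- The basis of sections given by a frame. -/
noncomputable def basis : Module.Basis (Fin r) Γ(T₀.left, ⊤) (Fiber P.proj x₀) :=
  .ofEquivFun (LinearEquiv.ofBijective (Fintype.linearCombination Γ(T₀.left, ⊤) ε.e)
    ε.bijective_linearCombination).symm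

@[simp]
theorem basis_apply (i : Fin r) : ε.basis i = ε.e i := by
  classical
  rw [basis, Module.Basis.coe_ofEquivFun, LinearEquiv.symm_symm]
  dsimp only
  rw [LinearEquiv.ofBijective_apply, Fintype.linearCombination_apply_single, one_smul]

/-- The endomorphism given by a matrix in a frame. -/
noncomputable def op : Matrix (Fin r) (Fin r) Γ(T₀.left, ⊤) ≃ₐ[Γ(T₀.left, ⊤)]
    Module.End Γ(T₀.left, ⊤) (Fiber P.proj x₀) :=
  Matrix.toLinAlgEquiv ε.basis

theorem op_apply_e (M : Matrix (Fin r) (Fin r) Γ(T₀.left, ⊤)) (i : Fin r) :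
    ε.op M (ε.e i) = ∑ j, M j i • ε.e j := by
  rw [← ε.basis_apply, op, Matrix.toLinAlgEquiv_self]
  simp

theorem op_pullback {T : Sch k} (f : T ⟶ T₀) {x : T ⟶ X} (h : f ≫ x₀ = x)
    (M : Matrix (Fin r) (Fin r) Γ(T₀.left, ⊤)) (v : Fiber P.proj x₀) :
    (ε.op M v).pullback f h = (ε.pullback f h).op (M.map f.left.appTop) (v.pullback f h) := by
  rw [← ε.basis.sum_repr v]
  simp only [map_sum, map_smul, basis_apply, P.pullback_sum, P.pullback_smul, op_apply_e]
  refine Finset.sum_congr rfl fun i _ => ?_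
  rw [show (ε.e i).pullback f h = (ε.pullback f h).e i from rfl, op_apply_e]
  rfl

theorem ext_of_e {φ ψ : Module.End Γ(T₀.left, ⊤) (Fiber P.proj x₀)}
    (h : ∀ i, φ (ε.e i) = ψ (ε.e i)) : φ = ψ :=
  ε.basis.ext fun i => by simpa using h i

end Frame

/-- Around every point with values in a local ring there is a frame. -/
theorem exists_frame_of_isLocalRing (P : VectorBundle X r) {R : CommRingCat.{u}} [IsLocalRing R]
    {T : Sch k} (i : T.left ≅ Spec R) (x : T ⟶ X) : Nonempty (Frame P x) := by
  obtain ⟨U, hU, e, he⟩ := P.exists_frame ((i.inv ≫ x.left) (IsLocalRing.closedPoint R))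
  -- An open subset of the spectrum of a local ring that contains the closed point is everything, so
  -- `x` factors through `U`.
  have hr : Set.range x.left ⊆ Set.range U.ι := by
    rw [Scheme.Opens.range_ι]
    have h1 := Scheme.preimage_eq_top_of_closedPoint_mem (i.inv ≫ x.left) hU
    rintro _ ⟨t, rfl⟩
    have h2 : i.hom t ∈ (i.inv ≫ x.left) ⁻¹ᵁ U := by rw [h1]; trivial
    have h3 : i.inv (i.hom t) = t := by simp
    change x.left (i.inv (i.hom t)) ∈ U at h2
    rwa [h3] at h2
  let l : T ⟶ openSub X U := Over.homMk (IsOpenImmersion.lift U.ι x.left hr) (by simp)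
  have hl : l ≫ openSubι X U = x := by
    ext1; exact IsOpenImmersion.lift_fac U.ι x.left hr
  refine ⟨⟨fun i => (e i).pullback l hl, fun {T'} f {x'} h => ?_⟩⟩
  subst h
  simp only [Fiber.pullback_pullback]
  have he' := he (f ≫ l)
  have hx : (f ≫ l) ≫ openSubι X U = f ≫ x := by rw [Category.assoc, hl]
  revert he'
  -- The type of sections depends on the point of `X`, so the equality of points has to be rewritten
  -- inside types.
  rw! (castMode := .all) [hx]
  exact id

end Frame

end TwistedGrassmannian

namespace TwistedGrassmannian

variable {k : Type u} [Field k]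

/-! ### The action of `GL_n` on the sections of a vector bundle of weight `w` -/

section Action

variable {n : ℕ}

theorem toPGL_one {T : Sch k} : toPGL (1 : (GLn k n).obj (op T)) = 1 :=
  map_one ((Functor.whiskerLeft (globalFunctions k) (conjNatTrans n)).app (op T)).hom

theorem toPGL_mul {T : Sch k} (g h : (GLn k n).obj (op T)) :
    toPGL (g * h) = toPGL g * toPGL h :=
  map_mul ((Functor.whiskerLeft (globalFunctions k) (conjNatTrans n)).app (op T)).hom g h

theorem toPGL_map {T T' : Sch k} (f : T' ⟶ T) (g : (GLn k n).obj (op T)) :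
    toPGL ((GLn k n).map f.op g) = (PGLn k n).map f.op (toPGL g) :=
  ConcreteCategory.congr_hom
    ((Functor.whiskerLeft (globalFunctions k) (conjNatTrans n)).naturality f.op) g

theorem exists_eq_mul_scalarGL {T : Sch k} {g g' : (GLn k n).obj (op T)}
    (h : toPGL g = toPGL g') : ∃ c, g' = g * scalarGL n c :=
  exists_eq_mul_scalar_of_conj_eq h

variable {X Y : Sch k} {a : GroupAction (PGLn k n) X} {q : X ⟶ Y}

theorem smul_inv_eq {T : Sch k} {g : (GLn k n).obj (op T)} {x x' : T ⟶ X}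
    (h : a.smul (toPGL g) x = x') : a.smul (toPGL g⁻¹) x' = x := by
  rw [← h, ← a.mul_smul, ← toPGL_mul, inv_mul_cancel, toPGL_one, a.one_smul]

theorem smul_mul_eq {T : Sch k} {g g' : (GLn k n).obj (op T)} {x x' x'' : T ⟶ X}
    (h : a.smul (toPGL g) x = x') (h' : a.smul (toPGL g') x' = x'') :
    a.smul (toPGL (g' * g)) x = x'' := by
  rw [toPGL_mul, a.mul_smul, h, h']

theorem smul_map_eq {T T' : Sch k} {g : (GLn k n).obj (op T)} {x x' : T ⟶ X}
    (h : a.smul (toPGL g) x = x') (f : T' ⟶ T) :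
    a.smul (toPGL ((GLn k n).map f.op g)) (f ≫ x) = f ≫ x' := by
  rw [toPGL_map, ← a.comp_smul, h]

theorem smul_map_eq' {T T' : Sch k} {g : (GLn k n).obj (op T)} {x x' : T ⟶ X}
    (h : a.smul (toPGL g) x = x') (f : T' ⟶ T) {y y' : T' ⟶ X} (hy : f ≫ x = y)
    (hy' : f ≫ x' = y') :
    a.smul (toPGL ((GLn k n).map f.op g)) y = y' := by
  rw [← hy, ← hy', smul_map_eq h]

/-- Points of `X` with values in a semilocal scheme and with the same image in the quotient differ
by an element of `GL_n`. -/
theorem IsFreeQuotient.exists_smul_eq (hq : IsFreeQuotient a q) {T : Sch k}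
    [Finite (MaximalSpectrum Γ(T.left, ⊤))] {x x' : T ⟶ X} (h : x ≫ q = x' ≫ q) :
    ∃ g : (GLn k n).obj (op T), a.smul (toPGL g) x = x' := by
  obtain ⟨φ, hφ, -⟩ := hq.existsUnique_smul_eq x x' h
  obtain ⟨g, hg⟩ := @exists_conj_eq_of_finite_maximalSpectrum n Γ(T.left, ⊤) _ ‹_› φ
  exact ⟨g, by rw [show toPGL g = φ from hg, hφ]⟩

variable {r : ℕ} {w : ℤ} (P : WeightBundle a r w)

namespace WeightBundle

/-- The linear isomorphism `P_x → P_{x'}` given by an element of `GL_n` sending `x` to `x'`. -/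
noncomputable def tr {T : Sch k} (g : (GLn k n).obj (op T)) {x x' : T ⟶ X}
    (h : a.smul (toPGL g) x = x') : Fiber P.proj x ≃ₗ[Γ(T.left, ⊤)] Fiber P.proj x' where
  toFun v := ⟨P.action.smul g v.1, by rw [P.smul_proj, v.2, h]⟩
  map_add' v v' := by subst h; exact P.smul_add g v v'
  map_smul' c v := by subst h; exact P.smul_smul g c v
  invFun v := ⟨P.action.smul g⁻¹ v.1, by rw [P.smul_proj, v.2, smul_inv_eq h]⟩
  left_inv v := Fiber.ext (by
    change P.action.smul g⁻¹ (P.action.smul g v.1) = v.1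
    rw [← P.action.mul_smul, inv_mul_cancel, P.action.one_smul])
  right_inv v := Fiber.ext (by
    change P.action.smul g (P.action.smul g⁻¹ v.1) = v.1
    rw [← P.action.mul_smul, mul_inv_cancel, P.action.one_smul])

variable {P}

theorem tr_val {T : Sch k} (g : (GLn k n).obj (op T)) {x x' : T ⟶ X}
    (h : a.smul (toPGL g) x = x') (v : Fiber P.proj x) :
    (P.tr g h v).1 = P.action.smul g v.1 := rfl

theorem tr_mul {T : Sch k} {g g' : (GLn k n).obj (op T)} {x x' x'' : T ⟶ X}
    (h : a.smul (toPGL g) x = x') (h' : a.smul (toPGL g') x' = x'')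
    (h'' : a.smul (toPGL (g' * g)) x = x'') (v : Fiber P.proj x) :
    P.tr (g' * g) h'' v = P.tr g' h' (P.tr g h v) :=
  Fiber.ext (P.action.mul_smul _ _ _)

theorem tr_pullback {T T' : Sch k} {g : (GLn k n).obj (op T)} {x x' : T ⟶ X}
    (h : a.smul (toPGL g) x = x') (v : Fiber P.proj x) (f : T' ⟶ T) {y y' : T' ⟶ X}
    (hy : f ≫ x = y) (hy' : f ≫ x' = y') :
    (P.tr g h v).pullback f hy' =
      P.tr ((GLn k n).map f.op g) (smul_map_eq' h f hy hy') (v.pullback f hy) :=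
  Fiber.ext (P.action.comp_smul _ _ _)

/-- By freeness `g` and `g'` have the same class in `PGL_n`, so they differ by a scalar, which acts
through its `w`-th power. Transport on `P` is therefore canonical only up to units, and transport on
`End P` is canonical. -/
theorem exists_tr_eq_smul (hq : IsFreeQuotient a q) {T : Sch k} {g g' : (GLn k n).obj (op T)}
    {x x' : T ⟶ X} (h : a.smul (toPGL g) x = x') (h' : a.smul (toPGL g') x = x') :
    ∃ c : Γ(T.left, ⊤)ˣ, ∀ v : Fiber P.proj x, P.tr g' h' v = (c : Γ(T.left, ⊤)) • P.tr g h v := by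
  have hxx : x ≫ q = x' ≫ q := by rw [← h, hq.smul_comp]
  obtain ⟨c, hc⟩ := exists_eq_mul_scalarGL
    ((hq.existsUnique_smul_eq x x' hxx).unique h h')
  subst hc
  refine ⟨c ^ w, fun v => ?_⟩
  rw [← map_smul]
  refine Fiber.ext ?_
  rw [tr_val, tr_val, P.action.mul_smul, P.scalar_smul]

/-- The isomorphism `End(P_x) → End(P_{x'})` given by an element of `GL_n` sending `x` to `x'` does
not depend on this element. -/
theorem tr_conj_eq (hq : IsFreeQuotient a q) {T : Sch k} {g g' : (GLn k n).obj (op T)}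
    {x x' : T ⟶ X} (h : a.smul (toPGL g) x = x') (h' : a.smul (toPGL g') x = x')
    (φ : Module.End Γ(T.left, ⊤) (Fiber P.proj x)) :
    (P.tr g' h').conj φ = (P.tr g h).conj φ := by
  obtain ⟨c, hc⟩ := exists_tr_eq_smul hq (P := P) h h'
  ext1 v
  obtain ⟨v, rfl⟩ := (P.tr g' h').surjective v
  rw [LinearEquiv.conj_apply_apply, LinearEquiv.symm_apply_apply, hc, hc, map_smul,
    LinearEquiv.conj_apply_apply, LinearEquiv.symm_apply_apply]

end WeightBundle

end Action

/-! ### Spectra of algebras over the function field -/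

section SpecOver

variable (Y : Sch k) [IsIntegral Y.left]

/-- The function field of an integral scheme over `k`. -/
abbrev FunField : Type u := Y.left.functionField

/-- The spectrum of an algebra over the function field of `Y`, as a scheme over `k`. -/
noncomputable abbrev specOver (R : Type u) [CommRing R] [Algebra (FunField Y) R] : Sch k :=
  Over.mk (Spec.map (CommRingCat.ofHom (algebraMap (FunField Y) R)) ≫
    Y.left.fromSpecStalk (genericPoint Y.left) ≫ Y.hom)

variable {R : Type u} [CommRing R] [Algebra (FunField Y) R]
variable {R' : Type u} [CommRing R'] [Algebra (FunField Y) R']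

/-- The morphism from the spectrum of an algebra over the function field to `Y`. -/
noncomputable def specOver.str (R : Type u) [CommRing R] [Algebra (FunField Y) R] :
    specOver Y R ⟶ Y :=
  Over.homMk (Spec.map (CommRingCat.ofHom (algebraMap (FunField Y) R)) ≫
    Y.left.fromSpecStalk (genericPoint Y.left))

variable {Y}

/-- The morphism of spectra given by a homomorphism of algebras over the function field. -/
noncomputable def specOver.map (φ : R →ₐ[FunField Y] R') : specOver Y R' ⟶ specOver Y R :=
  Over.homMk (Spec.map (CommRingCat.ofHom φ.toRingHom)) (by
    simp only [Over.mk_left, Over.mk_hom, ← Spec.map_comp_assoc, ← CommRingCat.ofHom_comp]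
    congr 3
    exact φ.comp_algebraMap)

theorem specOver.map_str (φ : R →ₐ[FunField Y] R') :
    specOver.map φ ≫ specOver.str Y R = specOver.str Y R' := by
  ext1
  simp only [specOver.map, specOver.str, Over.comp_left, Over.homMk_left, ← Spec.map_comp_assoc,
    ← CommRingCat.ofHom_comp]
  congr 3
  exact φ.comp_algebraMap

theorem specOver.map_comp {R'' : Type u} [CommRing R''] [Algebra (FunField Y) R'']
    (φ : R →ₐ[FunField Y] R') (ψ : R' →ₐ[FunField Y] R'') :
    specOver.map ψ ≫ specOver.map φ = specOver.map (ψ.comp φ) := by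
  ext1
  simp only [specOver.map, Over.comp_left, Over.homMk_left, ← Spec.map_comp,
    ← CommRingCat.ofHom_comp]
  rfl

/-- Functions on `Spec R` pulled back to `T`. -/
noncomputable abbrev fn {T : Sch k} (y : T ⟶ specOver Y R) : R →+* Γ(T.left, ⊤) :=
  pullFun (R := CommRingCat.of R) y.left

theorem fn_comp {T T' : Sch k} (f : T' ⟶ T) (y : T ⟶ specOver Y R) :
    fn (f ≫ y) = f.left.appTop.hom.comp (fn y) :=
  pullFun_comp f.left y.left

theorem fn_comp_map {T : Sch k} (y : T ⟶ specOver Y R') (φ : R →ₐ[FunField Y] R') :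
    fn (y ≫ specOver.map φ) = (fn y).comp φ.toRingHom :=
  pullFun_SpecMap (R := CommRingCat.of R) (R' := CommRingCat.of R') y.left _

theorem fn_injective {T : Sch k} {y y' : T ⟶ specOver Y R} (h : fn y = fn y') : y = y' := by
  ext1; exact pullFun_injective h

/-- The inclusion of the generic point of `Y` is a monomorphism, so equality over `Y` can be tested
on the scalars of `k(Y)`. -/
theorem comp_str_eq_iff {T : Sch k} (y : T ⟶ specOver Y R) (y' : T ⟶ specOver Y R') :
    y ≫ specOver.str Y R = y' ≫ specOver.str Y R' ↔
      (fn y).comp (algebraMap (FunField Y) R) = (fn y').comp (algebraMap (FunField Y) R') := by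
  rw [show (fn y).comp (algebraMap (FunField Y) R) = pullFun (R := CommRingCat.of (FunField Y))
      (y.left ≫ Spec.map (CommRingCat.ofHom (algebraMap (FunField Y) R))) from
      (pullFun_SpecMap (R := CommRingCat.of (FunField Y)) (R' := CommRingCat.of R) y.left
        (CommRingCat.ofHom (algebraMap (FunField Y) R))).symm,
    show (fn y').comp (algebraMap (FunField Y) R') = pullFun (R := CommRingCat.of (FunField Y))
      (y'.left ≫ Spec.map (CommRingCat.ofHom (algebraMap (FunField Y) R'))) from
      (pullFun_SpecMap (R := CommRingCat.of (FunField Y)) (R' := CommRingCat.of R')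
        y'.left (CommRingCat.ofHom (algebraMap (FunField Y) R'))).symm]
  constructor
  · intro h
    congr 1
    rw [← cancel_mono (Y.left.fromSpecStalk (genericPoint Y.left))]
    simpa [specOver.str] using congr_arg (fun f => f.left) h
  · intro h
    have h' := pullFun_injective h
    ext1
    simp only [specOver.str, Over.comp_left, Over.homMk_left]
    rw [← Category.assoc, h', Category.assoc]

theorem exists_fn_eq {T : Sch k} (y₀ : T ⟶ specOver Y R) (φ : R' →+* Γ(T.left, ⊤))
    (h : φ.comp (algebraMap (FunField Y) R') = (fn y₀).comp (algebraMap (FunField Y) R)) :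
    ∃ y : T ⟶ specOver Y R', fn y = φ ∧ y ≫ specOver.str Y R' = y₀ ≫ specOver.str Y R := by
  obtain ⟨y, hy⟩ := exists_pullFun_eq (R := CommRingCat.of R') φ
  have hy' : y ≫ Spec.map (CommRingCat.ofHom (algebraMap (FunField Y) R')) =
      y₀.left ≫ Spec.map (CommRingCat.ofHom (algebraMap (FunField Y) R)) := by
    apply pullFun_injective (R := CommRingCat.of (FunField Y))
    rw [pullFun_SpecMap, pullFun_SpecMap, hy]
    exact h
  have hk : y ≫ (specOver Y R').hom = T.hom := by
    rw [← Over.w y₀]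
    exact (Category.assoc _ _ _).symm.trans ((congr_arg (· ≫ _) hy').trans (Category.assoc _ _ _))
  let y' : T ⟶ specOver Y R' := Over.homMk y hk
  have hy'' : fn y' = φ := hy
  exact ⟨y', hy'', (comp_str_eq_iff y' y₀).mpr (by rw [hy'', h])⟩

end SpecOver

end TwistedGrassmannian

namespace TwistedGrassmannian

variable {k : Type u} [Field k]

/-! ### Pullback of endomorphisms -/

section EndCompat

variable {X : Sch k} {r : ℕ}

/-- `φ'` is the pullback along `f : T' ⟶ T` of the endomorphism `φ` of the sections of `P`. -/
def EndCompat (P : VectorBundle X r) {T T' : Sch k} {x : T ⟶ X} {x' : T' ⟶ X} (f : T' ⟶ T)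
    (h : f ≫ x = x') (φ : Module.End Γ(T.left, ⊤) (Fiber P.proj x))
    (φ' : Module.End Γ(T'.left, ⊤) (Fiber P.proj x')) : Prop :=
  ∀ v, φ' (v.pullback f h) = (φ v).pullback f h

namespace EndCompat

variable {P : VectorBundle X r} {T T' : Sch k} {x : T ⟶ X} {x' : T' ⟶ X} {f : T' ⟶ T}
  {h : f ≫ x = x'} {φ ψ : Module.End Γ(T.left, ⊤) (Fiber P.proj x)}
  {φ' ψ' : Module.End Γ(T'.left, ⊤) (Fiber P.proj x')}

/-- The pullback of a frame generates the sections. This uniqueness lets pullback of endomorphisms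
be handled as a relation instead of a construction. -/
theorem unique (ε : Frame P x) (hφ : EndCompat P f h φ φ') (hφ' : EndCompat P f h φ ψ') :
    φ' = ψ' :=
  (ε.pullback f h).ext_of_e fun i => (hφ (ε.e i)).trans (hφ' (ε.e i)).symm

theorem smul (hφ : EndCompat P f h φ φ') (c : Γ(T.left, ⊤)) :
    EndCompat P f h (c • φ) (f.left.appTop c • φ') := fun v => by
  rw [LinearMap.smul_apply, LinearMap.smul_apply, P.pullback_smul, hφ]

theorem sum {ι : Type*} (s : Finset ι) {φ : ι → Module.End Γ(T.left, ⊤) (Fiber P.proj x)}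
    {φ' : ι → Module.End Γ(T'.left, ⊤) (Fiber P.proj x')} (hφ : ∀ i, EndCompat P f h (φ i) (φ' i)) :
    EndCompat P f h (∑ i ∈ s, φ i) (∑ i ∈ s, φ' i) := fun v => by
  rw [LinearMap.sum_apply, LinearMap.sum_apply, P.pullback_sum]
  exact Finset.sum_congr rfl fun i _ => hφ i v

theorem conj {n : ℕ} {a : GroupAction (PGLn k n) X} {w : ℤ} {P : WeightBundle a r w}
    {φ : Module.End Γ(T.left, ⊤) (Fiber P.proj x)}
    {φ' : Module.End Γ(T'.left, ⊤) (Fiber P.proj x')}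
    (hφ : EndCompat P.toVectorBundle f h φ φ') {g : (GLn k n).obj (op T)} {z : T ⟶ X} {z' : T' ⟶ X}
    (hg : a.smul (toPGL g) x = z) (hz : f ≫ z = z') :
    EndCompat P.toVectorBundle f hz ((P.tr g hg).conj φ)
      ((P.tr ((GLn k n).map f.op g) (smul_map_eq' hg f h hz)).conj φ') := fun v => by
  obtain ⟨v, rfl⟩ := (P.tr g hg).surjective v
  rw [WeightBundle.tr_pullback hg v f h, LinearEquiv.conj_apply_apply,
    LinearEquiv.conj_apply_apply, LinearEquiv.symm_apply_apply, LinearEquiv.symm_apply_apply, hφ,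
    WeightBundle.tr_pullback hg _ f h]

end EndCompat

end EndCompat

/-! ### Endomorphisms given by matrices over an extension of the function field -/

section OpOf

variable {X Y : Sch k} [IsIntegral Y.left] {r : ℕ} {P : VectorBundle X r}
variable {F : Type u} [CommRing F] [Algebra (FunField Y) F] {x₀ : specOver Y F ⟶ X}
  (ε : Frame P x₀)

/-- The endomorphism given by a matrix with coefficients in `F` of the sections over a `T`-point of
`X` that factors through the point `x₀ : Spec F ⟶ X`. -/
noncomputable def Frame.opOf {T : Sch k} (y : T ⟶ specOver Y F) {x : T ⟶ X} (h : y ≫ x₀ = x) :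
    Matrix (Fin r) (Fin r) F →+* Module.End Γ(T.left, ⊤) (Fiber P.proj x) :=
  ((ε.pullback y h).op : _ →+* _).comp (fn y).mapMatrix

theorem Frame.opOf_apply {T : Sch k} (y : T ⟶ specOver Y F) {x : T ⟶ X} (h : y ≫ x₀ = x)
    (m : Matrix (Fin r) (Fin r) F) : ε.opOf y h m = (ε.pullback y h).op (m.map (fn y)) := rfl

theorem Frame.opOf_smul {T : Sch k} (y : T ⟶ specOver Y F) {x : T ⟶ X} (h : y ≫ x₀ = x)
    (c : F) (m : Matrix (Fin r) (Fin r) F) : ε.opOf y h (c • m) = fn y c • ε.opOf y h m := by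
  rw [opOf_apply, opOf_apply, ← map_smul]
  congr 1
  ext i j
  simp

theorem EndCompat.of_opOf {T T' : Sch k} (y : T ⟶ specOver Y F) {x : T ⟶ X} (h : y ≫ x₀ = x)
    (f : T' ⟶ T) {x' : T' ⟶ X} (h' : f ≫ x = x') (y' : T' ⟶ specOver Y F) (hy' : f ≫ y = y')
    (h'' : y' ≫ x₀ = x') (m : Matrix (Fin r) (Fin r) F) :
    EndCompat P f h' (ε.opOf y h m) (ε.opOf y' h'' m) := by
  subst hy'
  intro v
  rw [Frame.opOf_apply, Frame.opOf_apply, Frame.op_pullback]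
  have h1 : m.map (fn (f ≫ y)) = (m.map (fn y)).map f.left.appTop := by
    rw [fn_comp]; rfl
  rw [h1]
  have h2 : (ε.pullback y h).pullback f h' = ε.pullback (f ≫ y) h'' := by
    simp only [Frame.pullback, Fiber.pullback_pullback]
  rw [h2]

end OpOf

/-! ### Global functions on the spectrum of an algebra over the function field -/

section Gamma

variable {Y : Sch k} [IsIntegral Y.left]

theorem fn_id_bijective (R : Type u) [CommRing R] [Algebra (FunField Y) R] :
    Function.Bijective (fn (𝟙 (specOver Y R))) := by
  rw [show fn (𝟙 (specOver Y R)) = (Scheme.ΓSpecIso (CommRingCat.of R)).inv.hom from pullFun_id _]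
  exact (Scheme.ΓSpecIso (CommRingCat.of R)).symm.commRingCatIsoToRingEquiv.bijective

theorem fn_map {R R' : Type u} [CommRing R] [Algebra (FunField Y) R] [CommRing R']
    [Algebra (FunField Y) R'] (φ : R →ₐ[FunField Y] R') (x : R) :
    fn (specOver.map φ) x = fn (𝟙 (specOver Y R')) (φ x) := by
  rw [← Category.id_comp (specOver.map φ), fn_comp_map]; rfl

instance (R : Type u) [CommRing R] [Algebra (FunField Y) R] [h : Finite (MaximalSpectrum R)] :
    Finite (MaximalSpectrum Γ((specOver Y R).left, ⊤)) := by
  let e := RingEquiv.ofBijective _ (fn_id_bijective (Y := Y) R)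
  refine Finite.of_injective (fun p : MaximalSpectrum Γ((specOver Y R).left, ⊤) =>
    (⟨p.asIdeal.comap e, Ideal.comap_isMaximal_of_equiv e⟩ : MaximalSpectrum R)) ?_
  intro p p' hpp
  ext1
  exact Ideal.comap_injective_of_surjective e e.surjective (congr_arg MaximalSpectrum.asIdeal hpp)

end Gamma

/-! ### Descent of endomorphisms to the function field of the quotient -/

section Descent

open TensorProduct

variable {n : ℕ} {X Y : Sch k} [IsIntegral Y.left] {a : GroupAction (PGLn k n) X} {q : X ⟶ Y}
variable {F : Type u} [Field F] [Algebra (FunField Y) F] {x₀ : specOver Y F ⟶ X}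

/-- A pair of points of `Spec F` that agree over `Y` gives a point of `Spec (F ⊗ F)`. -/
theorem exists_map_tensor {T : Sch k} {R R' : Type u} [CommRing R] [Algebra (FunField Y) R]
    [CommRing R'] [Algebra (FunField Y) R'] (y : T ⟶ specOver Y R) (y' : T ⟶ specOver Y R')
    (h : y ≫ specOver.str Y R = y' ≫ specOver.str Y R') :
    ∃ f : T ⟶ specOver Y (R ⊗[FunField Y] R'),
      f ≫ specOver.map Algebra.TensorProduct.includeLeft = y ∧
      f ≫ specOver.map Algebra.TensorProduct.includeRight = y' := by
  rw [comp_str_eq_iff] at h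
  let : Algebra (FunField Y) Γ(T.left, ⊤) := ((fn y).comp (algebraMap (FunField Y) R)).toAlgebra
  let φ : R →ₐ[FunField Y] Γ(T.left, ⊤) := { fn y with commutes' := fun c => rfl }
  let φ' : R' →ₐ[FunField Y] Γ(T.left, ⊤) :=
    { fn y' with commutes' := fun c => (RingHom.congr_fun h c).symm }
  let ψ := Algebra.TensorProduct.lift φ φ' (fun _ _ => Commute.all _ _)
  obtain ⟨f, hf, -⟩ := exists_fn_eq y ψ.toRingHom (by
    ext c
    exact ψ.commutes c)
  refine ⟨f, fn_injective ?_, fn_injective ?_⟩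
  · rw [fn_comp_map, hf]
    ext x
    change ψ (x ⊗ₜ 1) = φ x
    rw [Algebra.TensorProduct.lift_tmul, map_one, mul_one]
  · rw [fn_comp_map, hf]
    ext x
    change ψ (1 ⊗ₜ x) = φ' x
    rw [Algebra.TensorProduct.lift_tmul, map_one, one_mul]

theorem comp_eq_of_comp_str_eq (hx₀ : x₀ ≫ q = specOver.str Y F) {T : Sch k}
    {y y' : T ⟶ specOver Y F} (h : y ≫ specOver.str Y F = y' ≫ specOver.str Y F) :
    (y ≫ x₀) ≫ q = (y' ≫ x₀) ≫ q := by
  rw [Category.assoc, Category.assoc, hx₀, h]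

/-- Two `T`-points of `X` that factor through `x₀ : Spec F ⟶ X` and agree over `Y` differ by an
element of `GL_n`. -/
theorem exists_smul_comp_eq [FiniteDimensional (FunField Y) F] (hq : IsFreeQuotient a q)
    (hx₀ : x₀ ≫ q = specOver.str Y F) {T : Sch k}
    (y y' : T ⟶ specOver Y F) (h : y ≫ specOver.str Y F = y' ≫ specOver.str Y F) :
    ∃ g : (GLn k n).obj (op T), a.smul (toPGL g) (y ≫ x₀) = y' ≫ x₀ := by
  -- It suffices to treat the universal pair over `F ⊗ F`. This ring is finite over `F`, hence
  -- artinian and semilocal, so there the element of `PGL_n` lifts to `GL_n` without localization.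
  obtain ⟨f, hf, hf'⟩ := exists_map_tensor y y' h
  have : IsArtinianRing (F ⊗[FunField Y] F) := IsArtinianRing.of_finite F _
  obtain ⟨g, hg⟩ := hq.exists_smul_eq (T := specOver Y (F ⊗[FunField Y] F))
    (comp_eq_of_comp_str_eq hx₀ (y := specOver.map Algebra.TensorProduct.includeLeft)
      (y' := specOver.map Algebra.TensorProduct.includeRight)
      (by rw [specOver.map_str, specOver.map_str]))
  exact ⟨(GLn k n).map f.op g, smul_map_eq' hg f (by rw [← Category.assoc, hf])
    (by rw [← Category.assoc, hf'])⟩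

end Descent

end TwistedGrassmannian

namespace TwistedGrassmannian

variable {k : Type u} [Field k]

/-! ### The invariant matrices: descent along `F` by the cocycle condition -/

section Descended

open TensorProduct

variable {n : ℕ} {X Y : Sch k} [IsIntegral Y.left] {a : GroupAction (PGLn k n) X} {q : X ⟶ Y}
variable {F : Type u} [Field F] [Algebra (FunField Y) F] {x₀ : specOver Y F ⟶ X}
variable {r : ℕ} {w : ℤ} {P : WeightBundle a r w}

/-- The matrices with coefficients in `F` that are invariant under the descent datum, that is, under
all elements of `GL_n` that relate two points of `X` that factor through `x₀ : Spec F ⟶ X`. -/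
noncomputable def descended (ε : Frame P.toVectorBundle x₀) :
    Subalgebra (FunField Y) (Matrix (Fin r) (Fin r) F) where
  carrier := { m | ∀ (T : Sch k) (y y' : T ⟶ specOver Y F)
    (_ : y ≫ specOver.str Y F = y' ≫ specOver.str Y F) (g : (GLn k n).obj (op T))
    (hg : a.smul (toPGL g) (y ≫ x₀) = y' ≫ x₀),
    (P.tr g hg).conj (ε.opOf y rfl m) = ε.opOf y' rfl m }
  mul_mem' := by
    intro m m' hm hm' T y y' h g hg
    rw [map_mul, Module.End.mul_eq_comp, LinearEquiv.conj_comp, hm T y y' h g hg,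
      hm' T y y' h g hg, map_mul, Module.End.mul_eq_comp]
  add_mem' := by
    intro m m' hm hm' T y y' h g hg
    rw [map_add, map_add, map_add, hm T y y' h g hg, hm' T y y' h g hg]
  algebraMap_mem' := by
    intro c T y y' h g hg
    rw [comp_str_eq_iff] at h
    rw [Algebra.algebraMap_eq_smul_one, ← algebraMap_smul F, ε.opOf_smul, ε.opOf_smul, map_smul,
      map_one, Module.End.one_eq_id, LinearEquiv.conj_id, map_one, Module.End.one_eq_id]
    congr 1
    exact RingHom.congr_fun h c

theorem mem_descended_iff {ε : Frame P.toVectorBundle x₀} {m : Matrix (Fin r) (Fin r) F} :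
    m ∈ descended ε ↔ ∀ (T : Sch k) (y y' : T ⟶ specOver Y F)
    (_ : y ≫ specOver.str Y F = y' ≫ specOver.str Y F) (g : (GLn k n).obj (op T))
    (hg : a.smul (toPGL g) (y ≫ x₀) = y' ≫ x₀),
    (P.tr g hg).conj (ε.opOf y rfl m) = ε.opOf y' rfl m := Iff.rfl

theorem conj_opOf_of_mem_descended {ε : Frame P.toVectorBundle x₀} {m : Matrix (Fin r) (Fin r) F}
    (hm : m ∈ descended ε) {T : Sch k} {y y' : T ⟶ specOver Y F}
    (hy : y ≫ specOver.str Y F = y' ≫ specOver.str Y F) {x x' : T ⟶ X} (h : y ≫ x₀ = x)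
    (h' : y' ≫ x₀ = x') (g : (GLn k n).obj (op T)) (hg : a.smul (toPGL g) x = x') :
    (P.tr g hg).conj (ε.opOf y h m) = ε.opOf y' h' m := by
  subst h h'
  exact hm T y y' hy g hg

theorem exists_matrix_eq_sum {R : Type u} [CommRing R] [Algebra (FunField Y) R] {ι : Type*}
    [Fintype ι] (b : Module.Basis ι (FunField Y) F)
    (N : Matrix (Fin r) (Fin r) (R ⊗[FunField Y] F)) :
    ∃ c : ι → Matrix (Fin r) (Fin r) R,
      N = ∑ i, (c i).map (fun x => x ⊗ₜ[FunField Y] b i) := by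
  refine ⟨fun i => Matrix.of fun s t => (Algebra.TensorProduct.basis R b).repr (N s t) i, ?_⟩
  ext s t
  rw [Matrix.sum_apply]
  conv_lhs => rw [← (Algebra.TensorProduct.basis R b).sum_repr (N s t)]
  refine Finset.sum_congr rfl fun i _ => ?_
  rw [Algebra.TensorProduct.basis_apply, TensorProduct.smul_tmul', smul_eq_mul, mul_one]
  rfl

/-- The elements `1 ⊗ b i` are a basis of `R ⊗ F` over `R`, so the coefficient matrices of an
expansion are unique. -/
theorem eq_of_sum_tmul_eq {R : Type u} [CommRing R] [Algebra (FunField Y) R] {ι : Type*}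
    [Fintype ι] (b : Module.Basis ι (FunField Y) F) {c c' : ι → Matrix (Fin r) (Fin r) R}
    (h : ∑ i, (c i).map (fun x => x ⊗ₜ[FunField Y] b i) =
      ∑ i, (c' i).map (fun x => x ⊗ₜ[FunField Y] b i)) : c = c' := by
  ext i s t
  have h' := congr_arg (fun N => (Algebra.TensorProduct.basis R b).repr (N s t) i) h
  have key : ∀ c : ι → Matrix (Fin r) (Fin r) R, (Algebra.TensorProduct.basis R b).repr
      ((∑ i, (c i).map (fun x => x ⊗ₜ[FunField Y] b i)) s t) i = c i s t := by
    intro c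
    have : (∑ i, (c i).map (fun x => x ⊗ₜ[FunField Y] b i)) s t =
        ∑ i, c i s t • Algebra.TensorProduct.basis R b i := by
      rw [Matrix.sum_apply]
      refine Finset.sum_congr rfl fun i _ => ?_
      rw [Algebra.TensorProduct.basis_apply, TensorProduct.smul_tmul', smul_eq_mul, mul_one]
      rfl
    rw [this, Module.Basis.repr_sum_self]
  simp only [key] at h'
  exact h'

theorem Frame.exists_opOf_id_eq {P : VectorBundle X r} {R : Type u} [CommRing R]
    [Algebra (FunField Y) R] {x₁ : specOver Y R ⟶ X} (ε : Frame P x₁)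
    (φ : Module.End Γ((specOver Y R).left, ⊤) (Fiber P.proj x₁)) :
    ∃ N, ε.opOf (𝟙 _) (Category.id_comp _) N = φ := by
  choose N hN using fun s t => (fn_id_bijective R).2
    ((ε.pullback (𝟙 _) (Category.id_comp _)).op.symm φ s t)
  refine ⟨Matrix.of N, ?_⟩
  rw [Frame.opOf_apply, ← (ε.pullback (𝟙 _) (Category.id_comp _)).op.apply_symm_apply φ]
  congr 1
  ext s t
  exact hN s t

theorem Frame.sum_smul_opOf {P : VectorBundle X r} {R : Type u} [CommRing R]
    [Algebra (FunField Y) R] {x₁ : specOver Y R ⟶ X} (ε : Frame P x₁) {ι : Type*} [Fintype ι]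
    (b : ι → F) (c : ι → Matrix (Fin r) (Fin r) R)
    {x : specOver Y (R ⊗[FunField Y] F) ⟶ X}
    (h : specOver.map Algebra.TensorProduct.includeLeft ≫ x₁ = x) :
    ∑ i, fn (specOver.map (Algebra.TensorProduct.includeRight :
        F →ₐ[FunField Y] R ⊗[FunField Y] F)) (b i) • ε.opOf _ h (c i) =
      (ε.pullback _ h).op
        ((∑ i, (c i).map (fun x => x ⊗ₜ[FunField Y] b i)).map (fn (𝟙 _))) := by
  simp only [Frame.opOf_apply, ← map_smul, ← map_sum]
  congr 1
  ext s t
  rw [Matrix.map_apply, Matrix.sum_apply, Matrix.sum_apply, map_sum]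
  refine Finset.sum_congr rfl fun i _ => ?_
  simp only [Matrix.smul_apply, Matrix.map_apply, smul_eq_mul, fn_map]
  rw [← map_mul]
  congr 1
  simp

theorem Frame.sum_smul_opOf_injective {P : VectorBundle X r} {R : Type u} [CommRing R]
    [Algebra (FunField Y) R] {x₁ : specOver Y R ⟶ X} (ε : Frame P x₁) {ι : Type*} [Fintype ι]
    (b : Module.Basis ι (FunField Y) F) {c c' : ι → Matrix (Fin r) (Fin r) R}
    {x : specOver Y (R ⊗[FunField Y] F) ⟶ X}
    (h : specOver.map Algebra.TensorProduct.includeLeft ≫ x₁ = x)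
    (hcc : ∑ i, fn (specOver.map (Algebra.TensorProduct.includeRight :
        F →ₐ[FunField Y] R ⊗[FunField Y] F)) (b i) • ε.opOf _ h (c i) =
      ∑ i, fn (specOver.map (Algebra.TensorProduct.includeRight :
        F →ₐ[FunField Y] R ⊗[FunField Y] F)) (b i) • ε.opOf _ h (c' i)) : c = c' := by
  rw [ε.sum_smul_opOf, ε.sum_smul_opOf] at hcc
  exact eq_of_sum_tmul_eq b (Matrix.map_injective (fn_id_bijective _).1
    ((ε.pullback _ h).op.injective hcc))

theorem Frame.opOf_id_injective {P : VectorBundle X r} {R : Type u} [CommRing R]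
    [Algebra (FunField Y) R] {x₁ : specOver Y R ⟶ X} (ε : Frame P x₁) :
    Function.Injective (ε.opOf (𝟙 _) (Category.id_comp _)) := fun _ _ h =>
  Matrix.map_injective (fn_id_bijective _).1 ((ε.pullback _ _).op.injective h)

theorem Frame.opOf_pullback {P : VectorBundle X r} {R R' : Type u} [CommRing R]
    [Algebra (FunField Y) R] [CommRing R'] [Algebra (FunField Y) R'] {x₁ : specOver Y R ⟶ X}
    (ε : Frame P x₁) (φ : R →ₐ[FunField Y] R') {T : Sch k} (t : T ⟶ specOver Y R') {x : T ⟶ X}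
    (h : t ≫ specOver.map φ ≫ x₁ = x) (N : Matrix (Fin r) (Fin r) R) :
    ε.opOf (t ≫ specOver.map φ) (by rw [Category.assoc, h]) N =
      (ε.pullback (specOver.map φ) rfl).opOf t h (N.map φ) := by
  rw [Frame.opOf_apply, Frame.opOf_apply]
  have h2 : (ε.pullback (specOver.map φ) rfl).pullback t h =
      ε.pullback (t ≫ specOver.map φ) (by rw [Category.assoc, h]) := by
    simp only [Frame.pullback, Fiber.pullback_pullback]
  rw [h2, fn_comp_map]
  congr 1

variable [FiniteDimensional (FunField Y) F] (hq : IsFreeQuotient a q)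
  (hx₀ : x₀ ≫ q = specOver.str Y F) (ε : Frame P.toVectorBundle x₀)

include hq hx₀ in
/-- The descent datum applied to a matrix with coefficients in `F`. -/
theorem exists_conj_opOf_eq {ι : Type*} [Fintype ι] (b : Module.Basis ι (FunField Y) F)
    (m : Matrix (Fin r) (Fin r) F) :
    ∃ c : ι → Matrix (Fin r) (Fin r) F, ∀ (T : Sch k) (y y' : T ⟶ specOver Y F)
      (_ : y ≫ specOver.str Y F = y' ≫ specOver.str Y F) (g : (GLn k n).obj (op T))
      (hg : a.smul (toPGL g) (y ≫ x₀) = y' ≫ x₀),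
      (P.tr g hg).conj (ε.opOf y rfl m) = ∑ i, fn y (b i) • ε.opOf y' rfl (c i) := by
  let pL : specOver Y (F ⊗[FunField Y] F) ⟶ specOver Y F :=
    specOver.map Algebra.TensorProduct.includeLeft
  let pR : specOver Y (F ⊗[FunField Y] F) ⟶ specOver Y F :=
    specOver.map Algebra.TensorProduct.includeRight
  -- The universal pair, with the right factor as source and the left one as target: in the basis `1
  -- ⊗ b i` the scalars then come from the source and the coefficient matrices from the target.
  obtain ⟨g₀, hg₀⟩ := exists_smul_comp_eq hq hx₀ pR pL
    (by rw [specOver.map_str, specOver.map_str])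
  let εL := ε.pullback pL rfl
  choose N hN using fun s t => (fn_id_bijective (F ⊗[FunField Y] F)).2
    (εL.op.symm ((P.tr g₀ hg₀).conj (ε.opOf pR rfl m)) s t)
  obtain ⟨c, hc⟩ := exists_matrix_eq_sum (r := r) b (Matrix.of N)
  have key : (P.tr g₀ hg₀).conj (ε.opOf pR rfl m) = ∑ i, fn pR (b i) • ε.opOf pL rfl (c i) := by
    rw [← εL.op.apply_symm_apply ((P.tr g₀ hg₀).conj (ε.opOf pR rfl m)), ε.sum_smul_opOf, ← hc]
    congr 1
    ext s t
    exact (hN s t).symm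
  refine ⟨c, fun T y y' h g hg => ?_⟩
  obtain ⟨f, hf, hf'⟩ := exists_map_tensor y' y h.symm
  have e1 : f ≫ pR ≫ x₀ = y ≫ x₀ := by rw [← Category.assoc, hf']
  have e2 : f ≫ pL ≫ x₀ = y' ≫ x₀ := by rw [← Category.assoc, hf]
  -- The given `g` need not be the pullback of `g₀`, but conjugation by the two is the same.
  rw [WeightBundle.tr_conj_eq hq (smul_map_eq' hg₀ f e1 e2) hg]
  refine (EndCompat.conj (EndCompat.of_opOf ε pR rfl f e1 y hf' rfl m) hg₀ e2).unique εL ?_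
  rw [key]
  refine EndCompat.sum _ fun i => ?_
  have := (EndCompat.of_opOf ε pL rfl f e2 y' hf rfl (c i)).smul (fn pR (b i))
  rwa [← hf', fn_comp]

theorem WeightBundle.conj_tr_mul {T : Sch k} {g g' : (GLn k n).obj (op T)} {x x' x'' : T ⟶ X}
    (h : a.smul (toPGL g) x = x') (h' : a.smul (toPGL g') x' = x'')
    (φ : Module.End Γ(T.left, ⊤) (Fiber P.proj x)) :
    (P.tr g' h').conj ((P.tr g h).conj φ) = (P.tr (g' * g) (smul_mul_eq h h')).conj φ := by
  ext1 v
  obtain ⟨v, rfl⟩ := (P.tr _ (smul_mul_eq h h')).surjective v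
  rw [LinearEquiv.conj_apply_apply, LinearEquiv.conj_apply_apply, LinearEquiv.conj_apply_apply,
    LinearEquiv.symm_apply_apply, WeightBundle.tr_mul h h', LinearEquiv.symm_apply_apply,
    LinearEquiv.symm_apply_apply, WeightBundle.tr_mul h h']

theorem WeightBundle.conj_tr_one {T : Sch k} {x : T ⟶ X}
    (h : a.smul (toPGL 1) x = x) (φ : Module.End Γ(T.left, ⊤) (Fiber P.proj x)) :
    (P.tr 1 h).conj φ = φ := by
  have h' : ∀ v, P.tr 1 h v = v := fun v => Fiber.ext (P.action.one_smul _)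
  ext1 v
  obtain ⟨v, rfl⟩ := (P.tr 1 h).surjective v
  rw [LinearEquiv.conj_apply_apply, LinearEquiv.symm_apply_apply, h', h']

include hq hx₀ in
-- Cocycle condition. Let `s` be the point given by the right factor of `R ⊗ F`. Transporting `m`
-- from `s` to `β` and on to `α` gives `∑ b i (s)` times the transported `c i`; transporting
-- directly to `α` gives `∑ b i (s)` times `c i`. Transport does not depend on the path, and
-- coefficients with respect to `1 ⊗ b i` are unique, so each `c i` is fixed. For `R = F ⊗ F` this
-- takes place over `F ⊗ F ⊗ F`.
theorem conj_opOf_eq_of_expansion {ι : Type*} [Fintype ι] (b : Module.Basis ι (FunField Y) F)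
    (m : Matrix (Fin r) (Fin r) F) (c : ι → Matrix (Fin r) (Fin r) F)
    (hc : ∀ (T : Sch k) (y y' : T ⟶ specOver Y F)
      (_ : y ≫ specOver.str Y F = y' ≫ specOver.str Y F) (g : (GLn k n).obj (op T))
      (hg : a.smul (toPGL g) (y ≫ x₀) = y' ≫ x₀),
      (P.tr g hg).conj (ε.opOf y rfl m) = ∑ i, fn y (b i) • ε.opOf y' rfl (c i))
    {R : Type u} [CommRing R] [Algebra (FunField Y) R] (α β : F →ₐ[FunField Y] R)
    (g₀ : (GLn k n).obj (op (specOver Y R)))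
    (hg₀ : a.smul (toPGL g₀) (specOver.map β ≫ x₀) = specOver.map α ≫ x₀) (i : ι) :
    (P.tr g₀ hg₀).conj (ε.opOf (specOver.map β) rfl (c i)) =
      ε.opOf (specOver.map α) rfl (c i) := by
  let εL := ε.pullback (specOver.map α) rfl
  choose N hN using fun i => εL.exists_opOf_id_eq
    ((P.tr g₀ hg₀).conj (ε.opOf (specOver.map β) rfl (c i)))
  let t : specOver Y (R ⊗[FunField Y] F) ⟶ specOver Y R :=
    specOver.map Algebra.TensorProduct.includeLeft
  let s : specOver Y (R ⊗[FunField Y] F) ⟶ specOver Y F :=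
    specOver.map Algebra.TensorProduct.includeRight
  have htR : s ≫ specOver.str Y F = (t ≫ specOver.map β) ≫ specOver.str Y F := by
    simp only [s, t, Category.assoc, specOver.map_str]
  have htL : s ≫ specOver.str Y F = (t ≫ specOver.map α) ≫ specOver.str Y F := by
    simp only [s, t, Category.assoc, specOver.map_str]
  obtain ⟨g₁, hg₁⟩ := exists_smul_comp_eq hq hx₀ s (t ≫ specOver.map β) htR
  have hg₀' := smul_map_eq' hg₀ t (Category.assoc _ _ _).symm (Category.assoc _ _ _).symm
  have h3 := WeightBundle.conj_tr_mul (P := P) hg₁ hg₀' (ε.opOf s rfl m)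
  rw [hc _ s (t ≫ specOver.map β) htR g₁ hg₁, map_sum,
    hc _ s (t ≫ specOver.map α) htL _ (smul_mul_eq hg₁ hg₀')] at h3
  have h4 : ∀ i, (P.tr _ hg₀').conj (ε.opOf (t ≫ specOver.map β) rfl (c i)) =
      εL.opOf t (Category.assoc _ _ _).symm (N i) := by
    intro i
    refine (EndCompat.conj (EndCompat.of_opOf ε (specOver.map β) rfl t (Category.assoc _ _ _).symm
      (t ≫ specOver.map β) rfl rfl (c i)) hg₀ (Category.assoc _ _ _).symm).unique εL ?_
    rw [← hN i]
    exact EndCompat.of_opOf εL (𝟙 _) (Category.id_comp _) t _ t (Category.comp_id _) _ _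
  have h5 : ∀ i, ε.opOf (t ≫ specOver.map α) rfl (c i) =
      εL.opOf t (Category.assoc _ _ _).symm ((c i).map α) :=
    fun i => ε.opOf_pullback _ t _ (c i)
  simp only [map_smul, h4, h5] at h3
  have h6 := εL.sum_smul_opOf_injective b _ h3
  rw [← hN i, h6, ← ε.opOf_pullback α (𝟙 _) (Category.id_comp _) (c i)]
  congr 1

omit [FiniteDimensional (FunField Y) F] in
include hq in
-- Invariance passes to pullbacks, for any choice of the element of `GL_n`; hence it need only be
-- verified for the universal pair over `F ⊗ F`.
theorem conj_opOf_eq_of_map {T W : Sch k} (f : T ⟶ W) {yW yW' : W ⟶ specOver Y F}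
    {y y' : T ⟶ specOver Y F} (hf : f ≫ yW = y) (hf' : f ≫ yW' = y')
    {g₀ : (GLn k n).obj (op W)} (hg₀ : a.smul (toPGL g₀) (yW ≫ x₀) = yW' ≫ x₀)
    {g : (GLn k n).obj (op T)} (hg : a.smul (toPGL g) (y ≫ x₀) = y' ≫ x₀)
    (m : Matrix (Fin r) (Fin r) F)
    (h : (P.tr g₀ hg₀).conj (ε.opOf yW rfl m) = ε.opOf yW' rfl m) :
    (P.tr g hg).conj (ε.opOf y rfl m) = ε.opOf y' rfl m := by
  have e1 : f ≫ yW ≫ x₀ = y ≫ x₀ := by rw [← Category.assoc, hf]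
  have e2 : f ≫ yW' ≫ x₀ = y' ≫ x₀ := by rw [← Category.assoc, hf']
  rw [WeightBundle.tr_conj_eq hq (smul_map_eq' hg₀ f e1 e2) hg]
  refine (EndCompat.conj (EndCompat.of_opOf ε yW rfl f e1 y hf rfl m) hg₀ e2).unique
    (ε.pullback yW' rfl) ?_
  rw [h]
  exact EndCompat.of_opOf ε yW' rfl f e2 y' hf' rfl m

include hq hx₀ in
/-- Descent: a matrix with coefficients in `F` is a combination of invariant matrices. -/
theorem exists_eq_sum_smul_mem_descended {ι : Type*} [Fintype ι]
    (b : Module.Basis ι (FunField Y) F) (m : Matrix (Fin r) (Fin r) F) :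
    ∃ c : ι → Matrix (Fin r) (Fin r) F, (∀ i, c i ∈ descended ε) ∧ m = ∑ i, b i • c i := by
  obtain ⟨c, hc⟩ := exists_conj_opOf_eq hq hx₀ ε b m
  refine ⟨c, fun i => ?_, ?_⟩
  · rw [mem_descended_iff]
    intro T y y' h g hg
    obtain ⟨f, hf, hf'⟩ := exists_map_tensor y' y h.symm
    obtain ⟨g₀, hg₀⟩ := exists_smul_comp_eq hq hx₀ (T := specOver Y (F ⊗[FunField Y] F))
      (specOver.map Algebra.TensorProduct.includeRight)
      (specOver.map Algebra.TensorProduct.includeLeft)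
      (by rw [specOver.map_str, specOver.map_str])
    have key := conj_opOf_eq_of_expansion hq hx₀ ε b m c hc _ _ g₀ hg₀ i
    exact conj_opOf_eq_of_map hq ε f hf' hf hg₀ hg _ key
  -- Transport from the identity point to itself by the unit element turns the expansion into `m = ∑
  -- b i • c i`.
  · have h1 : a.smul (toPGL (1 : (GLn k n).obj (op (specOver Y F)))) (𝟙 _ ≫ x₀) = 𝟙 _ ≫ x₀ := by
      rw [toPGL_one, a.one_smul]
    have h2 := hc _ (𝟙 _) (𝟙 _) rfl 1 h1
    rw [WeightBundle.conj_tr_one] at h2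
    simp only [← ε.opOf_smul, ← map_sum] at h2
    exact Matrix.map_injective (fn_id_bijective _).1 ((ε.pullback _ _).op.injective h2)

include hq hx₀ in
/-- Invariant matrices that are linearly independent over the function field are linearly
independent over `F`. -/
theorem linearIndependent_of_mem_descended {ι : Type*} {m : ι → Matrix (Fin r) (Fin r) F}
    (hm : ∀ i, m i ∈ descended ε) (hli : LinearIndependent (FunField Y) m) :
    LinearIndependent F m := by
  classical
  rw [linearIndependent_iff']
  intro s c hc i hi
  let b := Module.finBasis (FunField Y) F
  -- Transport the relation `∑ c i • m i = 0` from the right factor of `F ⊗ F` to the left one: the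
  -- scalars stay on the right, and the `m i`, being invariant, move to the left.
  have key : ∑ i : s, (m i).map (fun x => x ⊗ₜ[FunField Y] c i) = 0 := by
    obtain ⟨g₀, hg₀⟩ := exists_smul_comp_eq hq hx₀ (T := specOver Y (F ⊗[FunField Y] F))
      (specOver.map Algebra.TensorProduct.includeRight)
      (specOver.map Algebra.TensorProduct.includeLeft)
      (by rw [specOver.map_str, specOver.map_str])
    have h1 := congr_arg (P.tr g₀ hg₀).conj (congr_arg (ε.opOf _ rfl) hc)
    rw [map_zero, map_zero, map_sum, map_sum] at h1
    simp only [ε.opOf_smul, map_smul] at h1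
    rw [← Finset.sum_coe_sort s] at h1
    simp only [hm _ _ _ _ (by rw [specOver.map_str, specOver.map_str]) g₀ hg₀] at h1
    rw [ε.sum_smul_opOf (fun i : s => c i) (fun i : s => m i)] at h1
    have h2 := (ε.pullback _ _).op.injective (h1.trans (map_zero _).symm)
    refine Matrix.map_injective (fn_id_bijective (Y := Y) _).1 (h2.trans ?_)
    ext; simp
  -- Comparing coefficients of `1 ⊗ b l` turns the relation over `F` into relations over the
  -- function field, one for each `l`.
  have key2 : (fun l => ∑ i : s, b.repr (c i) l • m i) = 0 := by
    apply eq_of_sum_tmul_eq b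
    have h0 : ∑ l, ((0 : Fin _ → Matrix (Fin r) (Fin r) F) l).map
        (fun x => x ⊗ₜ[FunField Y] b l) = 0 :=
      Finset.sum_eq_zero fun l _ => by ext s t; exact TensorProduct.zero_tmul _ _
    rw [h0, ← key]
    ext s t
    simp only [Matrix.sum_apply, Matrix.map_apply, Matrix.smul_apply, TensorProduct.sum_tmul,
      TensorProduct.smul_tmul]
    rw [Finset.sum_comm]
    refine Finset.sum_congr rfl fun i _ => ?_
    rw [← TensorProduct.tmul_sum, b.sum_repr]
  have key3 : ∀ l, b.repr (c i) l = 0 := by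
    intro l
    have := congr_fun key2 l
    rw [Finset.sum_coe_sort s (fun i => b.repr (c i) l • m i)] at this
    exact linearIndependent_iff'.mp hli s _ this i hi
  rw [← b.sum_repr (c i)]
  simp [key3]

end Descended

end TwistedGrassmannian

namespace TwistedGrassmannian

variable {k : Type u} [Field k]

/-! ### Gluing morphisms for the fpqc topology -/

section Gluing

/-- Morphisms of schemes over `k` glue for the fpqc topology. -/
theorem exists_amalgamation {T E : Sch k} (S : Sieve T)
    (hS : S ∈ (Scheme.fpqcTopology.over (Spec (CommRingCat.of k))) T)
    (w : ∀ {T' : Sch k} (f : T' ⟶ T), S f → (T' ⟶ E))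
    (hw : ∀ {T' T'' : Sch k} (f : T' ⟶ T) (hf : S f) (g : T'' ⟶ T'),
      w (g ≫ f) (S.downward_closed hf g) = g ≫ w f hf) :
    ∃ v : T ⟶ E, ∀ {T' : Sch k} (f : T' ⟶ T) (hf : S f), f ≫ v = w f hf := by
  have hE := GrothendieckTopology.Subcanonical.isSheaf_of_isRepresentable
    (J := Scheme.fpqcTopology.over (Spec (CommRingCat.of k))) (yoneda.obj E) S hS
  obtain ⟨v, hv, -⟩ := hE (fun T' f hf => w f hf)
    ((Presieve.compatible_iff_sieveCompatible _).mpr fun T' T'' f g hf => hw f hf g)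
  exact ⟨v, fun f hf => hv f hf⟩

theorem hom_ext_of_covering {T E : Sch k} {S : Sieve T}
    (hS : S ∈ (Scheme.fpqcTopology.over (Spec (CommRingCat.of k))) T) {v v' : T ⟶ E}
    (h : ∀ {T' : Sch k} (f : T' ⟶ T), S f → f ≫ v = f ≫ v') : v = v' := by
  have hE := GrothendieckTopology.Subcanonical.isSheaf_of_isRepresentable
    (J := Scheme.fpqcTopology.over (Spec (CommRingCat.of k))) (yoneda.obj E) S hS
  exact hE.isSeparatedFor.ext fun T' f hf => h f hf

theorem mem_fpqc_of_isOpenCover {T : Sch k} {S : Sieve T} {ι : Type u} (U : ι → T.left.Opens)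
    (hU : ⨆ i, U i = ⊤) (h : ∀ i, S (openSubι T (U i))) :
    S ∈ (Scheme.fpqcTopology.over (Spec (CommRingCat.of k))) T := by
  rw [GrothendieckTopology.mem_over_iff]
  refine Scheme.fpqcTopology.superset_covering ?_ (Scheme.zariskiTopology_le_fpqcTopology _
    (T.left.openCoverOfIsOpenCover U hU).mem_grothendieckTopology)
  rw [Sieve.ofArrows, Sieve.generate_le_iff, Presieve.ofArrows_le_iff]
  exact fun i => (Sieve.overEquiv_iff _ _).mpr (h i)

/-- A flat, surjective and quasi-compact morphism generates a covering sieve, and by transitivity a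
sieve may be tested after pullback to a covering. -/
theorem mem_fpqc_of_flat {T T' : Sch k} {S : Sieve T} (p : T' ⟶ T) [Flat p.left]
    [Surjective p.left] [QuasiCompact p.left]
    (h : S.pullback p ∈ (Scheme.fpqcTopology.over (Spec (CommRingCat.of k))) T') :
    S ∈ (Scheme.fpqcTopology.over (Spec (CommRingCat.of k))) T := by
  refine GrothendieckTopology.transitive _
    (S := Sieve.generate (Presieve.singleton p)) ?_ S ?_
  · rw [GrothendieckTopology.mem_over_iff, Sieve.overEquiv_generate]
    refine Scheme.fpqcTopology.superset_covering ?_ (Precoverage.generate_mem_toGrothendieck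
      p.left.singleton_mem_fpqcPrecoverage)
    rw [Sieve.generate_le_iff]
    rintro _ _ ⟨⟩
    exact Sieve.le_generate _ _ _ (Presieve.image_mem_functorPushforward _ _ (Presieve.singleton.mk (f := p)))
  · rintro W _ ⟨_, g, _, ⟨⟩, rfl⟩
    rw [Sieve.pullback_comp]
    exact GrothendieckTopology.pullback_stable _ g h

theorem isUnit_appTop_openSubι_basicOpen {T : Sch k} (f : Γ(T.left, ⊤)) :
    IsUnit ((openSubι T (T.left.basicOpen f)).left.appTop f) := by
  let U := T.left.basicOpen f
  have h : U.toScheme.basicOpen (U.ι.appTop f) = ⊤ := by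
    rw [← Scheme.preimage_basicOpen_top, Scheme.Opens.ι_preimage_self]
  refine RingedSpace.isUnit_of_isUnit_germ U.toScheme.toLocallyRingedSpace.toRingedSpace ⊤ _ ?_
  intro x hx
  have hx' : x ∈ U.toScheme.basicOpen (U.ι.appTop f) := by rw [h]; trivial
  exact (U.toScheme.mem_basicOpen_top _ x).mp hx'

/-- Elements of `PGL_n` lift to `GL_n` locally. -/
theorem exists_toPGL_eq_mem_fpqc {n : ℕ} {T : Sch k} (S : Sieve T) (φ : (PGLn k n).obj (op T))
    (h : ∀ {T' : Sch k} (f : T' ⟶ T),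
      (∃ g : (GLn k n).obj (op T'), toPGL g = (PGLn k n).map f.op φ) → S f) :
    S ∈ (Scheme.fpqcTopology.over (Spec (CommRingCat.of k))) T := by
  obtain ⟨s, hs, hs'⟩ := exists_span_eq_top_and_conj_eq (R := Γ(T.left, ⊤)) φ
  refine mem_fpqc_of_isOpenCover (fun f : s => T.left.basicOpen f.1) ?_ fun f => h _ ?_
  · rw [iSup_subtype]
    exact iSup_basicOpen_of_span_eq_top _ _ hs
  · obtain ⟨g, hg⟩ := hs' f.1 f.2 (R' := Γ((openSub T (T.left.basicOpen f.1)).left, ⊤))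
      (openSubι T (T.left.basicOpen f.1)).left.appTop.hom (isUnit_appTop_openSubι_basicOpen f.1)
    exact ⟨g, hg⟩

end Gluing

/-! ### The generic fibre is covered by translates of a point over `F` -/

section Cover

variable {n : ℕ} {X Y : Sch k} [IsIntegral Y.left] {a : GroupAction (PGLn k n) X} {q : X ⟶ Y}
variable {F : Type u} [Field F] [Algebra (FunField Y) F] {x₀ : specOver Y F ⟶ X}

/-- The sieve on `T` of the morphisms along which the point `x : T ⟶ X` becomes the translate under
an element of `GL_n` of a point that factors through `x₀ : Spec F ⟶ X`. -/
def translateSieve (a : GroupAction (PGLn k n) X) (x₀ : specOver Y F ⟶ X) {T : Sch k}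
    (x : T ⟶ X) : Sieve T where
  arrows T' f := ∃ (y : T' ⟶ specOver Y F) (g : (GLn k n).obj (op T')),
    a.smul (toPGL g) (y ≫ x₀) = f ≫ x
  downward_closed := by
    rintro T' T'' f ⟨y, g, h⟩ f'
    exact ⟨f' ≫ y, (GLn k n).map f'.op g, smul_map_eq' h f' (Category.assoc _ _ _).symm
      (Category.assoc _ _ _).symm⟩

/-- After base change along the faithfully flat `Spec F → Spec k(Y)`, the point `s.x` and a point
through `x₀` agree in `Y`. They differ by an element of `PGL_n` since `q` is a principal bundle, and
this element lifts to `GL_n` Zariski locally. -/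
theorem translateSieve_mem (hq : IsFreeQuotient a q) (hx₀ : x₀ ≫ q = specOver.str Y F)
    (s : GenericFiberPoint q) :
    translateSieve a x₀ s.x ∈ (Scheme.fpqcTopology.over (Spec (CommRingCat.of k))) s.T := by
  let j : Spec (CommRingCat.of F) ⟶ Spec Y.left.functionField :=
    Spec.map (CommRingCat.ofHom (algebraMap (FunField Y) F))
  obtain ⟨hj, hj'⟩ : Flat j ∧ Surjective j := by
    refine (flat_and_surjective_SpecMap_iff _).mpr ?_
    exact RingHom.faithfullyFlat_algebraMap_iff.mpr (inferInstanceAs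
      (Module.FaithfullyFlat (FunField Y) F))
  let T' : Sch k := Over.mk (Limits.pullback.fst s.t j ≫ s.T.hom)
  let p : T' ⟶ s.T := Over.homMk (Limits.pullback.fst s.t j)
  have : Flat p.left := inferInstanceAs (Flat (Limits.pullback.fst s.t j))
  have : Surjective p.left := inferInstanceAs (Surjective (Limits.pullback.fst s.t j))
  have : QuasiCompact p.left := inferInstanceAs (QuasiCompact (Limits.pullback.fst s.t j))
  have hy : Limits.pullback.snd s.t j ≫ j ≫ Y.left.fromSpecStalk (genericPoint Y.left) =
      Limits.pullback.fst s.t j ≫ (s.x ≫ q).left := by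
    rw [← Limits.pullback.condition_assoc, s.comm]
  let y : T' ⟶ specOver Y F := Over.homMk (Limits.pullback.snd s.t j) (by
    have h1 : (s.x ≫ q).left ≫ Y.hom = s.T.hom := Over.w (s.x ≫ q)
    have h2 := congr_arg (· ≫ Y.hom) hy
    simp only [Category.assoc, h1] at h2
    exact h2)
  have hyx : (y ≫ x₀) ≫ q = (p ≫ s.x) ≫ q := by
    rw [Category.assoc, hx₀, Category.assoc]
    ext1
    exact hy
  obtain ⟨φ, hφ, -⟩ := hq.existsUnique_smul_eq _ _ hyx
  refine mem_fpqc_of_flat p (exists_toPGL_eq_mem_fpqc _ φ ?_)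
  rintro W f ⟨g, hg⟩
  refine ⟨f ≫ y, g, ?_⟩
  rw [hg, Category.assoc, ← a.comp_smul, hφ, Category.assoc]

end Cover

end TwistedGrassmannian

namespace TwistedGrassmannian

variable {k : Type u} [Field k]

/-! ### Invariant matrices as equivariant endomorphisms over the generic fibre -/

section Extension

variable {n : ℕ} {X Y : Sch k} [IsIntegral Y.left] {a : GroupAction (PGLn k n) X} {q : X ⟶ Y}
variable {F : Type u} [Field F] [Algebra (FunField Y) F] {x₀ : specOver Y F ⟶ X}
variable {r : ℕ} {w : ℤ} {P : WeightBundle a r w}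

/-- `v'` is the value at `v` of the equivariant endomorphism given by the matrix `m`. -/
def IsValue (ε : Frame P.toVectorBundle x₀) (m : Matrix (Fin r) (Fin r) F) {T : Sch k} {x : T ⟶ X}
    (v v' : Fiber P.proj x) : Prop :=
  ∀ (T' : Sch k) (f : T' ⟶ T) (x' : T' ⟶ X) (hx : f ≫ x = x') (y : T' ⟶ specOver Y F)
    (g : (GLn k n).obj (op T')) (hg : a.smul (toPGL g) (y ≫ x₀) = x'),
    v'.pullback f hx = (P.tr g hg).conj (ε.opOf y rfl m) (v.pullback f hx)

variable (hq : IsFreeQuotient a q) (hx₀ : x₀ ≫ q = specOver.str Y F)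
  (ε : Frame P.toVectorBundle x₀)

include hq hx₀ in
theorem IsValue.unique {ε : Frame P.toVectorBundle x₀} {m : Matrix (Fin r) (Fin r) F}
    (s : GenericFiberPoint q) {v v' v'' : Fiber P.proj s.x} (h : IsValue ε m v v')
    (h' : IsValue ε m v v'') : v' = v'' := by
  refine Fiber.ext (hom_ext_of_covering (translateSieve_mem hq hx₀ s) ?_)
  rintro T' f ⟨y, g, hg⟩
  exact congr_arg Subtype.val ((h T' f _ rfl y g hg).trans (h' T' f _ rfl y g hg).symm)

include hq hx₀ in
-- The points `y` and `y'` agree over `Y`, so some `h` in `GL_n` relates them. Invariance moves `m`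
-- along `h`, and any two transports to `x` induce the same conjugation. So the local values of the
-- extended endomorphism are independent of all choices.
theorem conj_opOf_eq_conj_opOf [FiniteDimensional (FunField Y) F] {m : Matrix (Fin r) (Fin r) F}
    (hm : m ∈ descended ε) {T : Sch k} {x : T ⟶ X} {y y' : T ⟶ specOver Y F}
    {g g' : (GLn k n).obj (op T)} (hg : a.smul (toPGL g) (y ≫ x₀) = x)
    (hg' : a.smul (toPGL g') (y' ≫ x₀) = x) :
    (P.tr g hg).conj (ε.opOf y rfl m) = (P.tr g' hg').conj (ε.opOf y' rfl m) := by
  have hy : y ≫ specOver.str Y F = y' ≫ specOver.str Y F := by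
    rw [← hx₀, ← Category.assoc, ← Category.assoc, ← hq.smul_comp (toPGL g) (y ≫ x₀), hg,
      ← hq.smul_comp (toPGL g') (y' ≫ x₀), hg']
  obtain ⟨h, hh⟩ := exists_smul_comp_eq hq hx₀ y y' hy
  rw [← hm T y y' hy h hh, WeightBundle.conj_tr_mul, WeightBundle.tr_conj_eq hq]

include hq hx₀ in
-- The local values on the translate sieve are compatible by `conj_opOf_eq_conj_opOf`, so they glue
-- to a morphism into the total space of `P`; that it lies over `s.x` is again checked locally.
theorem exists_isValue [FiniteDimensional (FunField Y) F] {m : Matrix (Fin r) (Fin r) F}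
    (hm : m ∈ descended ε) (s : GenericFiberPoint q) (v : Fiber P.proj s.x) :
    ∃ v', IsValue ε m v v' := by
  have hS := translateSieve_mem hq hx₀ s
  choose y g hg using fun (T' : Sch k) (f : T' ⟶ s.T) (hf : translateSieve a x₀ s.x f) => hf
  obtain ⟨v', hv'⟩ := exists_amalgamation _ hS (E := P.total)
    (fun {T'} f hf => ((P.tr (g T' f hf) (hg T' f hf)).conj (ε.opOf (y T' f hf) rfl m)
      (v.pullback f rfl)).1) (by
    intro T' T'' f hf f'
    have h1 := EndCompat.conj (EndCompat.of_opOf ε (y T' f hf) rfl f' (Category.assoc _ _ _).symm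
      (f' ≫ y T' f hf) rfl rfl m) (hg T' f hf) (Category.assoc _ _ _).symm
    have h2 := h1 (v.pullback f rfl)
    rw [conj_opOf_eq_conj_opOf hq hx₀ ε hm _ (hg T'' (f' ≫ f) _), Fiber.pullback_pullback] at h2
    exact congr_arg Subtype.val h2)
  have hproj : v' ≫ P.proj = s.x := by
    refine hom_ext_of_covering hS fun f hf => ?_
    rw [← Category.assoc, hv' f hf]
    exact ((P.tr (g _ f hf) (hg _ f hf)).conj (ε.opOf (y _ f hf) rfl m) (v.pullback f rfl)).2
  refine ⟨⟨v', hproj⟩, ?_⟩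
  rintro T' f _ rfl y' g' hg'
  refine Fiber.ext ?_
  have hf : translateSieve a x₀ s.x f := ⟨y', g', hg'⟩
  refine (hv' f hf).trans ?_
  rw [conj_opOf_eq_conj_opOf hq hx₀ ε hm (hg T' f hf) hg']

theorem IsValue.add {m : Matrix (Fin r) (Fin r) F} {T : Sch k} {x : T ⟶ X}
    {v v' w w' : Fiber P.proj x} (h : IsValue ε m v v') (h' : IsValue ε m w w') :
    IsValue ε m (v + w) (v' + w') := fun T' f x' hx y g hg => by
  rw [P.pullback_add, P.pullback_add, map_add, h T' f x' hx y g hg, h' T' f x' hx y g hg]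

theorem IsValue.smul {m : Matrix (Fin r) (Fin r) F} {T : Sch k} {x : T ⟶ X}
    {v v' : Fiber P.proj x} (h : IsValue ε m v v') (c : Γ(T.left, ⊤)) :
    IsValue ε m (c • v) (c • v') := fun T' f x' hx y g hg => by
  rw [P.pullback_smul, P.pullback_smul, map_smul, h T' f x' hx y g hg]

theorem IsValue.pullback {m : Matrix (Fin r) (Fin r) F} {T : Sch k} {x : T ⟶ X}
    {v v' : Fiber P.proj x} (h : IsValue ε m v v') {T' : Sch k} (f : T' ⟶ T) {x' : T' ⟶ X}
    (hx : f ≫ x = x') : IsValue ε m (v.pullback f hx) (v'.pullback f hx) :=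
    fun T'' f' x'' hx' y g hg => by
  rw [Fiber.pullback_pullback, Fiber.pullback_pullback]
  exact h T'' (f' ≫ f) x'' _ y g hg

theorem IsValue.eq_opOf {m : Matrix (Fin r) (Fin r) F} {T : Sch k} {x : T ⟶ X}
    {v v' : Fiber P.proj x} (h : IsValue ε m v v') {y : T ⟶ specOver Y F} (hy : y ≫ x₀ = x) :
    v' = ε.opOf y hy m v := by
  subst hy
  have hg : a.smul (toPGL 1) (y ≫ x₀) = y ≫ x₀ := by rw [toPGL_one, a.one_smul]
  have h1 := h T (𝟙 T) _ (Category.id_comp _) y 1 hg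
  rwa [Fiber.pullback_id, Fiber.pullback_id, WeightBundle.conj_tr_one] at h1

include hq in
-- A transport from `x₀` to the translated point is a transport to the original point followed by
-- the one along `g`, so independence of transport is exactly equivariance.
theorem IsValue.tr {m : Matrix (Fin r) (Fin r) F} {T : Sch k} {x : T ⟶ X}
    {v v' : Fiber P.proj x} (h : IsValue ε m v v') (g : (GLn k n).obj (op T)) {z : T ⟶ X}
    (hg : a.smul (toPGL g) x = z) : IsValue ε m (P.tr g hg v) (P.tr g hg v') := by
  intro T' f z' hz y g₁ hg₁
  have hg' := smul_map_eq' hg f rfl hz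
  have h1 := smul_mul_eq hg₁ (smul_inv_eq hg')
  have h2 := WeightBundle.conj_tr_mul (P := P) h1 hg' (ε.opOf y rfl m)
  rw [WeightBundle.tr_conj_eq hq hg₁ (smul_mul_eq h1 hg')] at h2
  rw [WeightBundle.tr_pullback hg v f rfl hz, WeightBundle.tr_pullback hg v' f rfl hz, ← h2,
    LinearEquiv.conj_apply_apply, LinearEquiv.symm_apply_apply, h T' f _ rfl y _ h1]

/-- The equivariant endomorphism over the generic fibre given by an invariant matrix. -/
noncomputable def extendMatrix [FiniteDimensional (FunField Y) F] {m : Matrix (Fin r) (Fin r) F}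
    (hm : m ∈ descended ε) (s : GenericFiberPoint q) :
    Module.End Γ(s.T.left, ⊤) (Fiber P.proj s.x) where
  toFun v := (exists_isValue hq hx₀ ε hm s v).choose
  map_add' v v' := IsValue.unique hq hx₀ s (exists_isValue hq hx₀ ε hm s _).choose_spec
    ((exists_isValue hq hx₀ ε hm s v).choose_spec.add ε (exists_isValue hq hx₀ ε hm s v').choose_spec)
  map_smul' c v := IsValue.unique hq hx₀ s (exists_isValue hq hx₀ ε hm s _).choose_spec
    ((exists_isValue hq hx₀ ε hm s v).choose_spec.smul ε c)

theorem isValue_extendMatrix [FiniteDimensional (FunField Y) F] {m : Matrix (Fin r) (Fin r) F}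
    (hm : m ∈ descended ε) (s : GenericFiberPoint q) (v : Fiber P.proj s.x) :
    IsValue ε m v (extendMatrix hq hx₀ ε hm s v) :=
  (exists_isValue hq hx₀ ε hm s v).choose_spec

theorem extendMatrix_mem [FiniteDimensional (FunField Y) F] {m : Matrix (Fin r) (Fin r) F}
    (hm : m ∈ descended ε) : extendMatrix hq hx₀ ε hm ∈ genericEnd P q := by
  refine ⟨fun s s' f h v => ?_, fun T g x t h h' v => ?_⟩
  · exact IsValue.unique hq hx₀ s' (isValue_extendMatrix hq hx₀ ε hm s' _)
      ((isValue_extendMatrix hq hx₀ ε hm s v).pullback ε f h)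
  · exact IsValue.unique hq hx₀ ⟨T, a.smul (toPGL g) x, t, h'⟩
      (isValue_extendMatrix hq hx₀ ε hm ⟨T, a.smul (toPGL g) x, t, h'⟩ _)
      ((isValue_extendMatrix hq hx₀ ε hm ⟨T, x, t, h⟩ v).tr hq ε g rfl)

omit ε in
/-- A point that factors through `x₀ : Spec F ⟶ X`, as a point of the generic fibre. -/
noncomputable def genericFiberPoint {T : Sch k} (y : T ⟶ specOver Y F) {x : T ⟶ X}
    (h : y ≫ x₀ = x) : GenericFiberPoint q where
  T := T
  x := x
  t := y.left ≫ Spec.map (CommRingCat.ofHom (algebraMap (FunField Y) F))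
  comm := by rw [← h, Category.assoc, Category.assoc, hx₀]; rfl

theorem scalars_genericFiberPoint {T : Sch k} (y : T ⟶ specOver Y F) {x : T ⟶ X}
    (h : y ≫ x₀ = x) (c : FunField Y) :
    (genericFiberPoint hx₀ y h).scalars c = fn y (algebraMap (FunField Y) F c) :=
  RingHom.congr_fun (pullFun_SpecMap y.left (CommRingCat.ofHom (algebraMap (FunField Y) F))) c

theorem endCompat_genericEnd {φ : ∀ s : GenericFiberPoint q, Module.End Γ(s.T.left, ⊤) (Fiber P.proj s.x)}
    (hφ : φ ∈ genericEnd P q) {m : Matrix (Fin r) (Fin r) F}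
    (hm : ε.opOf (𝟙 _) (Category.id_comp _) m = φ (genericFiberPoint hx₀ (𝟙 _) (Category.id_comp _)))
    (s : GenericFiberPoint q) (y : s.T ⟶ specOver Y F) (h : y ≫ x₀ = s.x) :
    φ s = ε.opOf y h m := by
  have h1 := hφ.1 (genericFiberPoint hx₀ (𝟙 _) (Category.id_comp _)) s y h
  rw [← hm] at h1
  exact EndCompat.unique ε h1 (EndCompat.of_opOf ε (𝟙 _) (Category.id_comp _) y h y
    (Category.comp_id _) h m)

theorem conj_genericEnd {φ : ∀ s : GenericFiberPoint q, Module.End Γ(s.T.left, ⊤) (Fiber P.proj s.x)}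
    (hφ : φ ∈ genericEnd P q) {T : Sch k} {x x' : T ⟶ X} {g : (GLn k n).obj (op T)}
    (hg : a.smul (toPGL g) x = x') (t h h') :
    (P.tr g hg).conj (φ ⟨T, x, t, h⟩) = φ ⟨T, x', t, h'⟩ := by
  subst hg
  ext1 v
  obtain ⟨v, rfl⟩ := (P.tr g rfl).surjective v
  rw [LinearEquiv.conj_apply_apply, LinearEquiv.symm_apply_apply]
  exact (hφ.2 T g x t h h' v).symm

theorem mem_descended_of_genericEnd
    {φ : ∀ s : GenericFiberPoint q, Module.End Γ(s.T.left, ⊤) (Fiber P.proj s.x)}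
    (hφ : φ ∈ genericEnd P q) {m : Matrix (Fin r) (Fin r) F}
    (hm : ε.opOf (𝟙 _) (Category.id_comp _) m = φ (genericFiberPoint hx₀ (𝟙 _) (Category.id_comp _))) :
    m ∈ descended ε := by
  intro T y y' hy g hg
  have e1 : ε.opOf y rfl m = φ (genericFiberPoint hx₀ y rfl) :=
    (endCompat_genericEnd hx₀ ε hφ hm (genericFiberPoint hx₀ y rfl) y rfl).symm
  have e2 : ε.opOf y' rfl m = φ (genericFiberPoint hx₀ y' rfl) :=
    (endCompat_genericEnd hx₀ ε hφ hm (genericFiberPoint hx₀ y' rfl) y' rfl).symm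
  rw [e1, e2]
  have h1 : y'.left ≫ Spec.map (CommRingCat.ofHom (algebraMap (FunField Y) F)) =
      y.left ≫ Spec.map (CommRingCat.ofHom (algebraMap (FunField Y) F)) := by
    rw [← cancel_mono (Y.left.fromSpecStalk (genericPoint Y.left))]
    exact congr_arg (fun f => f.left) hy.symm
  have h2 := conj_genericEnd hφ hg (y.left ≫ Spec.map (CommRingCat.ofHom (algebraMap (FunField Y) F)))
    (genericFiberPoint hx₀ y rfl).comm (h1 ▸ (genericFiberPoint hx₀ y' rfl).comm)
  refine h2.trans ?_
  unfold genericFiberPoint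
  congr 1
  congr 1
  exact h1.symm

/-- The endomorphisms of the fibre of `P` at `x₀`, as matrices. -/
noncomputable def endToMatrix :
    Module.End Γ((specOver Y F).left, ⊤) (Fiber P.proj x₀) ≃+* Matrix (Fin r) (Fin r) F :=
  (RingEquiv.ofBijective (ε.opOf (𝟙 _) (Category.id_comp _))
    ⟨ε.opOf_id_injective, fun φ => ε.exists_opOf_id_eq φ⟩).symm

theorem opOf_endToMatrix (φ : Module.End Γ((specOver Y F).left, ⊤) (Fiber P.proj x₀)) :
    ε.opOf (𝟙 _) (Category.id_comp _) (endToMatrix ε φ) = φ :=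
  (endToMatrix ε).symm_apply_apply φ

/-- Restriction of equivariant endomorphisms to `x₀`. -/
noncomputable def genericEndToMatrix : genericEnd P q →ₐ[FunField Y] Matrix (Fin r) (Fin r) F where
  toFun φ := endToMatrix ε (φ.1 (genericFiberPoint hx₀ (𝟙 _) (Category.id_comp _)))
  map_one' := map_one _
  map_mul' φ ψ := map_mul _ _ _
  map_zero' := map_zero _
  map_add' φ ψ := map_add _ _ _
  commutes' c := by
    apply ε.opOf_id_injective
    refine (opOf_endToMatrix ε _).trans ?_
    have h : algebraMap (FunField Y) (Matrix (Fin r) (Fin r) F) c =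
        algebraMap (FunField Y) F c • (1 : Matrix (Fin r) (Fin r) F) := by
      rw [Algebra.algebraMap_eq_smul_one, algebraMap_smul]
    rw [h, Frame.opOf_smul, map_one, ← scalars_genericFiberPoint hx₀ (𝟙 _) (Category.id_comp _)]
    rfl

theorem opOf_genericEndToMatrix (φ : genericEnd P q) :
    ε.opOf (𝟙 _) (Category.id_comp _) (genericEndToMatrix hx₀ ε φ) =
      φ.1 (genericFiberPoint hx₀ (𝟙 _) (Category.id_comp _)) :=
  opOf_endToMatrix ε _

include hq in
-- Restricted to `x₀`, an equivariant endomorphism gives an invariant matrix, because equivariance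
-- along points through `x₀` is the invariance condition. Conversely, an invariant matrix spreads to
-- the whole generic fibre by translation and gluing.
theorem range_genericEndToMatrix [FiniteDimensional (FunField Y) F] :
    (genericEndToMatrix hx₀ ε).range = descended ε := by
  apply le_antisymm
  · rintro _ ⟨φ, rfl⟩
    exact mem_descended_of_genericEnd hx₀ ε φ.2 (opOf_genericEndToMatrix hx₀ ε φ)
  · intro m hm
    refine ⟨⟨extendMatrix hq hx₀ ε hm, extendMatrix_mem hq hx₀ ε hm⟩, ?_⟩
    apply ε.opOf_id_injective
    refine (opOf_genericEndToMatrix hx₀ ε _).trans ?_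
    ext1 v
    exact (isValue_extendMatrix hq hx₀ ε hm _ v).eq_opOf ε (Category.id_comp _)

include hq hx₀ in
-- Restriction to `x₀` is injective because it is a homomorphism from a simple ring to a ring that
-- is nonzero when `r` is positive.
theorem nonempty_genericEnd_equiv [FiniteDimensional (FunField Y) F] [IsSimpleRing (genericEnd P q)]
    (hr : 0 < r) : Nonempty (genericEnd P q ≃ₐ[FunField Y] descended ε) := by
  have : Nonempty (Fin r) := ⟨⟨0, hr⟩⟩
  rw [← range_genericEndToMatrix hq hx₀ ε]
  exact ⟨AlgEquiv.ofInjective _ ((genericEndToMatrix hx₀ ε).toRingHom.injective)⟩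

end Extension

end TwistedGrassmannian

namespace TwistedGrassmannian

/-! ### Idempotents of prescribed rank -/

section Idempotents

variable {K : Type u} [Field K]

/-- Morita theory: `V` is a sum of copies, indexed by `ι`, of the `Δ`-vector space `W = E_jj V`. -/
theorem finrank_dvd_of_matrix_module {ι : Type} [Fintype ι] [DecidableEq ι] [Nonempty ι]
    {Δ : Type u} [DivisionRing Δ] [Algebra K Δ] [FiniteDimensional K Δ] {V : Type u}
    [AddCommGroup V] [Module (Matrix ι ι Δ) V] [Module K V] [IsScalarTower K (Matrix ι ι Δ) V]
    [FiniteDimensional K V] :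
    Fintype.card ι * Module.finrank K Δ ∣ Module.finrank K V := by
  let : Module Δ V := Module.compHom V (Matrix.scalar (α := Δ) ι)
  have hsc : ∀ (d : Δ) (v : V), d • v = Matrix.scalar ι d • v := fun _ _ => rfl
  have : IsScalarTower Δ (Matrix ι ι Δ) V := ⟨fun d m v => by
    rw [hsc, ← mul_smul, Matrix.scalar_apply, Matrix.smul_eq_diagonal_mul]⟩
  have : IsScalarTower K Δ V := ⟨fun c d v => by
    rw [hsc, hsc, ← smul_assoc]
    congr 1
    ext i j
    simp [Matrix.diagonal_apply]⟩
  let j : ι := Classical.arbitrary ι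
  let W := MatrixModCat.toModuleCatObj Δ V j
  have hmem : ∀ (i : ι) (v : V), Matrix.single j i (1 : Δ) • v ∈ W := fun i v =>
    (MatrixModCat.mem_toModuleCatObj j).2 ⟨Matrix.single j i (1 : Δ) • v, by
      rw [← mul_smul, Matrix.single_mul_single_same, mul_one]⟩
  have hcomm : ∀ (c : K) (M : Matrix ι ι Δ) (v : V), M • c • v = c • M • v := fun c M v => by
    have h1 : c • v = (c • (1 : Matrix ι ι Δ)) • v := by rw [smul_assoc, one_smul]
    rw [h1, ← mul_smul, mul_smul_comm, mul_one, smul_assoc]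
  let f : V ≃ₗ[K] (ι → W) :=
    { toFun v i := ⟨Matrix.single j i (1 : Δ) • v, hmem i v⟩
      map_add' v v' := by ext i; simp
      map_smul' c v := by
        ext i
        simp [hcomm]
      invFun w := ∑ i, Matrix.single i j (1 : Δ) • (w i : V)
      left_inv v := by simp [← mul_smul, ← Finset.sum_smul, Matrix.sum_single_one]
      right_inv w := by
        ext i
        simp only [Finset.smul_sum]
        rw [Finset.sum_eq_single i (fun b _ hb ↦ by
          simp [← mul_smul, Matrix.single_mul_single_of_ne _ _ _ _ hb.symm]) (by simp)]
        obtain ⟨y, hy⟩ := (MatrixModCat.mem_toModuleCatObj j).1 (w i).2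
        simp [← mul_smul, ← hy] }
  have : Module.Finite K W := Module.Finite.of_injective (W.subtype.restrictScalars K)
    Subtype.val_injective
  rw [f.finrank_eq, Module.finrank_pi_fintype, Finset.sum_const, smul_eq_mul, Finset.card_univ,
    ← Module.finrank_mul_finrank K Δ W, ← mul_assoc]
  exact dvd_mul_right _ _

theorem rank_add_of_orthogonal {F : Type*} [Field F] {r : ℕ} {p p' : Matrix (Fin r) (Fin r) F}
    (hp : p * p = p) (hp' : p' * p' = p') (h : p * p' = 0) (h' : p' * p = 0) :
    (p + p').rank = p.rank + p'.rank := by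
  have hr : LinearMap.range (p + p').mulVecLin =
      LinearMap.range p.mulVecLin ⊔ LinearMap.range p'.mulVecLin := by
    apply le_antisymm
    · rintro _ ⟨v, rfl⟩
      rw [Matrix.mulVecLin_add]
      exact Submodule.add_mem_sup ⟨v, rfl⟩ ⟨v, rfl⟩
    · refine sup_le ?_ ?_
      · rintro _ ⟨v, rfl⟩
        exact ⟨p.mulVec v, by simp [hp, h']⟩
      · rintro _ ⟨v, rfl⟩
        exact ⟨p'.mulVec v, by simp [hp', h]⟩
  have hd : LinearMap.range p.mulVecLin ⊓ LinearMap.range p'.mulVecLin = ⊥ := by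
    rw [eq_bot_iff]
    rintro _ ⟨⟨v, rfl⟩, ⟨v', hv'⟩⟩
    have h1 : p.mulVec (p.mulVec v) = p.mulVec (p'.mulVec v') := congr_arg p.mulVec hv'.symm
    rw [Matrix.mulVec_mulVec, Matrix.mulVec_mulVec, hp, h, Matrix.zero_mulVec] at h1
    exact h1
  have := Submodule.finrank_sup_add_finrank_inf_eq (LinearMap.range p.mulVecLin)
    (LinearMap.range p'.mulVecLin)
  rw [hd, finrank_bot, add_zero, ← hr] at this
  exact this

variable {F : Type u} [Field F] [Algebra K F] {r : ℕ}

/-- The diagonal units factor through one another, `E_ii = E_ij E_jj E_ji`, so their images have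
equal rank; ranks of orthogonal idempotents add up. -/
theorem rank_map_sum_single {Δ : Type u} [DivisionRing Δ] [Algebra K Δ] {m : ℕ} [NeZero m]
    (f : Matrix (Fin m) (Fin m) Δ →ₐ[K] Matrix (Fin r) (Fin r) F) (S : Finset (Fin m)) :
    (f (∑ i ∈ S, Matrix.single i i 1)).rank = S.card * (f (Matrix.single 0 0 1)).rank := by
  classical
  have hle : ∀ i j, (f (Matrix.single i i 1)).rank ≤ (f (Matrix.single j j 1)).rank := by
    intro i j
    have : (Matrix.single i i 1 : Matrix (Fin m) (Fin m) Δ) =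
        Matrix.single i j 1 * (Matrix.single j j 1 * Matrix.single j i 1) := by simp
    rw [this, map_mul, map_mul]
    exact (Matrix.rank_mul_le_right _ _).trans (Matrix.rank_mul_le_left _ _)
  induction S using Finset.induction_on with
  | empty => simp
  | insert i S hi ih =>
    have h1 : Matrix.single i i (1 : Δ) * ∑ l ∈ S, Matrix.single l l 1 = 0 := by
      rw [Finset.mul_sum]
      exact Finset.sum_eq_zero fun l hl =>
        Matrix.single_mul_single_of_ne _ _ _ _ (fun h : i = l => hi (h ▸ hl)) _
    have h2 : (∑ l ∈ S, Matrix.single l l 1) * Matrix.single i i (1 : Δ) = 0 := by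
      rw [Finset.sum_mul]
      exact Finset.sum_eq_zero fun l hl =>
        Matrix.single_mul_single_of_ne _ _ _ _ (fun h : l = i => hi (h ▸ hl)) _
    have h3 : (∑ l ∈ S, Matrix.single l l (1 : Δ)) * (∑ l ∈ S, Matrix.single l l (1 : Δ)) =
        ∑ l ∈ S, Matrix.single l l (1 : Δ) := by
      rw [Finset.sum_mul_sum]
      refine Finset.sum_congr rfl fun l hl => ?_
      rw [Finset.sum_eq_single l, Matrix.single_mul_single_same, mul_one]
      · exact fun b _ hb => Matrix.single_mul_single_of_ne _ _ _ _ hb.symm _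
      · exact fun h => absurd hl h
    rw [Finset.sum_insert hi, map_add, rank_add_of_orthogonal, ih, Finset.card_insert_of_notMem hi,
      le_antisymm (hle i 0) (hle 0 i)]
    · ring
    · rw [← map_mul, Matrix.single_mul_single_same, mul_one]
    · rw [← map_mul, h3]
    · rw [← map_mul, h1, map_zero]
    · rw [← map_mul, h2, map_zero]

/-- A simple algebra of degree `r` that is Brauer equivalent to an algebra of degree `j ≤ r`
contains an idempotent of rank `j`. -/
theorem exists_idempotent_rank_eq {A D : CSA.{u, u} K} (h : IsBrauerEquivalent A D) {j : ℕ}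
    (hj : 0 < j) (hjr : j ≤ r) (hA : Module.finrank K A = r ^ 2) (hD : Module.finrank K D = j ^ 2)
    (f : A →ₐ[K] Matrix (Fin r) (Fin r) F) : ∃ e : A, e * e = e ∧ (f e).rank = j := by
  classical
  obtain ⟨s, t, hs, ht, ⟨α⟩⟩ := h
  have : IsArtinianRing A := IsArtinianRing.of_finite K A
  obtain ⟨m, _, Δ, _, _, _, ⟨β⟩⟩ := IsSimpleRing.exists_algEquiv_matrix_divisionRing_finite K A
  have : NeZero s := ⟨hs⟩
  have hm : 0 < m := Nat.pos_of_ne_zero (NeZero.ne m)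
  let f' : Matrix (Fin m) (Fin m) Δ →ₐ[K] Matrix (Fin r) (Fin r) F := f.comp β.symm.toAlgHom
  -- The rank of a primitive idempotent of `A ≅ M_m(Δ)`. It will be the index of `A`: counting ranks
  -- gives `r = m c`, and then dimensions give `dim Δ = c ^ 2`.
  set c := (f' (Matrix.single 0 0 1)).rank with hc
  have hrc : r = m * c := by
    have h1 := rank_map_sum_single f' Finset.univ
    rw [Finset.card_univ, Fintype.card_fin, Matrix.sum_single_one, map_one, Matrix.rank_one,
      Fintype.card_fin] at h1
    exact h1
  have hc0 : 0 < c := Nat.pos_of_ne_zero (by rintro h0; rw [h0] at hrc; omega)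
  have hΔ : Module.finrank K Δ = c ^ 2 := by
    have h1 := β.toLinearEquiv.finrank_eq
    rw [hA, Module.finrank_matrix, Fintype.card_fin, hrc] at h1
    have : (m * m) * c ^ 2 = (m * m) * Module.finrank K Δ := by rw [← h1]; ring
    exact (Nat.eq_of_mul_eq_mul_left (Nat.mul_pos hm hm) this).symm
  have hst : s * r = t * j := by
    have h1 := α.toLinearEquiv.finrank_eq
    rw [Module.finrank_matrix, Module.finrank_matrix, hA, hD, Fintype.card_fin,
      Fintype.card_fin] at h1
    have : (s * r) ^ 2 = (t * j) ^ 2 := by linarith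
    exact Nat.pow_left_injective two_ne_zero this
  -- The column space `D ^ t` is a module over `M_t(D) ≅ M_s(A) ≅ M_sm(Δ)`, which constrains its
  -- dimension `t j ^ 2`.
  have hdvd : s * m * c ^ 2 ∣ t * j ^ 2 := by
    let γ : Matrix (Fin s × Fin m) (Fin s × Fin m) Δ ≃ₐ[K] Matrix (Fin t) (Fin t) D :=
      (Matrix.compAlgEquiv (Fin s) (Fin m) Δ K).symm.trans (β.symm.mapMatrix.trans α)
    let : Module (Matrix (Fin t) (Fin t) D) (Fin t → D) := Matrix.Module.matrixModule
    let : Module (Matrix (Fin s × Fin m) (Fin s × Fin m) Δ) (Fin t → D) :=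
      Module.compHom _ (γ : Matrix (Fin s × Fin m) (Fin s × Fin m) Δ →+* Matrix (Fin t) (Fin t) D)
    have : IsScalarTower K (Matrix (Fin s × Fin m) (Fin s × Fin m) Δ) (Fin t → D) :=
      ⟨fun a M v => by
        change γ (a • M) • v = a • (γ M • v)
        rw [map_smul]
        ext i
        simp [Finset.smul_sum]⟩
    have h1 := finrank_dvd_of_matrix_module (K := K) (ι := Fin s × Fin m) (Δ := Δ) (V := Fin t → D)
    rwa [Fintype.card_prod, Fintype.card_fin, Fintype.card_fin, hΔ, Module.finrank_pi_fintype,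
      Finset.sum_const, Finset.card_univ, Fintype.card_fin, smul_eq_mul, hD] at h1
  obtain ⟨ρ, hρ⟩ := hdvd
  -- Since `t j = s r = s m c`, the divisibility becomes `c ∣ j`: the index divides `j`. The sum of
  -- `ρ` diagonal units then has rank `j`.
  have hj' : j = ρ * c := by
    have h1 : (s * m * c) * j = (s * m * c) * (ρ * c) := by
      calc (s * m * c) * j = (s * r) * j := by rw [hrc]; ring
        _ = t * j ^ 2 := by rw [hst]; ring
        _ = _ := by rw [hρ]; ring
    exact Nat.eq_of_mul_eq_mul_left (by positivity) h1
  have hρm : ρ ≤ m := by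
    rw [hj', hrc] at hjr
    exact Nat.le_of_mul_le_mul_right hjr hc0
  obtain ⟨S, -, hS⟩ := Finset.exists_subset_card_eq (s := (Finset.univ : Finset (Fin m)))
    (n := ρ) (by simpa using hρm)
  refine ⟨β.symm (∑ i ∈ S, Matrix.single i i 1), ?_, ?_⟩
  · rw [← map_mul]
    congr 1
    rw [Finset.sum_mul_sum]
    refine Finset.sum_congr rfl fun l hl => ?_
    rw [Finset.sum_eq_single l, Matrix.single_mul_single_same, mul_one]
    · exact fun b _ hb => Matrix.single_mul_single_of_ne _ _ _ _ hb.symm _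
    · exact fun h => absurd hl h
  · have h1 := rank_map_sum_single f' S
    rw [hS, ← hc, ← hj'] at h1
    exact h1

end Idempotents

end TwistedGrassmannian

namespace TwistedGrassmannian

/-! ### Forms of matrix algebras, and a chart of the Grassmannian -/

section Forms

variable {K F : Type u} [Field K] [Field F] [Algebra K F] {r j : ℕ}

theorem map_sum_smul {ι : Type*} [Fintype ι] {R : Type u} [CommRing R] (φ : F →+* R) (t : ι → K)
    (m : ι → Matrix (Fin r) (Fin r) F) :
    (∑ i, t i • m i).map φ = ∑ i, φ (algebraMap K F (t i)) • (m i).map φ := by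
  ext x y
  simp only [Matrix.map_apply, Matrix.sum_apply, Matrix.smul_apply, map_sum, smul_eq_mul]
  exact Finset.sum_congr rfl fun i _ => by rw [Algebra.smul_def, map_mul]

/-- The subalgebra `A` is a `K`-form of `M_r(F)`. -/
structure IsForm (A : Subalgebra K (Matrix (Fin r) (Fin r) F)) : Prop where
  span_eq_top : Submodule.span F (A : Set (Matrix (Fin r) (Fin r) F)) = ⊤
  linearIndependent {ι : Type u} (m : ι → Matrix (Fin r) (Fin r) F) :
    (∀ i, m i ∈ A) → LinearIndependent K m → LinearIndependent F m

namespace IsForm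

variable {A : Subalgebra K (Matrix (Fin r) (Fin r) F)}

/-- A basis of `A` over `K` stays independent over `F` and spans `M_r(F)`, so it is also a basis of
`M_r(F)` over `F`. -/
theorem finite_and_finrank_eq (hA : IsForm A) :
    Module.Finite K A ∧ Module.finrank K A = r ^ 2 := by
  let b := Module.Basis.ofVectorSpace K A
  let m : Module.Basis.ofVectorSpaceIndex K A → Matrix (Fin r) (Fin r) F := fun i => (b i : _)
  have hm : LinearIndependent K m := b.linearIndependent.map' A.val.toLinearMap (by
    rw [LinearMap.ker_eq_bot]; exact Subtype.val_injective)
  have hsp : (⊤ : Submodule F (Matrix (Fin r) (Fin r) F)) ≤ Submodule.span F (Set.range m) := by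
    rw [← hA.span_eq_top, Submodule.span_le]
    intro a ha
    have h1 : (⟨a, ha⟩ : A) ∈ Submodule.span K (Set.range b) := by rw [b.span_eq]; trivial
    have h2 := Submodule.mem_map_of_mem (f := A.val.toLinearMap) h1
    rw [Submodule.map_span, ← Set.range_comp] at h2
    exact Submodule.span_le_restrictScalars K F _ h2
  let b' := Module.Basis.mk (hA.linearIndependent m (fun i => (b i).2) hm) hsp
  have := Module.Finite.finite_basis b'
  have := Fintype.ofFinite (Module.Basis.ofVectorSpaceIndex K A)
  refine ⟨Module.Finite.of_basis b, ?_⟩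
  rw [Module.finrank_eq_card_basis b, ← Module.finrank_eq_card_basis b', Module.finrank_matrix,
    Fintype.card_fin, Module.finrank_self, mul_one, sq]

theorem span_map_eq_top (hA : IsForm A) {R : Type u} [CommRing R] (φ : F →+* R) :
    Submodule.span R ((fun m : Matrix (Fin r) (Fin r) F => m.map φ) '' A) = ⊤ := by
  have h1 : ∀ m : Matrix (Fin r) (Fin r) F, m.map φ ∈
      Submodule.span R ((fun m : Matrix (Fin r) (Fin r) F => m.map φ) '' A) := by
    intro m
    have hm : m ∈ Submodule.span F (A : Set (Matrix (Fin r) (Fin r) F)) := by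
      rw [hA.span_eq_top]; trivial
    induction hm using Submodule.span_induction with
    | mem x h => exact Submodule.subset_span ⟨x, h, rfl⟩
    | zero => rw [Matrix.map_zero _ (map_zero φ)]; exact zero_mem _
    | add x y _ _ hx hy => rw [Matrix.map_add φ (map_add φ)]; exact add_mem hx hy
    | smul c x _ hx =>
      rw [show (c • x).map φ = φ c • x.map φ by ext; simp]
      exact Submodule.smul_mem _ _ hx
  rw [eq_top_iff]
  rintro M -
  rw [Matrix.matrix_eq_sum_single M]
  refine Submodule.sum_mem _ fun a _ => Submodule.sum_mem _ fun b _ => ?_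
  have : Matrix.single a b (M a b) = M a b • (Matrix.single a b (1 : F)).map φ := by
    rw [← single_one_map]; simp
  rw [this]
  exact Submodule.smul_mem _ _ (h1 _)

/-- Left multiplication by `u` is injective on the finite-dimensional space `A`, hence surjective,
so the inverse of `u` already lies in `A`. -/
theorem exists_mul_eq_one (hA : IsForm A) {u : Matrix (Fin r) (Fin r) F} (hu : u ∈ A)
    (hdet : u.det ≠ 0) : ∃ u' ∈ A, u * u' = 1 ∧ u' * u = 1 := by
  have := hA.finite_and_finrank_eq.1
  have hinj : Function.Injective (LinearMap.mulLeft K (⟨u, hu⟩ : A)) := by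
    rw [← LinearMap.ker_eq_bot, LinearMap.ker_eq_bot']
    intro a ha
    have h1 : u * (a : Matrix (Fin r) (Fin r) F) = 0 := congr_arg Subtype.val ha
    have h2 : u⁻¹ * (u * (a : Matrix (Fin r) (Fin r) F)) = 0 := by rw [h1, mul_zero]
    rw [← mul_assoc, Matrix.nonsing_inv_mul _ (isUnit_iff_ne_zero.2 hdet), one_mul] at h2
    exact Subtype.ext h2
  obtain ⟨u', hu'⟩ := LinearMap.injective_iff_surjective.1 hinj 1
  have h1 : u * (u' : Matrix (Fin r) (Fin r) F) = 1 := congr_arg Subtype.val hu'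
  exact ⟨u', u'.2, h1, mul_eq_one_comm.1 h1⟩

/-- A form of `M_r(F)` over an infinite field contains units in general position. -/
theorem exists_det_ne_zero [Infinite K] (hA : IsForm A) {E : Type u} [Field E] (φ : F →+* E)
    (B : Matrix (Fin j) (Fin r) E) (C : Matrix (Fin r) (Fin j) E) (hBC : B * C = 1)
    (N : Matrix (Fin r) (Fin j) E) (M : Matrix (Fin j) (Fin r) E) (hN : M * N = 1) :
    ∃ u ∈ A, u.det ≠ 0 ∧ (B * u.map φ * N).det ≠ 0 := by
  have := hA.finite_and_finrank_eq.1
  let b := Module.finBasis K A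
  let σ := Fin (Module.finrank K A)
  -- The generic element of `A`, with indeterminate coordinates in a `K`-basis. Both conditions
  -- become the nonvanishing of a polynomial in these coordinates.
  let G : Matrix (Fin r) (Fin r) (MvPolynomial σ E) :=
    ∑ i, (MvPolynomial.X i : MvPolynomial σ E) •
      ((b i : Matrix (Fin r) (Fin r) F).map φ).map MvPolynomial.C
  let p₁ : MvPolynomial σ E := G.det
  let B' : Matrix (Fin j) (Fin r) (MvPolynomial σ E) := B.map MvPolynomial.C
  let N' : Matrix (Fin r) (Fin j) (MvPolynomial σ E) := N.map MvPolynomial.C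
  let p₂ : MvPolynomial σ E := (B' * G * N').det
  have hG : ∀ t : σ → E, G.map (MvPolynomial.eval t) =
      ∑ i, t i • (b i : Matrix (Fin r) (Fin r) F).map φ := by
    intro t
    ext x y
    simp only [G, Matrix.map_apply, Matrix.sum_apply, Matrix.smul_apply, smul_eq_mul, map_sum,
      map_mul, MvPolynomial.eval_X, MvPolynomial.eval_C]
  have hp₁ : ∀ t, MvPolynomial.eval t p₁ = (G.map (MvPolynomial.eval t)).det := fun t =>
    RingHom.map_det _ _
  have hC : ∀ (t : σ → E) {x y : ℕ} (M : Matrix (Fin x) (Fin y) E),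
      (M.map (MvPolynomial.C (σ := σ))).map (MvPolynomial.eval t) = M := by
    intro t x y M; ext; simp
  have hp₂ : ∀ t, MvPolynomial.eval t p₂ = (B * G.map (MvPolynomial.eval t) * N).det := fun t => by
    refine (RingHom.map_det _ _).trans ?_
    rw [RingHom.mapMatrix_apply, Matrix.map_mul, Matrix.map_mul, hC, hC]
  have hex : ∀ M : Matrix (Fin r) (Fin r) E, ∃ t : σ → E, G.map (MvPolynomial.eval t) = M := by
    intro M
    have hM : M ∈ Submodule.span E (Set.range fun i => (b i : Matrix (Fin r) (Fin r) F).map φ) := by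
      have h1 : M ∈ Submodule.span E ((fun m : Matrix (Fin r) (Fin r) F => m.map φ) '' A) := by
        rw [hA.span_map_eq_top φ]; trivial
      refine Submodule.span_le.2 ?_ h1
      rintro _ ⟨m, hm, rfl⟩
      have h2 : m = ∑ i, b.repr ⟨m, hm⟩ i • (b i : Matrix (Fin r) (Fin r) F) := by
        have := congr_arg Subtype.val (b.sum_repr ⟨m, hm⟩)
        refine this.symm.trans ?_
        rw [AddSubmonoidClass.coe_finsetSum]
        rfl
      rw [SetLike.mem_coe]
      simp only
      rw [h2, map_sum_smul]
      exact Submodule.sum_mem _ fun i _ => Submodule.smul_mem _ _ (Submodule.subset_span ⟨i, rfl⟩)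
    obtain ⟨t, ht⟩ := (Submodule.mem_span_range_iff_exists_fun E).1 hM
    exact ⟨t, (hG t).trans ht⟩
  have h₁ : p₁ ≠ 0 := by
    obtain ⟨t, ht⟩ := hex 1
    intro h
    have := hp₁ t
    rw [h, ht] at this
    simp at this
  have h₂ : p₂ ≠ 0 := by
    -- At the matrix `C M` the second determinant is that of `B C M N = 1`.
    obtain ⟨t, ht⟩ := hex (C * M)
    intro h
    have := hp₂ t
    rw [h, ht, ← Matrix.mul_assoc, hBC, Matrix.one_mul, hN] at this
    simp at this
  -- The coordinates must lie in `K` and not just in `E`, for `u` to be in `A`. A nonzero polynomial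
  -- over `E` cannot vanish on all tuples from the infinite subset `K`.
  have hinf : (Set.range fun c : K => φ (algebraMap K F c)).Infinite :=
    Set.infinite_range_of_injective (φ.comp (algebraMap K F)).injective
  obtain ⟨t, ht, ht'⟩ : ∃ t : σ → K,
      MvPolynomial.eval (fun i => φ (algebraMap K F (t i))) p₁ ≠ 0 ∧
      MvPolynomial.eval (fun i => φ (algebraMap K F (t i))) p₂ ≠ 0 := by
    by_contra! hcon
    refine mul_ne_zero h₁ h₂ (MvPolynomial.funext_set _ (fun _ => hinf) fun x hx => ?_)
    choose t ht using fun i => hx i trivial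
    obtain rfl : (fun i => φ (algebraMap K F (t i))) = x := funext ht
    rw [map_mul, map_zero, mul_eq_zero, or_iff_not_imp_left]
    exact hcon t
  have hu : (∑ i, t i • (b i : Matrix (Fin r) (Fin r) F)).map φ =
      G.map (MvPolynomial.eval (fun i => φ (algebraMap K F (t i)))) := by
    rw [hG, map_sum_smul]
  refine ⟨∑ i, t i • (b i : Matrix (Fin r) (Fin r) F),
    A.sum_mem fun i _ => A.smul_mem (b i).2 _, ?_, ?_⟩
  · rw [hp₁, ← hu] at ht
    intro h
    refine ht ((RingHom.map_det φ _).symm.trans ?_)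
    rw [h, map_zero]
  · rwa [hp₂, ← hu] at ht'

end IsForm

theorem exists_rank_factorization {e : Matrix (Fin r) (Fin r) F} (he : e * e = e)
    (hj : e.rank = j) : ∃ (C : Matrix (Fin r) (Fin j) F) (B : Matrix (Fin j) (Fin r) F),
      C * B = e ∧ B * C = 1 := by
  let f := (Module.finBasisOfFinrankEq F (LinearMap.range e.mulVecLin) hj).equivFun
  refine ⟨LinearMap.toMatrix' ((LinearMap.range e.mulVecLin).subtype ∘ₗ f.symm.toLinearMap),
    LinearMap.toMatrix' (f.toLinearMap ∘ₗ e.mulVecLin.rangeRestrict), ?_, ?_⟩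
  · rw [← LinearMap.toMatrix'_comp]
    refine Eq.trans (congr_arg _ ?_) (LinearMap.toMatrix'_toLin' e)
    apply LinearMap.ext
    intro v
    change ((f.symm (f (e.mulVecLin.rangeRestrict v)) : LinearMap.range e.mulVecLin) :
      Fin r → F) = _
    rw [LinearEquiv.symm_apply_apply]
    rfl
  · rw [← LinearMap.toMatrix'_comp, ← LinearMap.toMatrix'_id]
    congr 1
    apply LinearMap.ext
    intro v
    have : e.mulVecLin.rangeRestrict (f.symm v : Fin r → F) = f.symm v := by
      obtain ⟨w, hw⟩ := (f.symm v).2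
      apply Subtype.ext
      rw [← hw]
      change e.mulVec (e.mulVec w) = e.mulVec w
      rw [Matrix.mulVec_mulVec, he]
    change f (e.mulVecLin.rangeRestrict (f.symm v : Fin r → F)) = v
    rw [this, LinearEquiv.apply_symm_apply]

theorem exists_range_mulVecLin_eq {N : Submodule F (Fin r → F)} (hN : Module.finrank F N = j) :
    ∃ (C : Matrix (Fin r) (Fin j) F) (B : Matrix (Fin j) (Fin r) F),
      LinearMap.range C.mulVecLin = N ∧ B * C = 1 := by
  let f := (Module.finBasisOfFinrankEq F N hN).equivFun
  let g := N.subtype ∘ₗ f.symm.toLinearMap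
  have hg : LinearMap.ker g = ⊥ := by
    rw [LinearMap.ker_eq_bot]
    exact Subtype.val_injective.comp f.symm.injective
  obtain ⟨h, hh⟩ := LinearMap.exists_leftInverse_of_injective g hg
  refine ⟨LinearMap.toMatrix' g, LinearMap.toMatrix' h, ?_, ?_⟩
  · rw [← Matrix.toLin'_apply', Matrix.toLin'_toMatrix', LinearMap.range_comp,
      LinearMap.range_eq_top.2 f.symm.surjective, Submodule.map_top, Submodule.range_subtype]
  · rw [← LinearMap.toMatrix'_comp, hh, LinearMap.toMatrix'_id]

/-- An idempotent `e` of rank `j` in `A` and a basis of `(1 - e) A e`; they define a chart of the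
Grassmannian of `j`-dimensional subspaces. -/
structure Chart (A : Subalgebra K (Matrix (Fin r) (Fin r) F)) (j : ℕ) where
  e : Matrix (Fin r) (Fin r) F
  e_mem : e ∈ A
  C : Matrix (Fin r) (Fin j) F
  B : Matrix (Fin j) (Fin r) F
  C_mul_B : C * B = e
  B_mul_C : B * C = 1
  d : ℕ
  v : Fin d → Matrix (Fin r) (Fin r) F
  v_mem i : v i ∈ A
  e_mul_v i : e * v i = 0
  v_mul_e i : v i * e = v i
  linearIndependent : LinearIndependent F v

namespace Chart

variable {A : Subalgebra K (Matrix (Fin r) (Fin r) F)} (c : Chart A j)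

/-- The idempotent with parameters `s`. -/
def point {R : Type u} [CommRing R] (φ : F →+* R) (s : Fin c.d → R) : Matrix (Fin r) (Fin r) R :=
  c.e.map φ + ∑ i, s i • (c.v i).map φ

end Chart

theorem IsForm.exists_corner_basis {A : Subalgebra K (Matrix (Fin r) (Fin r) F)} (hA : IsForm A)
    {e : Matrix (Fin r) (Fin r) F} (heA : e ∈ A) (he : e * e = e) :
    ∃ (d : ℕ) (v : Fin d → Matrix (Fin r) (Fin r) F), (∀ i, v i ∈ A) ∧ (∀ i, e * v i = 0) ∧
      (∀ i, v i * e = v i) ∧ LinearIndependent K v ∧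
      ∀ a ∈ A, (1 - e) * a * e ∈ Submodule.span K (Set.range v) := by
  have := hA.finite_and_finrank_eq.1
  let V : Submodule K (Matrix (Fin r) (Fin r) F) := Subalgebra.toSubmodule A ⊓
    (LinearMap.ker (LinearMap.mulLeft K e) ⊓
      LinearMap.ker (LinearMap.mulRight K e - LinearMap.id))
  have hV : ∀ {m}, m ∈ V ↔ m ∈ A ∧ e * m = 0 ∧ m * e = m := by
    intro m
    simp only [V, Submodule.mem_inf, LinearMap.mem_ker, LinearMap.sub_apply, sub_eq_zero]
    rfl
  have : FiniteDimensional K (Subalgebra.toSubmodule A) := this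
  have : FiniteDimensional K V := Submodule.finiteDimensional_of_le inf_le_left
  let b := Module.finBasis K V
  refine ⟨_, fun i => b i, fun i => (hV.1 (b i).2).1, fun i => (hV.1 (b i).2).2.1,
    fun i => (hV.1 (b i).2).2.2, b.linearIndependent.map' V.subtype V.ker_subtype, fun a ha => ?_⟩
  have hw : (1 - e) * a * e ∈ V := hV.2 ⟨A.mul_mem (A.mul_mem (A.sub_mem A.one_mem heA) ha) heA,
    by rw [← mul_assoc, ← mul_assoc, mul_sub, he, mul_one, sub_self, zero_mul, zero_mul],
    by rw [mul_assoc, he]⟩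
  have h1 : (⟨_, hw⟩ : V) ∈ Submodule.span K (Set.range b) := by rw [b.span_eq]; trivial
  have h2 := Submodule.mem_map_of_mem (f := V.subtype) h1
  rw [Submodule.map_span, ← Set.range_comp] at h2
  exact h2

/-- Replace `e` by a conjugate `e'` under a unit `u` of `A`, chosen so that `N` is a complement of
the kernel of `e'`. Then `N` is the graph of a map from the image of `e'` to its kernel, and such
maps are the combinations of a basis of `(1 - e') A e'`. -/
theorem IsForm.exists_chart [Infinite K] {A : Subalgebra K (Matrix (Fin r) (Fin r) F)}
    (hA : IsForm A) {e : Matrix (Fin r) (Fin r) F} (heA : e ∈ A) (he : e * e = e) (hj : e.rank = j)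
    {E : Type u} [Field E] (φ : F →+* E) {N : Submodule E (Fin r → E)}
    (hN : Module.finrank E N = j) : ∃ (c : Chart A j) (x : Fin c.d → E),
      N = LinearMap.range (c.point φ x).mulVecLin := by
  have := hA.finite_and_finrank_eq.1
  obtain ⟨C, B, hCB, hBC⟩ := exists_rank_factorization he hj
  obtain ⟨M, M', hM, hMM⟩ := exists_range_mulVecLin_eq hN
  obtain ⟨u, hu, hdet, hdet'⟩ := hA.exists_det_ne_zero φ (B.map φ) (C.map φ) (by
    rw [← Matrix.map_mul, hBC]; simp) M M' hMM
  obtain ⟨u', hu', huu', hu'u⟩ := hA.exists_mul_eq_one hu hdet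
  set e' := u' * e * u with he'
  have hee : e' * e' = e' := by
    calc e' * e' = u' * e * (u * u') * e * u := by simp only [he', mul_assoc]
      _ = u' * (e * e) * u := by rw [huu', mul_one]; simp only [mul_assoc]
      _ = e' := by rw [he]
  have heA' : e' ∈ A := A.mul_mem (A.mul_mem hu' heA) hu
  obtain ⟨d, v, hvA, hev, hve, hli, hv⟩ := hA.exists_corner_basis heA' hee
  let c : Chart A j :=
    { e := e'
      e_mem := heA'
      C := u' * C
      B := B * u
      C_mul_B := by rw [he', ← hCB]; simp only [Matrix.mul_assoc]
      B_mul_C := by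
        rw [Matrix.mul_assoc, ← Matrix.mul_assoc u, huu', Matrix.one_mul, hBC]
      d := d
      v := v
      v_mem := hvA
      e_mul_v := hev
      v_mul_e := hve
      linearIndependent :=
        -- The definition of a form quantifies over index types in universe `u`, hence the lift of
        -- `Fin d`.
        (hA.linearIndependent (fun i : ULift.{u} (Fin d) => v i.down) (fun i => hvA _)
          (hli.comp _ ULift.down_injective)).comp ULift.up ULift.up_injective }
  let D := (B * u).map φ * M
  have hD : IsUnit D.det := by
    rw [isUnit_iff_ne_zero]
    simpa only [D, Matrix.map_mul] using hdet'
  -- The projection onto `N` along the kernel of `e'`. It satisfies `p e' = p` and `e' p = e'`, so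
  -- `p = e' + (1 - e') p e'`.
  let p := M * D⁻¹ * (B * u).map φ
  have hpM : p * M = M := by
    simp only [p]
    rw [Matrix.mul_assoc, Matrix.mul_assoc, Matrix.nonsing_inv_mul _ hD, Matrix.mul_one]
  have hrp : LinearMap.range p.mulVecLin = N := by
    rw [← hM]
    apply le_antisymm
    · rintro _ ⟨v, rfl⟩
      exact ⟨(D⁻¹ * (B * u).map φ).mulVec v, by simp [p, Matrix.mul_assoc]⟩
    · rintro _ ⟨v, rfl⟩
      exact ⟨M.mulVec v, by simp [hpM]⟩
  have hCe : c.C.map φ * c.B.map φ = e'.map φ := by rw [← Matrix.map_mul, c.C_mul_B]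
  have hBe : (B * u).map φ * e'.map φ = (B * u).map φ := by
    rw [← Matrix.map_mul]
    change (c.B * c.e).map φ = c.B.map φ
    rw [← c.C_mul_B, ← Matrix.mul_assoc]
    rw [c.B_mul_C, Matrix.one_mul]
  have hpe : p * e'.map φ = p := by
    simp only [p]
    rw [Matrix.mul_assoc, hBe]
  have hep : e'.map φ * p = e'.map φ := by
    rw [← hCe]
    change c.C.map φ * (B * u).map φ * (M * D⁻¹ * (B * u).map φ) = c.C.map φ * (B * u).map φ
    calc _ = c.C.map φ * (D * D⁻¹) * (B * u).map φ := by simp only [D, Matrix.mul_assoc]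
      _ = _ := by rw [Matrix.mul_nonsing_inv _ hD, Matrix.mul_one]
  -- The `v i` span the corner over `E` as well, because `A` spans all matrices over `E`.
  have hspan : ∀ Q : Matrix (Fin r) (Fin r) E, (1 - e'.map φ) * Q * e'.map φ ∈
      Submodule.span E (Set.range fun i => (c.v i).map φ) := by
    intro Q
    have hQ : Q ∈ Submodule.span E ((fun m : Matrix (Fin r) (Fin r) F => m.map φ) '' A) := by
      rw [hA.span_map_eq_top φ]; trivial
    induction hQ using Submodule.span_induction with
    | mem x h =>
      obtain ⟨a, ha, rfl⟩ := h
      obtain ⟨t, ht⟩ := (Submodule.mem_span_range_iff_exists_fun K).1 (hv a ha)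
      have h3 := congr_arg (fun m : Matrix (Fin r) (Fin r) F => m.map φ) ht
      rw [Matrix.map_mul, Matrix.map_mul, Matrix.map_sub φ (map_sub φ),
        Matrix.map_one _ (map_zero φ) (map_one φ), map_sum_smul] at h3
      rw [← h3]
      exact Submodule.sum_mem _ fun i _ => Submodule.smul_mem _ _ (Submodule.subset_span ⟨i, rfl⟩)
    | zero => simp
    | add x y _ _ hx hy => rw [mul_add, add_mul]; exact add_mem hx hy
    | smul a x _ hx => rw [mul_smul_comm, smul_mul_assoc]; exact Submodule.smul_mem _ _ hx
  obtain ⟨x, hx⟩ := (Submodule.mem_span_range_iff_exists_fun E).1 (hspan p)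
  refine ⟨c, x, ?_⟩
  rw [← hrp, Chart.point, hx, sub_mul, one_mul, hep, sub_mul, hpe, ← Matrix.map_mul, hee]
  congr 2
  change p = e'.map φ + _
  abel

/-- Needed for rings of global functions, which are fields only as a property; the given ring
structure is kept. -/
theorem IsForm.exists_chart_of_isField [Infinite K]
    {A : Subalgebra K (Matrix (Fin r) (Fin r) F)}
    (hA : IsForm A) {e : Matrix (Fin r) (Fin r) F} (heA : e ∈ A) (he : e * e = e) (hj : e.rank = j)
    {R : Type u} [CommRing R] (hR : IsField R) (φ : F →+* R) {N : Submodule R (Fin r → R)}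
    (hN : Module.finrank R N = j) : ∃ (c : Chart A j) (x : Fin c.d → R),
      N = LinearMap.range (c.point φ x).mulVecLin := by
  let _ := hR.toField
  exact hA.exists_chart heA he hj φ hN

/-! ### Identities between the idempotents of a chart -/

namespace Chart

variable {A : Subalgebra K (Matrix (Fin r) (Fin r) F)} (c : Chart A j) {R : Type u} [CommRing R]
  (φ : F →+* R) (s s' : Fin c.d → R)

theorem e_mul_e : c.e * c.e = c.e := by
  rw [← c.C_mul_B, Matrix.mul_assoc, ← Matrix.mul_assoc c.B, c.B_mul_C, Matrix.one_mul]

theorem point_mul_e : c.point φ s * c.e.map φ = c.point φ s := by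
  rw [point, add_mul, ← Matrix.map_mul, e_mul_e, Finset.sum_mul]
  congr 1
  exact Finset.sum_congr rfl fun i _ => by rw [smul_mul_assoc, ← Matrix.map_mul, v_mul_e]

theorem e_mul_point : c.e.map φ * c.point φ s = c.e.map φ := by
  rw [point, mul_add, ← Matrix.map_mul, e_mul_e, Finset.mul_sum, Finset.sum_eq_zero, add_zero]
  intro i _
  rw [mul_smul_comm, ← Matrix.map_mul, e_mul_v, Matrix.map_zero _ (map_zero φ), smul_zero]

/-- All these idempotents have the kernel of `e`, and a product of two projections along the same
kernel is the first factor. The parameters describe the image as a graph over the image of `e`. -/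
theorem point_mul_point : c.point φ s * c.point φ s' = c.point φ s := by
  conv_lhs => rw [← point_mul_e, mul_assoc, e_mul_point, point_mul_e]

theorem point_mul_C_mul_B : c.point φ s * c.C.map φ * c.B.map φ = c.point φ s := by
  rw [Matrix.mul_assoc, ← Matrix.map_mul, c.C_mul_B, point_mul_e]

theorem B_mul_e : c.B * c.e = c.B := by
  rw [← c.C_mul_B, ← Matrix.mul_assoc, c.B_mul_C, Matrix.one_mul]

/-- Shows that `point * C` is a split injection from a free module of rank `j`, over every ring;
this makes the image a subbundle. -/
theorem B_mul_point_mul_C : c.B.map φ * (c.point φ s * c.C.map φ) = 1 := by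
  rw [← c.B_mul_e, Matrix.map_mul, ← Matrix.mul_assoc, Matrix.mul_assoc _ _ (c.point φ s),
    e_mul_point, ← Matrix.map_mul, ← Matrix.map_mul, B_mul_e, B_mul_C,
    Matrix.map_one _ (map_zero φ) (map_one φ)]

/-- Independence of the `v i` over the field `F` is witnessed by a linear left inverse `g`; its base
change `G` to `R` recovers the parameters. -/
theorem point_injective : Function.Injective (c.point φ) := by
  intro s s' h
  have h1 : ∑ i, s i • (c.v i).map φ = ∑ i, s' i • (c.v i).map φ := by
    simpa only [point, add_right_inj] using h
  obtain ⟨g, hg⟩ := LinearMap.exists_leftInverse_of_injective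
    (Fintype.linearCombination F c.v)
    (LinearMap.ker_eq_bot.2 c.linearIndependent.fintypeLinearCombination_injective)
  let G : Matrix (Fin r) (Fin r) R →ₗ[R] (Fin c.d → R) :=
    { toFun := fun M => ∑ a, ∑ b, M a b • fun l => φ (g (Matrix.single a b 1) l)
      map_add' := fun M M' => by simp [add_smul, Finset.sum_add_distrib]
      map_smul' := fun a M => by simp [mul_smul, Finset.smul_sum] }
  have hG : ∀ m : Matrix (Fin r) (Fin r) F, G (m.map φ) = fun l => φ (g m l) := by
    intro m
    ext l
    conv_rhs => rw [Matrix.matrix_eq_sum_single m]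
    simp only [G, LinearMap.coe_mk, AddHom.coe_mk, Finset.sum_apply, map_sum, Pi.smul_apply,
      Matrix.map_apply, smul_eq_mul]
    refine Finset.sum_congr rfl fun a _ => Finset.sum_congr rfl fun b _ => ?_
    rw [show Matrix.single a b (m a b) = m a b • Matrix.single a b (1 : F) by simp, map_smul,
      Pi.smul_apply, smul_eq_mul, map_mul]
  have hv : ∀ i, g (c.v i) = Pi.single i 1 := fun i => by
    have := LinearMap.congr_fun hg (Pi.single i 1)
    rwa [LinearMap.comp_apply, Fintype.linearCombination_apply_single, one_smul] at this
  have h2 := congr_arg G h1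
  simp only [map_sum, map_smul, hG, hv] at h2
  ext l
  have h3 := congr_fun h2 l
  simpa [Finset.sum_apply, Pi.single_apply, apply_ite φ] using h3

end Chart

end Forms

end TwistedGrassmannian

namespace TwistedGrassmannian

variable {k : Type u} [Field k]

/-! ### The chart of the Grassmannian bundle -/

/-- The map `f` is a split injection, so its image is free of rank `j`, and `1 - f h` realizes the
quotient as a direct summand of the projective module `M`. -/
theorem isSubbundle_range {R M : Type u} [CommRing R] [AddCommGroup M] [Module R M]
    [Module.Projective R M] {j : ℕ} (f : (Fin j → R) →ₗ[R] M) (h : M →ₗ[R] (Fin j → R))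
    (hf : h ∘ₗ f = LinearMap.id) : IsSubbundle j (LinearMap.range (f ∘ₗ h)) := by
  have hf' : ∀ v, h (f v) = v := fun v => LinearMap.congr_fun hf v
  have hs : Function.Surjective h := fun v => ⟨f v, hf' v⟩
  have hr : LinearMap.range (f ∘ₗ h) = LinearMap.range f := by
    rw [LinearMap.range_comp, LinearMap.range_eq_top.2 hs, Submodule.map_top]
  rw [hr]
  refine ⟨?_, fun p => ?_⟩
  · refine Module.Projective.of_split
      ((LinearMap.range f).liftQ (LinearMap.id - f ∘ₗ h) ?_) (LinearMap.range f).mkQ ?_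
    · rintro _ ⟨v, rfl⟩
      simp [hf']
    · apply Submodule.linearMap_qext
      ext v
      simp
  · have hnt : Nontrivial R := ⟨0, 1, fun h => p.2.ne_top ((Ideal.eq_top_iff_one _).2 (h ▸ zero_mem _))⟩
    rw [← Module.rankAtStalk_eq_of_equiv (LinearEquiv.ofInjective f
      (Function.LeftInverse.injective hf')), Module.rankAtStalk_eq_finrank_of_free]
    simp

/-- The idempotent `φ` is the identity on its range, which contains that of `ψ`; so `φ ψ = ψ`, while
also `φ ψ = φ`. -/
theorem eq_of_range_eq {R M : Type*} [CommRing R] [AddCommGroup M] [Module R M]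
    {φ ψ : Module.End R M} (h1 : φ * ψ = φ) (h2 : φ * φ = φ)
    (h : LinearMap.range φ = LinearMap.range ψ) : φ = ψ := by
  ext v
  obtain ⟨u, hu⟩ : ψ v ∈ LinearMap.range φ := h ▸ ⟨v, rfl⟩
  have h3 : φ (ψ v) = φ v := LinearMap.congr_fun h1 v
  have h4 : φ (φ u) = φ u := LinearMap.congr_fun h2 u
  rw [← h3, ← hu, h4]

namespace EndCompat

variable {X : Sch k} {r : ℕ} {P : VectorBundle X r} {T T' : Sch k} {x : T ⟶ X} {x' : T' ⟶ X}
  {f : T' ⟶ T} {h : f ≫ x = x'} {φ ψ : Module.End Γ(T.left, ⊤) (Fiber P.proj x)}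
  {φ' ψ' : Module.End Γ(T'.left, ⊤) (Fiber P.proj x')}

theorem add (hφ : EndCompat P f h φ φ') (hψ : EndCompat P f h ψ ψ') :
    EndCompat P f h (φ + ψ) (φ' + ψ') := fun v => by
  rw [LinearMap.add_apply, LinearMap.add_apply, P.pullback_add, hφ, hψ]

/-- The pulled back sections of a frame generate, so forming the image of an endomorphism commutes
with base change. -/
theorem range_eq (ε : Frame P x) (hφ : EndCompat P f h φ φ') :
    LinearMap.range φ' = Submodule.span Γ(T'.left, ⊤)
      ((fun v : Fiber P.proj x => v.pullback f h) '' (LinearMap.range φ : Set (Fiber P.proj x))) := by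
  apply le_antisymm
  · rw [LinearMap.range_eq_map, ← (ε.pullback f h).basis.span_eq, Submodule.map_span,
      Submodule.span_le]
    rintro _ ⟨_, ⟨i, rfl⟩, rfl⟩
    rw [Frame.basis_apply]
    exact Submodule.subset_span ⟨φ (ε.e i), ⟨_, rfl⟩, (hφ (ε.e i)).symm⟩
  · rw [Submodule.span_le]
    rintro _ ⟨_, ⟨v, rfl⟩, rfl⟩
    exact ⟨_, hφ v⟩

end EndCompat

/-! ### Points of the Grassmannian bundle in a chart, and their images in the quotient -/

section ChartPoint

variable {n : ℕ} {X Y : Sch k} [IsIntegral Y.left] {a : GroupAction (PGLn k n) X} {q : X ⟶ Y}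
variable {F : Type u} [Field F] [Algebra (FunField Y) F] {x₀ : specOver Y F ⟶ X}
variable {r : ℕ} {w : ℤ} {P : WeightBundle a r w} {j : ℕ}
variable {ε : Frame P.toVectorBundle x₀} (c : Chart (descended ε) j)

/-- The idempotent endomorphism of the fibre of `P` with parameters `s`. -/
noncomputable def chartEnd {T : Sch k} (y : T ⟶ specOver Y F) {x : T ⟶ X} (h : y ≫ x₀ = x)
    (s : Fin c.d → Γ(T.left, ⊤)) : Module.End Γ(T.left, ⊤) (Fiber P.proj x) :=
  (ε.pullback y h).op (c.point (fn y) s)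

theorem chartEnd_eq {T : Sch k} (y : T ⟶ specOver Y F) {x : T ⟶ X} (h : y ≫ x₀ = x)
    (s : Fin c.d → Γ(T.left, ⊤)) :
    chartEnd c y h s = ε.opOf y h c.e + ∑ i, s i • ε.opOf y h (c.v i) := by
  rw [chartEnd, Chart.point, map_add, map_sum]
  simp only [map_smul]
  rfl

theorem chartEnd_compat {T T' : Sch k} {y : T ⟶ specOver Y F} {x : T ⟶ X} (h : y ≫ x₀ = x)
    (s : Fin c.d → Γ(T.left, ⊤)) (f : T' ⟶ T) {x' : T' ⟶ X} (h' : f ≫ x = x')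
    {y' : T' ⟶ specOver Y F} (hy' : f ≫ y = y') (h'' : y' ≫ x₀ = x') :
    EndCompat P.toVectorBundle f h' (chartEnd c y h s)
      (chartEnd c y' h'' (fun i => f.left.appTop (s i))) := by
  rw [chartEnd_eq, chartEnd_eq]
  exact (EndCompat.of_opOf ε y h f h' y' hy' h'' _).add
    (EndCompat.sum _ fun i => (EndCompat.of_opOf ε y h f h' y' hy' h'' _).smul (s i))

/-- Both `e` and the `v i` are invariant matrices, so transport along `g` keeps the parameters `s`.
This is what makes the coordinates of the chart functions over `k(Y)`. -/
theorem conj_chartEnd {T : Sch k} {y y' : T ⟶ specOver Y F}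
    (hy : y ≫ specOver.str Y F = y' ≫ specOver.str Y F) {x x' : T ⟶ X} (h : y ≫ x₀ = x)
    (h' : y' ≫ x₀ = x') (g : (GLn k n).obj (op T)) (hg : a.smul (toPGL g) x = x')
    (s : Fin c.d → Γ(T.left, ⊤)) :
    (P.tr g hg).conj (chartEnd c y h s) = chartEnd c y' h' s := by
  rw [chartEnd_eq, chartEnd_eq, map_add, map_sum,
    conj_opOf_of_mem_descended c.e_mem hy h h' g hg]
  simp only [map_smul, conj_opOf_of_mem_descended (c.v_mem _) hy h h' g hg]

/-- Idempotents with a common kernel are determined by their ranges, and the parameters are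
determined by the idempotent. -/
theorem chartEnd_range_injective {T : Sch k} (y : T ⟶ specOver Y F) {x : T ⟶ X} (h : y ≫ x₀ = x)
    {s s' : Fin c.d → Γ(T.left, ⊤)}
    (hs : LinearMap.range (chartEnd c y h s) = LinearMap.range (chartEnd c y h s')) : s = s' := by
  apply c.point_injective (fn y)
  apply (ε.pullback y h).op.injective
  refine eq_of_range_eq ?_ ?_ hs
  · rw [← map_mul, Chart.point_mul_point]
  · rw [← map_mul, Chart.point_mul_point]

theorem isSubbundle_chartEnd {T : Sch k} (y : T ⟶ specOver Y F) {x : T ⟶ X} (h : y ≫ x₀ = x)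
    (s : Fin c.d → Γ(T.left, ⊤)) : IsSubbundle j (LinearMap.range (chartEnd c y h s)) := by
  let b := (ε.pullback y h).basis
  have : Module.Projective Γ(T.left, ⊤) (Fiber P.proj x) := Module.Projective.of_basis b
  have h1 : chartEnd c y h s =
      (Matrix.toLin (Pi.basisFun _ _) b (c.point (fn y) s * c.C.map (fn y))) ∘ₗ
        (Matrix.toLin b (Pi.basisFun _ _) (c.B.map (fn y))) := by
    rw [← Matrix.toLin_mul, Chart.point_mul_C_mul_B]
    rfl
  rw [h1]
  apply isSubbundle_range
  rw [← Matrix.toLin_mul, Chart.B_mul_point_mul_C, Matrix.toLin_one]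

variable {Gr : GrassmannianBundle P.toVectorBundle j}

/-- The point of the Grassmannian bundle over `y ≫ x₀` with parameters `s`. -/
noncomputable def chartFiber (Gr : GrassmannianBundle P.toVectorBundle j) {T : Sch k}
    [IsAffine T.left] (y : T ⟶ specOver Y F) {x : T ⟶ X} (h : y ≫ x₀ = x)
    (s : Fin c.d → Γ(T.left, ⊤)) : Fiber Gr.proj x :=
  ((Gr.bijOn_subspace x).surjOn (isSubbundle_chartEnd c y h s)).choose

theorem subspace_chartFiber {T : Sch k} [IsAffine T.left] (y : T ⟶ specOver Y F) {x : T ⟶ X}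
    (h : y ≫ x₀ = x) (s : Fin c.d → Γ(T.left, ⊤)) :
    Gr.subspace (chartFiber c Gr y h s) = LinearMap.range (chartEnd c y h s) :=
  ((Gr.bijOn_subspace x).surjOn (isSubbundle_chartEnd c y h s)).choose_spec.2

theorem GrassmannianBundle.subspace_injective {X : Sch k} {r j : ℕ} {P : VectorBundle X r}
    (Gr : GrassmannianBundle P j) {T : Sch k} [IsAffine T.left] {x : T ⟶ X} {z z' : Fiber Gr.proj x}
    (h : Gr.subspace z = Gr.subspace z') : z = z' :=
  (Gr.bijOn_subspace x).injOn trivial trivial h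

/-- The point of the Grassmannian bundle over `y ≫ x₀` with parameters `s`. -/
noncomputable def chartPoint (Gr : GrassmannianBundle P.toVectorBundle j) {T : Sch k}
    [IsAffine T.left] (y : T ⟶ specOver Y F) (s : Fin c.d → Γ(T.left, ⊤)) : T ⟶ Gr.total :=
  (chartFiber c Gr y rfl s).1

theorem chartPoint_proj {T : Sch k} [IsAffine T.left] (y : T ⟶ specOver Y F)
    (s : Fin c.d → Γ(T.left, ⊤)) : chartPoint c Gr y s ≫ Gr.proj = y ≫ x₀ :=
  (chartFiber c Gr y rfl s).2

theorem comp_chartPoint {T T' : Sch k} [IsAffine T.left] [IsAffine T'.left] (f : T' ⟶ T)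
    (y : T ⟶ specOver Y F) (s : Fin c.d → Γ(T.left, ⊤)) :
    f ≫ chartPoint c Gr y s = chartPoint c Gr (f ≫ y) (fun i => f.left.appTop (s i)) := by
  have h : (chartFiber c Gr y rfl s).pullback f (Category.assoc _ _ _).symm =
      chartFiber c Gr (f ≫ y) rfl (fun i => f.left.appTop (s i)) := by
    apply Gr.subspace_injective
    rw [Gr.subspace_pullback, subspace_chartFiber, subspace_chartFiber]
    exact ((chartEnd_compat c rfl s f _ rfl rfl).range_eq (ε.pullback y rfl)).symm
  exact congr_arg Subtype.val h

theorem IsInducedAction.subspace_eq_map_tr {b : GroupAction (PGLn k n) Gr.total}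
    (hb : IsInducedAction P Gr b) {T : Sch k} [IsAffine T.left] {g : (GLn k n).obj (op T)}
    {x x' : T ⟶ X} (hg : a.smul (toPGL g) x = x') {z : Fiber Gr.proj x} {z' : Fiber Gr.proj x'}
    (h : b.smul (toPGL g) z.1 = z'.1) :
    Gr.subspace z' = (Gr.subspace z).map (P.tr g hg).toLinearMap := by
  subst hg
  obtain rfl : (⟨b.smul (toPGL g) z.1, by rw [hb.smul_proj, z.2]⟩ :
    Fiber Gr.proj (a.smul (toPGL g) x)) = z' := Fiber.ext h
  exact hb.subspace_smul g z

theorem range_conj {R M M' : Type*} [CommRing R] [AddCommGroup M] [Module R M] [AddCommGroup M']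
    [Module R M'] (e : M ≃ₗ[R] M') (φ : Module.End R M) :
    LinearMap.range (e.conj φ) = (LinearMap.range φ).map e.toLinearMap := by
  rw [LinearEquiv.conj_apply, LinearMap.range_comp_of_range_eq_top _ (LinearEquiv.range _),
    LinearMap.range_comp]

/-- Two points of the chart have the same image in the quotient if and only if they have the same
parameters. -/
theorem chartPoint_comp_eq_iff [FiniteDimensional (FunField Y) F] (hq : IsFreeQuotient a q)
    (hx₀ : x₀ ≫ q = specOver.str Y F) {b : GroupAction (PGLn k n) Gr.total}
    (hb : IsInducedAction P Gr b) {Z : Sch k} {q' : Gr.total ⟶ Z} (hq' : IsFreeQuotient b q')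
    {T : Sch k} [IsAffine T.left] {y y' : T ⟶ specOver Y F}
    (hy : y ≫ specOver.str Y F = y' ≫ specOver.str Y F) {s s' : Fin c.d → Γ(T.left, ⊤)} :
    chartPoint c Gr y s ≫ q' = chartPoint c Gr y' s' ≫ q' ↔ s = s' := by
  obtain ⟨g, hg⟩ := exists_smul_comp_eq hq hx₀ y y' hy
  constructor
  · intro h
    obtain ⟨γ, hγ, -⟩ := hq'.existsUnique_smul_eq _ _ h
    have h1 : a.smul γ (y ≫ x₀) = y' ≫ x₀ := by
      rw [← chartPoint_proj c (Gr := Gr) y s, ← hb.smul_proj, hγ, chartPoint_proj]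
    -- Seen in `X`, the element `γ` relates the same two points as `g`, so freeness of the action on
    -- `X` identifies them. This lifts `γ` to `GL_n`, where its effect on subspaces is known.
    obtain rfl : γ = toPGL g :=
      (hq.existsUnique_smul_eq _ _ (comp_eq_of_comp_str_eq hx₀ hy)).unique h1 hg
    have h2 := hb.subspace_eq_map_tr hg hγ
    rw [subspace_chartFiber, subspace_chartFiber, ← range_conj,
      conj_chartEnd c hy rfl rfl g hg] at h2
    exact (chartEnd_range_injective c y' rfl h2).symm
  · rintro rfl
    have h1 : b.smul (toPGL g) (chartPoint c Gr y s) ≫ Gr.proj = y' ≫ x₀ := by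
      rw [hb.smul_proj, chartPoint_proj, hg]
    have h2 : (⟨_, h1⟩ : Fiber Gr.proj (y' ≫ x₀)) = chartFiber c Gr y' rfl s := by
      apply Gr.subspace_injective
      refine (hb.subspace_eq_map_tr hg (z := chartFiber c Gr y rfl s) (z' := ⟨_, h1⟩) rfl).trans ?_
      rw [subspace_chartFiber, subspace_chartFiber, ← range_conj, conj_chartEnd c hy rfl rfl g hg]
    have h3 : b.smul (toPGL g) (chartPoint c Gr y s) = chartPoint c Gr y' s :=
      congr_arg Subtype.val h2
    rw [← h3, hq'.smul_comp]

end ChartPoint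

end TwistedGrassmannian

namespace TwistedGrassmannian

/-! ### Points with values in fields -/

section FieldPoints

/-- Take the residue field of any point of the fibre product, which is nonempty by surjectivity. -/
theorem exists_spec_field_lift {A B : Scheme.{u}} (f : A ⟶ B) [Surjective f] {L : Type u} [Field L]
    (t : Spec (CommRingCat.of L) ⟶ B) : ∃ (E : Type u) (_ : Field E) (φ : L →+* E)
      (z : Spec (CommRingCat.of E) ⟶ A), z ≫ f = Spec.map (CommRingCat.ofHom φ) ≫ t := by
  let W := Limits.pullback f t
  obtain ⟨w, -⟩ := (Limits.pullback.snd f t).surjective (IsLocalRing.closedPoint L)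
  refine ⟨W.residueField w, inferInstance,
    (Spec.preimage (W.fromSpecResidueField w ≫ Limits.pullback.snd f t)).hom,
    W.fromSpecResidueField w ≫ Limits.pullback.fst f t, ?_⟩
  rw [CommRingCat.ofHom_hom, Spec.map_preimage, Category.assoc, Category.assoc,
    Limits.pullback.condition]

/-- Nullstellensatz: the fibre is locally of finite type over `L`, and the quotient of the ring of a
nonempty affine open subset by a maximal ideal is finite over `L`. -/
theorem exists_finite_field_lift {A B : Scheme.{u}} (f : A ⟶ B) [Surjective f]
    [LocallyOfFiniteType f] {L : Type u} [Field L] (t : Spec (CommRingCat.of L) ⟶ B) :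
    ∃ (E : Type u) (_ : Field E) (φ : L →+* E) (z : Spec (CommRingCat.of E) ⟶ A),
      φ.Finite ∧ z ≫ f = Spec.map (CommRingCat.ofHom φ) ≫ t := by
  let W := Limits.pullback f t
  obtain ⟨w, -⟩ := (Limits.pullback.snd f t).surjective (IsLocalRing.closedPoint L)
  obtain ⟨_, ⟨U, hU, rfl⟩, hw, -⟩ := W.isBasis_affineOpens.exists_subset_of_mem_open
    (Set.mem_univ w) isOpen_univ
  have hU : IsAffineOpen U := hU
  have hnt : Nontrivial Γ(W, U) := by
    rw [← hU.range_fromSpec] at hw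
    obtain ⟨x, -⟩ := hw
    exact PrimeSpectrum.nonempty_iff_nontrivial.1 ⟨x⟩
  let φ := Spec.preimage (hU.fromSpec ≫ Limits.pullback.snd f t)
  have hφ : φ.hom.FiniteType := by
    rw [← HasRingHomProperty.Spec_iff (P := @LocallyOfFiniteType), Spec.map_preimage]
    infer_instance
  obtain ⟨m, hm⟩ := Ideal.exists_maximal Γ(W, U)
  let _ : Field (Γ(W, U) ⧸ m) := Ideal.Quotient.field m
  refine ⟨Γ(W, U) ⧸ m, inferInstance, (Ideal.Quotient.mk m).comp φ.hom,
    Spec.map (CommRingCat.ofHom (Ideal.Quotient.mk m)) ≫ hU.fromSpec ≫ Limits.pullback.fst f t,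
    ?_, ?_⟩
  · rw [RingHom.finite_iff_finiteType_of_isJacobsonRing]
    exact hφ.comp_surjective Ideal.Quotient.mk_surjective
  · rw [CommRingCat.ofHom_comp, Spec.map_comp, CommRingCat.ofHom_hom, Spec.map_preimage]
    simp only [Category.assoc, Limits.pullback.condition]

theorem exists_stalk_hom {Z : Scheme.{u}} {R : Type u} [CommRing R] [IsLocalRing R]
    (f : Spec (CommRingCat.of R) ⟶ Z) {z : Z} (h : f (IsLocalRing.closedPoint R) = z) :
    ∃ φ : Z.presheaf.stalk z →+* R, Spec.map (CommRingCat.ofHom φ) ≫ Z.fromSpecStalk z = f := by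
  subst h
  exact ⟨(Scheme.stalkClosedPointTo f).hom, Scheme.Spec_stalkClosedPointTo_fromSpecStalk f⟩

theorem eq_genericPoint_of_specializes {Z : Scheme.{u}} [IsIntegral Z] {z : Z}
    (h : z ⤳ genericPoint Z) : z = genericPoint Z :=
  (h.antisymm (genericPoint_specializes z)).eq

end FieldPoints

variable {k : Type u} [Field k]

/-! ### A point over a finite extension, the idempotent of rank `j`, and dominance -/

section GenericPoints

variable {n : ℕ} {X Y : Sch k} [IsIntegral Y.left] {a : GroupAction (PGLn k n) X} {q : X ⟶ Y}

theorem exists_specOver_lift (hq : IsFreeQuotient a q) :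
    ∃ (F : Type u) (_ : Field F) (_ : Algebra (FunField Y) F) (x₀ : specOver Y F ⟶ X),
      FiniteDimensional (FunField Y) F ∧ x₀ ≫ q = specOver.str Y F := by
  have := hq.surjective
  have := hq.locallyOfFinitePresentation
  obtain ⟨F, _, φ, z, hφ, hz⟩ := exists_finite_field_lift q.left
    (L := FunField Y) (Y.left.fromSpecStalk (genericPoint Y.left))
  let _ : Algebra (FunField Y) F := φ.toAlgebra
  have hk : z ≫ X.hom = (specOver Y F).hom := by
    rw [← Over.w q, ← Category.assoc, hz, Category.assoc]
    rfl
  exact ⟨F, inferInstance, inferInstance, Over.homMk z hk, hφ, by ext1; exact hz⟩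

variable {F : Type u} [Field F] [Algebra (FunField Y) F] {x₀ : specOver Y F ⟶ X}
variable {r : ℕ} {w : ℤ} {P : WeightBundle a r w} {j : ℕ}

theorem isForm_descended [FiniteDimensional (FunField Y) F] (hq : IsFreeQuotient a q)
    (hx₀ : x₀ ≫ q = specOver.str Y F) (ε : Frame P.toVectorBundle x₀) : IsForm (descended ε) where
  span_eq_top := by
    rw [eq_top_iff]
    rintro m -
    obtain ⟨c, hc, rfl⟩ := exists_eq_sum_smul_mem_descended hq hx₀ ε
      (Module.finBasis (FunField Y) F) m
    exact Submodule.sum_mem _ fun i _ => Submodule.smul_mem _ _ (Submodule.subset_span (hc i))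
  linearIndependent _ hm hli := linearIndependent_of_mem_descended hq hx₀ ε hm hli

/-- The algebra that defines the Brauer class is isomorphic to the algebra of invariant matrices,
whose dimension is `r ^ 2` because it is a form of `M_r(F)`; so the existence of an idempotent
applies to its inclusion in `M_r(F)`. -/
theorem exists_idempotent_mem_descended [FiniteDimensional (FunField Y) F]
    (hq : IsFreeQuotient a q) (hx₀ : x₀ ≫ q = specOver.str Y F) (ε : Frame P.toVectorBundle x₀)
    (hj : 0 < j) (hjr : j ≤ r) {D : CSA.{u, u} (FunField Y)}
    (hD : Module.finrank (FunField Y) D = j ^ 2)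
    (hPD : IsBrauerClassOf P q (Quotient.mk (Brauer.CSA_Setoid _) D)) :
    ∃ e ∈ descended ε, e * e = e ∧ e.rank = j := by
  obtain ⟨A, ⟨α⟩, hA⟩ := hPD
  have : IsSimpleRing (genericEnd P q) := IsSimpleRing.of_ringEquiv α.toRingEquiv inferInstance
  obtain ⟨β⟩ := nonempty_genericEnd_equiv hq hx₀ ε (hj.trans_le hjr)
  have hAD : IsBrauerEquivalent A D := Quotient.exact hA
  have hr : Module.finrank (FunField Y) A = r ^ 2 := by
    rw [← (isForm_descended hq hx₀ ε).finite_and_finrank_eq.2]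
    exact (α.trans β).toLinearEquiv.finrank_eq
  obtain ⟨e, he, hej⟩ := exists_idempotent_rank_eq hAD hj hjr hr hD
    ((descended ε).val.comp (α.trans β).toAlgHom)
  refine ⟨(α.trans β) e, ((α.trans β) e).2, ?_, hej⟩
  have := congr_arg (fun z => (((α.trans β) z : descended ε) : Matrix (Fin r) (Fin r) F)) he
  exact (congr_arg Subtype.val (map_mul (α.trans β) e e)).symm.trans this

instance (R : Type u) [CommRing R] [Algebra (FunField Y) R] : IsAffine (specOver Y R).left :=
  inferInstanceAs (IsAffine (Spec (CommRingCat.of R)))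

/-- Over the generic point of `X / PGL_n` the Grassmannian bundle is not empty. -/
theorem exists_specOver_proj_eq {ε : Frame P.toVectorBundle x₀} {e : Matrix (Fin r) (Fin r) F}
    (heA : e ∈ descended ε) (he : e * e = e) (hej : e.rank = j)
    (Gr : GrassmannianBundle P.toVectorBundle j) :
    ∃ z : specOver Y F ⟶ Gr.total, z ≫ Gr.proj = x₀ := by
  obtain ⟨C, B, hCB, hBC⟩ := exists_rank_factorization he hej
  -- A chart with no parameters: its only point is the image of `e`.
  let c : Chart (descended ε) j :=
    { e := e, e_mem := heA, C := C, B := B, C_mul_B := hCB, B_mul_C := hBC, d := 0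
      v := Fin.elim0, v_mem := fun i => i.elim0, e_mul_v := fun i => i.elim0
      v_mul_e := fun i => i.elim0, linearIndependent := linearIndependent_empty_type }
  exact ⟨chartPoint c Gr (𝟙 _) Fin.elim0, by rw [chartPoint_proj, Category.id_comp]⟩

variable {Gr : GrassmannianBundle P.toVectorBundle j} {Z : Sch k} [IsIntegral Z.left]
  {q' : Gr.total ⟶ Z} {π : Z ⟶ Y}

theorem specOver.str_closedPoint (t : (specOver Y F).left) :
    (specOver.str Y F).left t = genericPoint Y.left := by
  have h1 : (Spec.map (CommRingCat.ofHom (algebraMap (FunField Y) F))) t =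
      IsLocalRing.closedPoint (FunField Y) := Subsingleton.elim (α := PrimeSpectrum (FunField Y)) _ _
  change (Y.left.fromSpecStalk (genericPoint Y.left))
    ((Spec.map (CommRingCat.ofHom (algebraMap (FunField Y) F))) t) = _
  rw [h1]
  exact Scheme.fromSpecStalk_closedPoint

omit [IsIntegral Z.left] in
theorem genericPoint_mem_range (hx₀ : x₀ ≫ q = specOver.str Y F) (hπ : q' ≫ π = Gr.proj ≫ q)
    {z : specOver Y F ⟶ Gr.total} (hz : z ≫ Gr.proj = x₀) :
    genericPoint Y.left ∈ Set.range π.left := by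
  refine ⟨(z ≫ q').left (IsLocalRing.closedPoint F), ?_⟩
  rw [← specOver.str_closedPoint (F := F) (IsLocalRing.closedPoint F), ← hx₀, ← hz, Category.assoc,
    ← hπ, ← Category.assoc]
  rfl

omit [IsIntegral Z.left] in
theorem isDominant_of_genericPoint_mem_range (h : genericPoint Y.left ∈ Set.range π.left) :
    IsDominant π.left := by
  refine ⟨?_⟩
  rw [DenseRange, dense_iff_closure_eq, Set.eq_univ_iff_forall]
  intro y
  obtain ⟨z, hz⟩ := h
  have h1 : π.left z ⤳ y := by rw [hz]; exact genericPoint_specializes y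
  have h2 : ({π.left z} : Set Y.left) ⊆ Set.range π.left := Set.singleton_subset_iff.2 ⟨z, rfl⟩
  exact closure_mono h2 h1.mem_closure

theorem map_genericPoint_eq (h : genericPoint Y.left ∈ Set.range π.left) :
    π.left (genericPoint Z.left) = genericPoint Y.left := by
  obtain ⟨z, hz⟩ := h
  apply eq_genericPoint_of_specializes
  rw [← hz]
  exact (genericPoint_specializes z).map π.left.continuous

end GenericPoints

end TwistedGrassmannian

namespace TwistedGrassmannian

variable {k : Type u} [Field k]

/-! ### The generic point of the quotient of the Grassmannian bundle -/

theorem finrank_eq_of_isSubbundle {R M : Type u} [CommRing R] (hR : IsField R) [AddCommGroup M]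
    [Module R M] [Module.Finite R M] {j : ℕ} {N : Submodule R M} (h : IsSubbundle j N) :
    Module.finrank R N = j := by
  let _ := hR.toField
  have h1 := h.rank_eq ⊥
  rwa [Module.rankAtStalk_eq_finrank_of_free] at h1

section GenericPoint

variable {n : ℕ} {X Y : Sch k} [IsIntegral Y.left] {a : GroupAction (PGLn k n) X} {q : X ⟶ Y}
variable {F : Type u} [Field F] [Algebra (FunField Y) F] {x₀ : specOver Y F ⟶ X}
variable {r : ℕ} {w : ℤ} {P : WeightBundle a r w} {j : ℕ}
variable {Gr : GrassmannianBundle P.toVectorBundle j} {Z : Sch k} [IsIntegral Z.left]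
variable {π : Z ⟶ Y} [Algebra (FunField Y) (FunField Z)]

/-- Every point of the Grassmannian bundle over a field is in a chart. -/
theorem exists_eq_chartPoint [Infinite (FunField Y)] {ε : Frame P.toVectorBundle x₀}
    (hε : IsForm (descended ε)) {e : Matrix (Fin r) (Fin r) F}
    (heA : e ∈ descended ε) (he : e * e = e) (hej : e.rank = j) {E : Type u} [Field E]
    [Algebra (FunField Y) E] (z : specOver Y E ⟶ Gr.total) (y : specOver Y E ⟶ specOver Y F)
    (hz : z ≫ Gr.proj = y ≫ x₀) :
    ∃ (c : Chart (descended ε) j) (s : Fin c.d → E),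
      z = chartPoint c Gr y (fun i => fn (𝟙 _) (s i)) := by
  have hb := fn_id_bijective (Y := Y) E
  have hR : IsField Γ((specOver Y E).left, ⊤) :=
    (RingEquiv.ofBijective _ hb).symm.toMulEquiv.isField (Field.toIsField E)
  let b := (ε.pullback y rfl).basis
  have : Module.Finite Γ((specOver Y E).left, ⊤) (Fiber P.proj (y ≫ x₀)) := Module.Finite.of_basis b
  let z' : Fiber Gr.proj (y ≫ x₀) := ⟨z, hz⟩
  have hz' : IsSubbundle j (Gr.subspace z') := (Gr.bijOn_subspace _).mapsTo trivial
  have hN : Module.finrank Γ((specOver Y E).left, ⊤) ((Gr.subspace z').map b.equivFun.toLinearMap) = j := by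
    rw [LinearEquiv.finrank_map_eq]
    exact finrank_eq_of_isSubbundle hR hz'
  obtain ⟨c, s, hs⟩ := hε.exists_chart_of_isField heA he hej hR (fn y) hN
  choose s' hs' using fun i => hb.2 (s i)
  refine ⟨c, s', ?_⟩
  have h1 : Gr.subspace z' = LinearMap.range (chartEnd c y rfl s) := by
    apply Submodule.map_injective_of_injective b.equivFun.injective
    refine Eq.trans hs ?_
    rw [← LinearMap.range_comp]
    have h2 : b.equivFun.toLinearMap ∘ₗ chartEnd c y rfl s =
        (c.point (fn y) s).mulVecLin ∘ₗ b.equivFun.toLinearMap := by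
      ext1 v
      have h3 := LinearMap.toMatrix_mulVec_repr b b (Matrix.toLin b b (c.point (fn y) s)) v
      rw [LinearMap.toMatrix_toLin] at h3
      exact h3.symm
    rw [h2, LinearMap.range_comp_of_range_eq_top _ (LinearEquiv.range _)]
  simp only [hs']
  exact congr_arg Subtype.val (Gr.subspace_injective (h1.trans
    (subspace_chartFiber c y rfl s).symm))

variable (hθ : Spec.map (CommRingCat.ofHom (algebraMap (FunField Y) (FunField Z))) ≫
  Y.left.fromSpecStalk (genericPoint Y.left) = Z.left.fromSpecStalk (genericPoint Z.left) ≫ π.left)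

/-- The inclusion of the generic point of a scheme over `Y`. -/
noncomputable def genericStr : specOver Y (FunField Z) ⟶ Z :=
  Over.homMk (Z.left.fromSpecStalk (genericPoint Z.left)) (by
    change _ = Spec.map (CommRingCat.ofHom (algebraMap (FunField Y) (FunField Z))) ≫
      Y.left.fromSpecStalk (genericPoint Y.left) ≫ Y.hom
    rw [← Category.assoc, hθ, Category.assoc, Over.w π])

theorem genericStr_comp : genericStr hθ ≫ π = specOver.str Y (FunField Z) := by
  ext1; exact hθ.symm

theorem genericStr_closedPoint (t : (specOver Y (FunField Z)).left) :
    (genericStr hθ).left t = genericPoint Z.left := by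
  have h1 : t = IsLocalRing.closedPoint (FunField Z) :=
    Subsingleton.elim (α := PrimeSpectrum (FunField Z)) _ _
  rw [h1]
  exact Scheme.fromSpecStalk_closedPoint

theorem map_genericStr_injective {R : Type u} [CommRing R] [Algebra (FunField Y) R]
    {φ ψ : FunField Z →ₐ[FunField Y] R}
    (h : specOver.map φ ≫ genericStr hθ = specOver.map ψ ≫ genericStr hθ) : φ = ψ := by
  have h1 : Spec.map (CommRingCat.ofHom φ.toRingHom) = Spec.map (CommRingCat.ofHom ψ.toRingHom) := by
    rw [← cancel_mono (Z.left.fromSpecStalk (genericPoint Z.left))]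
    exact congr_arg (fun f => f.left) h
  have h2 := congr_arg CommRingCat.Hom.hom (Spec.map_injective h1)
  exact AlgHom.ext fun x => RingHom.congr_fun h2 x

/-- A field-valued point that hits the generic point of `Z` factors through the local ring there,
which is the function field; lying over `Y` makes the factorization `k(Y)`-linear. -/
theorem exists_eq_map_genericStr {M : Type u} [Field M] [Algebra (FunField Y) M]
    (f : specOver Y M ⟶ Z) (hf : f ≫ π = specOver.str Y M)
    (hM : f.left (IsLocalRing.closedPoint M) = genericPoint Z.left) :
    ∃ φ : FunField Z →ₐ[FunField Y] M, f = specOver.map φ ≫ genericStr hθ := by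
  obtain ⟨φ, hφ⟩ := exists_stalk_hom (R := M) f.left hM
  have h1 : φ.comp (algebraMap (FunField Y) (FunField Z)) = algebraMap (FunField Y) M := by
    have h2 : Spec.map (CommRingCat.ofHom (φ.comp (algebraMap (FunField Y) (FunField Z)))) =
        Spec.map (CommRingCat.ofHom (algebraMap (FunField Y) M)) := by
      rw [← cancel_mono (Y.left.fromSpecStalk (genericPoint Y.left)), CommRingCat.ofHom_comp,
        Spec.map_comp, Category.assoc, hθ, ← Category.assoc, hφ]
      exact congr_arg (fun f => f.left) hf
    exact congr_arg CommRingCat.Hom.hom (Spec.map_injective h2)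
  refine ⟨{ φ with commutes' := fun x => RingHom.congr_fun h1 x }, ?_⟩
  ext1
  exact hφ.symm

/-- There is a point of the Grassmannian bundle over the generic point of its quotient `Z`, the
image of which in `X` factors through `x₀`. -/
theorem exists_point_over_genericStr (hq : IsFreeQuotient a q)
    (hx₀ : x₀ ≫ q = specOver.str Y F) {b : GroupAction (PGLn k n) Gr.total}
    (hb : IsInducedAction P Gr b) {q' : Gr.total ⟶ Z} (hq' : IsFreeQuotient b q')
    (hπ : q' ≫ π = Gr.proj ≫ q) :
    ∃ (E : Type u) (_ : Field E) (_ : Algebra (FunField Y) E) (φ : FunField Z →ₐ[FunField Y] E)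
      (z : specOver Y E ⟶ Gr.total) (y : specOver Y E ⟶ specOver Y F),
      z ≫ Gr.proj = y ≫ x₀ ∧ z ≫ q' = specOver.map φ ≫ genericStr hθ := by
  have := hq'.surjective
  -- First lift the generic point of `Z` to the Grassmannian bundle, over some field `E₀`.
  obtain ⟨E₀, _, φ₀, z₀, hz₀⟩ := exists_spec_field_lift q'.left
    (L := FunField Z) (Z.left.fromSpecStalk (genericPoint Z.left))
  have hs : Surjective (Spec.map (CommRingCat.ofHom (algebraMap (FunField Y) F))) := by
    refine ⟨fun t => ⟨IsLocalRing.closedPoint F, ?_⟩⟩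
    exact Subsingleton.elim (α := PrimeSpectrum (FunField Y)) _ _
  -- Then enlarge `E₀` to a field `E` that also receives `F` over `k(Y)`.
  obtain ⟨E, _, φ₁, z₁, hz₁⟩ := exists_spec_field_lift
    (Spec.map (CommRingCat.ofHom (algebraMap (FunField Y) F)))
    (Spec.map (CommRingCat.ofHom (φ₀.comp (algebraMap (FunField Y) (FunField Z)))))
  let _ : Algebra (FunField Y) E :=
    (φ₁.comp (φ₀.comp (algebraMap (FunField Y) (FunField Z)))).toAlgebra
  let φ : FunField Z →ₐ[FunField Y] E := { φ₁.comp φ₀ with commutes' := fun _ => rfl }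
  have hE : (specOver Y E).hom = Spec.map (CommRingCat.ofHom φ.toRingHom) ≫
      (specOver Y (FunField Z)).hom := (Over.w (specOver.map φ)).symm
  have hzq : (Spec.map (CommRingCat.ofHom φ₁) ≫ z₀) ≫ q'.left =
      Spec.map (CommRingCat.ofHom φ.toRingHom) ≫ Z.left.fromSpecStalk (genericPoint Z.left) := by
    rw [Category.assoc, hz₀, ← Category.assoc, ← Spec.map_comp, ← CommRingCat.ofHom_comp]
  let z : specOver Y E ⟶ Gr.total := Over.homMk (Spec.map (CommRingCat.ofHom φ₁) ≫ z₀) (by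
    rw [← Over.w q', ← Category.assoc, hzq, Category.assoc, hE, ← Over.w (genericStr hθ)]
    rfl)
  have hz : z ≫ q' = specOver.map φ ≫ genericStr hθ := by ext1; exact hzq
  have hy : z₁ ≫ Spec.map (CommRingCat.ofHom (algebraMap (FunField Y) F)) =
      Spec.map (CommRingCat.ofHom (algebraMap (FunField Y) E)) := by
    rw [hz₁, ← Spec.map_comp, ← CommRingCat.ofHom_comp]
  let y : specOver Y E ⟶ specOver Y F := Over.homMk z₁ (by
    change z₁ ≫ Spec.map (CommRingCat.ofHom (algebraMap (FunField Y) F)) ≫ _ = _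
    rw [← Category.assoc, hy]
    rfl)
  have hyF : y ≫ specOver.str Y F = specOver.str Y E := by
    ext1
    change z₁ ≫ Spec.map (CommRingCat.ofHom (algebraMap (FunField Y) F)) ≫ _ = _
    rw [← Category.assoc, hy]
    rfl
  have hzy : (z ≫ Gr.proj) ≫ q = (y ≫ x₀) ≫ q := by
    rw [Category.assoc, ← hπ, ← Category.assoc, hz, Category.assoc, genericStr_comp,
      specOver.map_str, Category.assoc, hx₀, hyF]
  -- Over `E` the image of `z` in `X` and the point `y ≫ x₀` differ by an element of `GL_n`;
  -- translating `z` by it does not change its image in `Z`.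
  obtain ⟨g, hg⟩ := hq.exists_smul_eq hzy
  exact ⟨E, inferInstance, inferInstance, φ, b.smul (toPGL g) z, y, by rw [hb.smul_proj, hg],
    by rw [hq'.smul_comp, hz]⟩

end GenericPoint

end TwistedGrassmannian

namespace TwistedGrassmannian

variable {k : Type u} [Field k]

/-! ### Descent of the chart to an affine space over the function field -/

/-- Reduces equalities to affine test schemes, the only ones on which the points of the Grassmannian
bundle are described by subspaces. -/
theorem hom_ext_of_isAffine {T Z : Sch k} {v v' : T ⟶ Z}
    (h : ∀ (T' : Sch k) [IsAffine T'.left] (f : T' ⟶ T), f ≫ v = f ≫ v') : v = v' := by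
  ext1
  refine T.left.affineCover.hom_ext _ _ fun i => ?_
  have : IsAffine (Over.mk (T.left.affineCover.f i ≫ T.hom)).left :=
    inferInstanceAs (IsAffine (T.left.affineCover.X i))
  exact congr_arg (fun f => f.left)
    (h (Over.mk (T.left.affineCover.f i ≫ T.hom)) (Over.homMk (T.left.affineCover.f i)))

/-- Descent of morphisms: on the sieve generated by `p`, define the value at `f` by any lift of `f`
to `T'`; the hypothesis on `v` makes this independent of the lift, hence compatible. -/
theorem exists_comp_eq_of_flat {T T' Z : Sch k} (p : T' ⟶ T) [Flat p.left] [Surjective p.left]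
    [QuasiCompact p.left] (v : T' ⟶ Z)
    (hv : ∀ {W : Sch k} (f f' : W ⟶ T'), f ≫ p = f' ≫ p → f ≫ v = f' ≫ v) :
    ∃ v' : T ⟶ Z, p ≫ v' = v := by
  let S : Sieve T := Sieve.generate (Presieve.singleton p)
  have hS' : ∀ {W : Sch k} {f : W ⟶ T}, S f → ∃ u : W ⟶ T', u ≫ p = f := by
    rintro W f ⟨_, u, _, ⟨⟩, h⟩
    exact ⟨u, h⟩
  have hp : S p := Sieve.le_generate _ _ _ (Presieve.singleton_self p)
  have hS : S ∈ (Scheme.fpqcTopology.over (Spec (CommRingCat.of k))) T := by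
    refine mem_fpqc_of_flat p ?_
    rw [(Sieve.mem_iff_pullback_eq_top _).1 hp]
    exact GrothendieckTopology.top_mem _ _
  obtain ⟨v', hv'⟩ := exists_amalgamation S hS (fun f hf => (hS' hf).choose ≫ v)
    (fun f hf g => by
      rw [← Category.assoc]
      refine hv _ _ ?_
      rw [(hS' (S.downward_closed hf g)).choose_spec, Category.assoc, (hS' hf).choose_spec])
  refine ⟨v', (hv' p hp).trans ?_⟩
  rw [hv _ (𝟙 _) ((hS' hp).choose_spec.trans (Category.id_comp _).symm), Category.id_comp]

theorem epi_of_flat {T T' Z : Sch k} (p : T' ⟶ T) [Flat p.left] [Surjective p.left]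
    [QuasiCompact p.left] {v v' : T ⟶ Z} (h : p ≫ v = p ≫ v') : v = v' := by
  let S : Sieve T := Sieve.generate (Presieve.singleton p)
  have hp : S p := Sieve.le_generate _ _ _ (Presieve.singleton_self p)
  have hS : S ∈ (Scheme.fpqcTopology.over (Spec (CommRingCat.of k))) T := by
    refine mem_fpqc_of_flat p ?_
    rw [(Sieve.mem_iff_pullback_eq_top _).1 hp]
    exact GrothendieckTopology.top_mem _ _
  refine hom_ext_of_covering hS ?_
  rintro W f ⟨_, u, _, ⟨⟩, rfl⟩
  rw [Category.assoc, Category.assoc, h]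

section Descent

variable {n : ℕ} {X Y : Sch k} [IsIntegral Y.left] {a : GroupAction (PGLn k n) X} {q : X ⟶ Y}

theorem flat_and_surjective_specOver_map {R R' : Type u} [CommRing R] [Algebra (FunField Y) R]
    [CommRing R'] [Algebra (FunField Y) R'] (φ : R →ₐ[FunField Y] R')
    (h : φ.toRingHom.FaithfullyFlat) :
    Flat (specOver.map φ).left ∧ Surjective (specOver.map φ).left ∧
      QuasiCompact (specOver.map φ).left := by
  obtain ⟨h1, h2⟩ := (flat_and_surjective_SpecMap_iff (CommRingCat.ofHom φ.toRingHom)).mpr h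
  exact ⟨h1, h2, inferInstanceAs (QuasiCompact (Spec.map (CommRingCat.ofHom φ.toRingHom)))⟩

variable {F : Type u} [Field F] [Algebra (FunField Y) F] {x₀ : specOver Y F ⟶ X}
variable {r : ℕ} {w : ℤ} {P : WeightBundle a r w} {j : ℕ}
variable {Gr : GrassmannianBundle P.toVectorBundle j} {Z : Sch k}
variable {ε : Frame P.toVectorBundle x₀} (c : Chart (descended ε) j)

open TensorProduct in
theorem faithfullyFlat_includeLeft {K R F : Type u} [Field K] [CommRing R] [Algebra K R] [Field F]
    [Algebra K F] :
    (Algebra.TensorProduct.includeLeft : R →ₐ[K] R ⊗[K] F).toRingHom.FaithfullyFlat := by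
  have h : (Algebra.TensorProduct.includeLeft : R →ₐ[K] R ⊗[K] F).toRingHom =
    algebraMap R (R ⊗[K] F) := rfl
  rw [h, RingHom.faithfullyFlat_algebraMap_iff]
  infer_instance

/-- The map from the affine space over the function field of `Y` to the quotient `Z` of the
Grassmannian bundle that is obtained by descent from a chart. -/
theorem exists_chartQuotient [FiniteDimensional (FunField Y) F] (hq : IsFreeQuotient a q)
    (hx₀ : x₀ ≫ q = specOver.str Y F) {b : GroupAction (PGLn k n) Gr.total}
    (hb : IsInducedAction P Gr b) {q' : Gr.total ⟶ Z} (hq' : IsFreeQuotient b q') :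
    ∃ G : specOver Y (MvPolynomial (Fin c.d) (FunField Y)) ⟶ Z,
      ∀ (T : Sch k) [IsAffine T.left]
        (p : T ⟶ specOver Y (MvPolynomial (Fin c.d) (FunField Y))) (y : T ⟶ specOver Y F),
        p ≫ specOver.str Y _ = y ≫ specOver.str Y F →
          p ≫ G = chartPoint c Gr y (fun i => fn p (MvPolynomial.X i)) ≫ q' := by
  let R := MvPolynomial (Fin c.d) (FunField Y)
  let i₁ : R →ₐ[FunField Y] TensorProduct (FunField Y) R F := Algebra.TensorProduct.includeLeft
  let i₂ : F →ₐ[FunField Y] TensorProduct (FunField Y) R F := Algebra.TensorProduct.includeRight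
  -- The chart is a map from affine space over `F` to the Grassmannian bundle, with the coordinate
  -- functions as parameters; `H` is its composite with `q'`.
  let H : specOver Y (TensorProduct (FunField Y) R F) ⟶ Z :=
    chartPoint c Gr (specOver.map i₂) (fun i => fn (specOver.map i₁) (MvPolynomial.X i)) ≫ q'
  have hH : ∀ (T : Sch k) [IsAffine T.left] (u : T ⟶ specOver Y (TensorProduct (FunField Y) R F)),
      u ≫ H = chartPoint c Gr (u ≫ specOver.map i₂)
        (fun i => fn (u ≫ specOver.map i₁) (MvPolynomial.X i)) ≫ q' := by
    intro T _ u
    simp only [H, fn_comp]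
    rw [← Category.assoc, comp_chartPoint]
    rfl
  obtain ⟨_, _, _⟩ := flat_and_surjective_specOver_map (Y := Y) i₁ faithfullyFlat_includeLeft
  -- Two points of affine space over `F` with the same image over `k(Y)` have the same parameters,
  -- so their chart points agree in `Z`. This is the descent condition.
  obtain ⟨G, hG⟩ := exists_comp_eq_of_flat (specOver.map i₁) H (fun {W} f f' hf => by
    refine hom_ext_of_isAffine fun T _ g => ?_
    have h1 : (g ≫ f) ≫ specOver.map i₁ = (g ≫ f') ≫ specOver.map i₁ := by
      rw [Category.assoc, hf, Category.assoc]
    have h2 : ((g ≫ f) ≫ specOver.map i₂) ≫ specOver.str Y F =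
        ((g ≫ f') ≫ specOver.map i₂) ≫ specOver.str Y F := by
      have := congr_arg (· ≫ specOver.str Y R) h1
      simpa only [Category.assoc, specOver.map_str] using this
    refine (Category.assoc _ _ _).symm.trans (Eq.trans ?_ (Category.assoc _ _ _))
    rw [hH T, hH T, chartPoint_comp_eq_iff c hq hx₀ hb hq' h2, h1])
  refine ⟨G, fun T _ p y hpy => ?_⟩
  obtain ⟨u, rfl, rfl⟩ := exists_map_tensor p y hpy
  rw [Category.assoc, hG, hH]

variable {G : specOver Y (MvPolynomial (Fin c.d) (FunField Y)) ⟶ Z}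

/-- The map `G` obtained by descent is injective on points with values in algebras. -/
theorem map_chartQuotient_injective [FiniteDimensional (FunField Y) F] (hq : IsFreeQuotient a q)
    (hx₀ : x₀ ≫ q = specOver.str Y F) {b : GroupAction (PGLn k n) Gr.total}
    (hb : IsInducedAction P Gr b) {q' : Gr.total ⟶ Z} (hq' : IsFreeQuotient b q')
    (hG : ∀ (T : Sch k) [IsAffine T.left]
      (p : T ⟶ specOver Y (MvPolynomial (Fin c.d) (FunField Y))) (y : T ⟶ specOver Y F),
      p ≫ specOver.str Y _ = y ≫ specOver.str Y F →
        p ≫ G = chartPoint c Gr y (fun i => fn p (MvPolynomial.X i)) ≫ q')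
    {R : Type u} [CommRing R] [Algebra (FunField Y) R]
    {φ ψ : MvPolynomial (Fin c.d) (FunField Y) →ₐ[FunField Y] R}
    (h : specOver.map φ ≫ G = specOver.map ψ ≫ G) : φ = ψ := by
  let i₁ : R →ₐ[FunField Y] TensorProduct (FunField Y) R F := Algebra.TensorProduct.includeLeft
  let y : specOver Y (TensorProduct (FunField Y) R F) ⟶ specOver Y F :=
    specOver.map Algebra.TensorProduct.includeRight
  -- Over `R ⊗ F` both points come from the chart, where the image in `Z` determines the parameters;
  -- and `R → R ⊗ F` is injective.
  have h1 := congr_arg (specOver.map i₁ ≫ ·) h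
  simp only [← Category.assoc, specOver.map_comp] at h1
  rw [hG _ _ y (by rw [specOver.map_str, specOver.map_str]),
    hG _ _ y (by rw [specOver.map_str, specOver.map_str]),
    chartPoint_comp_eq_iff c hq hx₀ hb hq' rfl] at h1
  apply MvPolynomial.algHom_ext
  intro i
  have h2 := congr_fun h1 i
  simp only [fn_map] at h2
  have hi₁ : Function.Injective i₁ := by
    have : i₁.toRingHom.FaithfullyFlat := faithfullyFlat_includeLeft
    exact this.injective
  exact hi₁ ((fn_id_bijective _).1 h2)

theorem chartQuotient_comp [FiniteDimensional (FunField Y) F]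
    (hx₀ : x₀ ≫ q = specOver.str Y F) {q' : Gr.total ⟶ Z} {π : Z ⟶ Y} (hπ : q' ≫ π = Gr.proj ≫ q)
    (hG : ∀ (T : Sch k) [IsAffine T.left]
      (p : T ⟶ specOver Y (MvPolynomial (Fin c.d) (FunField Y))) (y : T ⟶ specOver Y F),
      p ≫ specOver.str Y _ = y ≫ specOver.str Y F →
        p ≫ G = chartPoint c Gr y (fun i => fn p (MvPolynomial.X i)) ≫ q') :
    G ≫ π = specOver.str Y _ := by
  let R := MvPolynomial (Fin c.d) (FunField Y)
  let i₁ : R →ₐ[FunField Y] TensorProduct (FunField Y) R F := Algebra.TensorProduct.includeLeft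
  obtain ⟨_, _, _⟩ := flat_and_surjective_specOver_map (Y := Y) i₁ faithfullyFlat_includeLeft
  refine epi_of_flat (specOver.map i₁) ?_
  rw [← Category.assoc, hG _ _ (specOver.map Algebra.TensorProduct.includeRight)
    (by rw [specOver.map_str, specOver.map_str]), Category.assoc, hπ, ← Category.assoc,
    chartPoint_proj, Category.assoc, hx₀, specOver.map_str, specOver.map_str]

end Descent

end TwistedGrassmannian

namespace TwistedGrassmannian

variable {k : Type u} [Field k]

/-! ### The function field of the quotient of the Grassmannian bundle -/

/-- If `x` is not in `L`, choose an `L`-linear functional `f` with `f 1 = 0` and `f x ≠ 0`; then `id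
⊗ f` separates `x ⊗ 1` from `1 ⊗ x`. -/
theorem exists_algebraMap_eq_of_tmul_eq {L E : Type u} [Field L] [Field E] [Algebra L E] {x : E}
    (h : x ⊗ₜ[L] (1 : E) = (1 : E) ⊗ₜ[L] x) : ∃ l : L, algebraMap L E l = x := by
  by_contra! hx
  obtain ⟨f, hfx, hf⟩ := Submodule.exists_dual_map_eq_bot_of_notMem
    (p := Submodule.span L {(1 : E)}) (x := x)
    (by
      rw [Submodule.mem_span_singleton]
      rintro ⟨l, hl⟩
      exact hx l (by rw [Algebra.algebraMap_eq_smul_one, hl])) inferInstance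
  have hf1 : f 1 = 0 := by
    have := Submodule.mem_map_of_mem (f := f) (Submodule.mem_span_singleton_self (R := L) (1 : E))
    rwa [hf, Submodule.mem_bot] at this
  have h1 := congr_arg (TensorProduct.rid L E ∘ LinearMap.lTensor E f) h
  simp only [Function.comp_apply, LinearMap.lTensor_tmul, TensorProduct.rid_tmul, hf1, zero_smul]
    at h1
  exact hfx ((smul_eq_zero.mp h1.symm).resolve_right one_ne_zero)

section Final

variable {n : ℕ} {X Y : Sch k} [IsIntegral Y.left] {a : GroupAction (PGLn k n) X} {q : X ⟶ Y}
variable {F : Type u} [Field F] [Algebra (FunField Y) F] {x₀ : specOver Y F ⟶ X}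
variable {r : ℕ} {w : ℤ} {P : WeightBundle a r w} {j : ℕ}
variable {Gr : GrassmannianBundle P.toVectorBundle j} {Z : Sch k} [IsIntegral Z.left]
variable {π : Z ⟶ Y} [Algebra (FunField Y) (FunField Z)]

/-- Descent of a point from `E` to `k(Z)`: the two pullbacks of `ψ` to `E ⊗ E` over `k(Z)` have the
same image under `G`, so they are equal by injectivity, and the coordinates of `ψ` lie in `k(Z)`. -/
theorem exists_map_comp_eq_genericStr {d : ℕ}
    {G : specOver Y (MvPolynomial (Fin d) (FunField Y)) ⟶ Z}
    (hinj : ∀ {R : Type u} [CommRing R] [Algebra (FunField Y) R]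
      {φ ψ : MvPolynomial (Fin d) (FunField Y) →ₐ[FunField Y] R},
      specOver.map φ ≫ G = specOver.map ψ ≫ G → φ = ψ)
    {s : specOver Y (FunField Z) ⟶ Z} {E : Type u} [Field E] [Algebra (FunField Y) E]
    (φ : FunField Z →ₐ[FunField Y] E) (ψ : MvPolynomial (Fin d) (FunField Y) →ₐ[FunField Y] E)
    (h : specOver.map ψ ≫ G = specOver.map φ ≫ s) :
    ∃ α : MvPolynomial (Fin d) (FunField Y) →ₐ[FunField Y] FunField Z, specOver.map α ≫ G = s := by
  let _ : Algebra (FunField Z) E := φ.toRingHom.toAlgebra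
  have : IsScalarTower (FunField Y) (FunField Z) E :=
    IsScalarTower.of_algebraMap_eq fun x => (φ.commutes x).symm
  let i₁ : E →ₐ[FunField Y] TensorProduct (FunField Z) E E :=
    (Algebra.TensorProduct.includeLeft : E →ₐ[FunField Z] _).restrictScalars (FunField Y)
  let i₂ : E →ₐ[FunField Y] TensorProduct (FunField Z) E E :=
    (Algebra.TensorProduct.includeRight : E →ₐ[FunField Z] _).restrictScalars (FunField Y)
  have hi : i₁.comp φ = i₂.comp φ := by
    ext l
    exact ((Algebra.TensorProduct.includeLeft : E →ₐ[FunField Z] _).commutes l).trans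
      ((Algebra.TensorProduct.includeRight :
        E →ₐ[FunField Z] TensorProduct (FunField Z) E E).commutes l).symm
  have h1 : i₁.comp ψ = i₂.comp ψ := by
    apply hinj
    rw [← specOver.map_comp, ← specOver.map_comp, Category.assoc, Category.assoc, h,
      ← Category.assoc, ← Category.assoc, specOver.map_comp, specOver.map_comp, hi]
  choose x hx using fun i => exists_algebraMap_eq_of_tmul_eq (L := FunField Z)
    (x := ψ (MvPolynomial.X i)) (AlgHom.congr_fun h1 (MvPolynomial.X i))
  refine ⟨MvPolynomial.aeval x, ?_⟩
  have h2 : φ.comp (MvPolynomial.aeval x) = ψ := by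
    apply MvPolynomial.algHom_ext
    intro i
    rw [AlgHom.comp_apply, MvPolynomial.aeval_X]
    exact hx i
  have h3 : φ.toRingHom.FaithfullyFlat :=
    RingHom.faithfullyFlat_algebraMap_iff.mpr (inferInstanceAs (Module.FaithfullyFlat (FunField Z) E))
  obtain ⟨_, _, _⟩ := flat_and_surjective_specOver_map φ h3
  refine epi_of_flat (specOver.map φ) ?_
  rw [← Category.assoc, specOver.map_comp, h2, h]

/-- If the generic point of `Z` is in the image of the map `G`, which is injective on points, then
the function field of `Z` is purely transcendental. -/
theorem isPurelyTranscendental_of_map_comp_eq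
    (hθ : Spec.map (CommRingCat.ofHom (algebraMap (FunField Y) (FunField Z))) ≫
      Y.left.fromSpecStalk (genericPoint Y.left) =
        Z.left.fromSpecStalk (genericPoint Z.left) ≫ π.left) {d : ℕ}
    {G : specOver Y (MvPolynomial (Fin d) (FunField Y)) ⟶ Z}
    (hinj : ∀ {R : Type u} [CommRing R] [Algebra (FunField Y) R]
      {φ ψ : MvPolynomial (Fin d) (FunField Y) →ₐ[FunField Y] R},
      specOver.map φ ≫ G = specOver.map ψ ≫ G → φ = ψ)
    (hG : G ≫ π = specOver.str Y _)
    (α : MvPolynomial (Fin d) (FunField Y) →ₐ[FunField Y] FunField Z)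
    (hα : specOver.map α ≫ G = genericStr hθ) :
    ∃ (x : Fin d → FunField Z), AlgebraicIndependent (FunField Y) x ∧
      IntermediateField.adjoin (FunField Y) (Set.range x) = ⊤ := by
  have hstr : ∀ {M : Type u} [Field M] [Algebra (FunField Y) M]
      (β : MvPolynomial (Fin d) (FunField Y) →ₐ[FunField Y] M),
      (specOver.map β ≫ G) ≫ π = specOver.str Y M := fun β => by
    rw [Category.assoc, hG, specOver.map_str]
  let x : Fin d → FunField Z := fun i => α (MvPolynomial.X i)
  have hαx : α = MvPolynomial.aeval x := MvPolynomial.algHom_ext fun i => by simp [x]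
  refine ⟨x, ?_, ?_⟩
  -- Independence: the generic point of affine space specializes to the point `α`, so its image
  -- specializes to the generic point of `Z` and equals it. This gives `ι : k(Z) → M`, and
  -- injectivity of `G` forces `β = ι ∘ α`; as `β` is injective, so is `α`.
  · let M := FractionRing (MvPolynomial (Fin d) (FunField Y))
    let β : MvPolynomial (Fin d) (FunField Y) →ₐ[FunField Y] M := Algebra.algHom _ _ _
    have hβ : Function.Injective β := IsFractionRing.injective _ M
    have hM : (specOver.map β ≫ G).left (IsLocalRing.closedPoint M) = genericPoint Z.left := by
      apply eq_genericPoint_of_specializes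
      have h1 : (specOver.map β).left (IsLocalRing.closedPoint M) ⤳
          (specOver.map α).left (IsLocalRing.closedPoint (FunField Z)) := by
        refine (PrimeSpectrum.le_iff_specializes _ _).1 ?_
        intro f hf
        have h2 : β f ∈ IsLocalRing.maximalIdeal M := hf
        rw [IsLocalRing.maximalIdeal_eq_bot, Ideal.mem_bot, map_eq_zero_iff β hβ] at h2
        rw [h2]
        exact zero_mem _
      have h3 := h1.map G.left.continuous
      have h4 : G.left ((specOver.map α).left (IsLocalRing.closedPoint (FunField Z))) =
          genericPoint Z.left := by
        refine Eq.trans ?_ (genericStr_closedPoint hθ (IsLocalRing.closedPoint (FunField Z)))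
        rw [← hα]
        rfl
      rw [h4] at h3
      exact h3
    obtain ⟨ι, hι⟩ := exists_eq_map_genericStr hθ (specOver.map β ≫ G) (hstr β) hM
    have h1 : β = ι.comp α := by
      apply hinj
      rw [hι, ← specOver.map_comp, Category.assoc, hα]
    have h2 : Function.Injective α := by
      have h3 : Function.Injective (ι ∘ α) := by
        have : (ι ∘ α : _ → M) = β := by rw [h1]; rfl
        rwa [this]
      exact h3.of_comp
    rw [AlgebraicIndependent, ← hαx]
    exact h2
  -- Generation: the point `α` is defined over the subfield `L'` generated by the coordinates and
  -- still maps to the generic point of `Z`. This gives `κ : k(Z) → L'` whose composite with the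
  -- inclusion is the identity.
  · let L' := IntermediateField.adjoin (FunField Y) (Set.range x)
    let α' : MvPolynomial (Fin d) (FunField Y) →ₐ[FunField Y] L' :=
      MvPolynomial.aeval fun i => ⟨x i, IntermediateField.subset_adjoin _ _ ⟨i, rfl⟩⟩
    have hα' : L'.val.comp α' = α := MvPolynomial.algHom_ext fun i => by simp [α', x]
    have hL : (specOver.map α' ≫ G).left (IsLocalRing.closedPoint L') = genericPoint Z.left := by
      refine Eq.trans ?_ (genericStr_closedPoint hθ (IsLocalRing.closedPoint (FunField Z)))
      have h1 : (specOver.map L'.val).left (IsLocalRing.closedPoint (FunField Z)) =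
        (IsLocalRing.closedPoint L' : (Spec (CommRingCat.of L'))) :=
          Subsingleton.elim (α := PrimeSpectrum L') _ _
      rw [← hα, ← hα', ← specOver.map_comp, Category.assoc, ← h1]
      rfl
    obtain ⟨κ, hκ⟩ := exists_eq_map_genericStr hθ (specOver.map α' ≫ G) (hstr α') hL
    have h1 : L'.val.comp κ = AlgHom.id (FunField Y) (FunField Z) := by
      apply map_genericStr_injective hθ
      rw [← specOver.map_comp, Category.assoc, ← hκ, ← Category.assoc, specOver.map_comp, hα', hα]
      have h2 : specOver.map (AlgHom.id (FunField Y) (FunField Z)) = 𝟙 _ := by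
        ext1
        exact Spec.map_id _
      rw [h2, Category.id_comp]
    rw [eq_top_iff]
    rintro l -
    have h2 := AlgHom.congr_fun h1 l
    change ((κ l : L') : FunField Z) = l at h2
    rw [← h2]
    exact (κ l).2

end Final

end TwistedGrassmannian

/-! ### Conclusion: the generic point of the quotient lies in a chart -/

namespace TwistedGrassmannian

theorem infinite_funField {k : Type u} [Field k] [Infinite k] (Y : Sch k) [IsIntegral Y.left] :
    Infinite (FunField Y) := by
  let f : k →+* FunField Y :=
    (Spec.preimage (Y.left.fromSpecStalk (genericPoint Y.left) ≫ Y.hom)).hom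
  exact Infinite.of_injective f f.injective

/-- The function field of the quotient of the Grassmannian bundle is purely transcendental over
that of the base. -/
theorem exists_adjoin_eq_top {k : Type u} [Field k] [Infinite k] {n : ℕ} {X Y : Sch k}
    [IsIntegral Y.left] {a : GroupAction (PGLn k n) X} {q : X ⟶ Y}
    (hq : IsFreeQuotient a q) {r : ℕ} {w : ℤ} {P : WeightBundle a r w} {j : ℕ}
    {Gr : GrassmannianBundle P.toVectorBundle j} {b : GroupAction (PGLn k n) Gr.total}
    (hb : IsInducedAction P Gr b) {Z : Sch k} [IsIntegral Z.left] {q' : Gr.total ⟶ Z}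
    (hq' : IsFreeQuotient b q') {π : Z ⟶ Y} (hπ : q' ≫ π = Gr.proj ≫ q)
    {F : Type u} [Field F] [Algebra (FunField Y) F] [FiniteDimensional (FunField Y) F]
    {x₀ : specOver Y F ⟶ X} (hx₀ : x₀ ≫ q = specOver.str Y F) {ε : Frame P.toVectorBundle x₀}
    {e : Matrix (Fin r) (Fin r) F} (heA : e ∈ descended ε) (he : e * e = e) (hej : e.rank = j)
    [Algebra (FunField Y) (FunField Z)]
    (hθ : Spec.map (CommRingCat.ofHom (algebraMap (FunField Y) (FunField Z))) ≫
      Y.left.fromSpecStalk (genericPoint Y.left) =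
        Z.left.fromSpecStalk (genericPoint Z.left) ≫ π.left) :
    ∃ (d : ℕ) (x : Fin d → FunField Z), AlgebraicIndependent (FunField Y) x ∧
      IntermediateField.adjoin (FunField Y) (Set.range x) = ⊤ := by
  have := infinite_funField Y
  obtain ⟨E, _, _, φ, z, y, hzy, hzq⟩ := exists_point_over_genericStr hθ hq hx₀ hb hq' hπ
  obtain ⟨c, s, hz⟩ := exists_eq_chartPoint (isForm_descended hq hx₀ ε) heA he hej z y hzy
  obtain ⟨G, hG⟩ := exists_chartQuotient c hq hx₀ hb hq'
  have hy : y ≫ specOver.str Y F = specOver.str Y E := by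
    rw [← hx₀, ← Category.assoc, ← hzy, Category.assoc, ← hπ, ← Category.assoc, hzq,
      Category.assoc, genericStr_comp, specOver.map_str]
  -- Over `E` the generic point of `Z` is the image under `G` of the point of affine space with
  -- coordinates `s`; it remains to descend these coordinates to `k(Z)`.
  have hψ : specOver.map (MvPolynomial.aeval s) ≫ G = specOver.map φ ≫ genericStr hθ := by
    rw [hG _ (specOver.map (MvPolynomial.aeval s)) y (by rw [specOver.map_str, hy]), ← hzq, hz]
    simp only [fn_map, MvPolynomial.aeval_X]
  obtain ⟨α, hα⟩ := exists_map_comp_eq_genericStr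
    (map_chartQuotient_injective c hq hx₀ hb hq' hG) φ _ hψ
  exact ⟨c.d, isPurelyTranscendental_of_map_comp_eq hθ
    (map_chartQuotient_injective c hq hx₀ hb hq' hG) (chartQuotient_comp c hx₀ hπ hG) α hα⟩

end TwistedGrassmannian

theorem mainTheorem8 {k : Type u} [Field k] [IsAlgClosed k] {n : ℕ} (hn : 0 < n)
    -- a free action of `PGL_n` on a variety `X`, with quotient variety `q : X ⟶ Y`
    {X Y : Sch k} [IsVariety X] [IsVariety Y] (a : GroupAction (PGLn k n) X) (q : X ⟶ Y)
    (hq : IsFreeQuotient a q)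
    -- a vector bundle `P` of weight `w` over `X`
    {r : ℕ} {w : ℤ} (P : WeightBundle a r w)
    {j : ℕ} (hj : 0 < j) (hjr : j ≤ r)
    -- the Brauer class of `P` is represented by the central simple algebra `D` of dimension `j ^ 2`
    (D : CSA.{u, u} Y.left.functionField)
    (hD : Module.finrank Y.left.functionField D = j ^ 2)
    (hPD : IsBrauerClassOf P q (Quotient.mk (Brauer.CSA_Setoid _) D))
    -- the Grassmannian bundle `Gr_j(P)`, the induced action, and the quotient `Z = Gr_j(P) / PGL_n`
    (Gr : GrassmannianBundle P.toVectorBundle j) (b : GroupAction (PGLn k n) Gr.total)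
    (hb : IsInducedAction P Gr b)
    {Z : Sch k} [IsVariety Z] (q' : Gr.total ⟶ Z) (hq' : IsFreeQuotient b q')
    -- the induced map between the quotients
    (π : Z ⟶ Y) (hπ : q' ≫ π = Gr.proj ≫ q) :
    IsBirationallyLinear π.left.toRationalMap := by
  have : Infinite k := IsAlgClosed.instInfinite
  obtain ⟨F, _, _, x₀, _, hx₀⟩ := exists_specOver_lift hq
  obtain ⟨ε⟩ := exists_frame_of_isLocalRing (R := CommRingCat.of F) P.toVectorBundle (Iso.refl _) x₀
  obtain ⟨e, heA, he, hej⟩ := exists_idempotent_mem_descended hq hx₀ ε hj hjr hD hPD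
  obtain ⟨z, hz⟩ := exists_specOver_proj_eq heA he hej Gr
  have hy := genericPoint_mem_range hx₀ hπ hz
  have := isDominant_of_genericPoint_mem_range hy
  refine ⟨inferInstance, ?_⟩
  let f : Spec (CommRingCat.of (FunField Z)) ⟶ Y.left :=
    Z.left.fromSpecStalk (genericPoint Z.left) ≫ π.left
  -- The generic point of `Y` is in the image of `π`, so `π` sends generic point to generic point,
  -- and `θ` is the induced extension of function fields.
  obtain ⟨θ, hθ⟩ := exists_stalk_hom f (z := genericPoint Y.left)
    ((congr_arg π.left Scheme.fromSpecStalk_closedPoint).trans (map_genericPoint_eq hy))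
  refine ⟨CommRingCat.ofHom θ, ?_, ?_⟩
  · exact hθ.trans (Scheme.PartialMap.fromSpecStalkOfMem_toPartialMap _ _).symm
  · let _ : Algebra (FunField Y) (FunField Z) := θ.toAlgebra
    obtain ⟨d, x, hx⟩ := exists_adjoin_eq_top hq hb hq' hπ hx₀ heA he hej hθ
    exact ⟨Fin d, x, hx⟩
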